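/- Let $S$ be an associative unital ring and let $A=\bigoplus_{n\ge 0}A^n$ be a graded $S$-ring which is connected ($A^0=S$) and strongly graded ($A^nA^m=A^{n+m}$ for all $n,m$). All tensor products are over $S$. Let $T=T_S(A^1)$ be the tensor ring of the $S$-bimodule $A^1$, $\pi_A:T\to A$ the canonical map and $I=\ker\pi_A$. Let $R\subseteq T$ be a bimodule of relations for $A$, that is, a graded $S$-subbimodule with $R\oplus(IT^1+T^1I)=I$, and suppose that $A^1$ and $R$ are projective as left $S$-modules. Let $\alpha:R\to T$ be a morphism of filtered $S$-bimodules (for the filtration $T^{\le n}=\bigoplus_{k\le n}T^k$) whose degree-zero component is the inclusion. For $r\in R\cap T^n$ let $\alpha_i(r)\in T^{n-i}$ be the component of $\alpha(r)$ of degree $n-i$ and put $\alpha_z(r)=\sum_i\alpha_i(r)z^i$; extend $\alpha_z$ additively to $R$. Let $P_z=\alpha_z(R)\subseteq T[z]$, where $z$ is a central indeterminate of degree $1$, let $D=T[z]/\langle P_z\rangle$ be the central extension of $A$ associated to $\alpha$, and let $\pi:D\to A$ be the projection with $z\mapsto 0$. The rings $A$ and $D$ act on $S$ through the projections $A\to A^0=S$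 and $D\to A\to S$. For an element $x$ of a tensor ring $T_S(V)$ write $\sum x_{T}\otimes x_{V}\in T_S(V)\otimes V$ for the preimage of the positive-degree part of $x$ under multiplication. Let $$A\otimes R\xrightarrow{d_2}A\otimes A^1\xrightarrow{d_1}A\to S\to 0,\qquad d_1(a\otimes b)=ab,\quad d_2(a\otimes r)=\sum a\,\pi_A(r_{T})\otimes r_{A^1}.$$ Let $T_D=T_S(D^1)$, let $\pi_D:T_D\to D$ be the canonical map, $\zeta:T\to T_D$ the $S$-ring morphism induced by $A^1\to D^1$, and $\lambda:T[z]\to T_D$ the map $\sum_i t_iz^i\mapsto\sum_i\zeta(t_i)\otimes z^{\otimes i}$. Put $[z,A^1]=\{z\otimes a-a\otimes z: a\in A^1\}$, $R_D=\lambda(P_z)+[z,A^1]\subseteq T_D$, and consider $$D\otimes R_D\xrightarrow{d_2'}D\otimes D^1\xrightarrow{d_1'}D\to S\to 0,\qquad d_1'(x\otimes y)=xy,\quad d_2'(x\otimes r)=\sum x\,\pi_D(r_{T_D})\otimes r_{D^1}.\tag{1}$$ A sequence ${}^1M_*$ is formed as follows from graded $D$-linear maps $\partial_1:D\otimes A^1\to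 D$ and $\partial_2:D\otimes R\to D\otimes A^1$ lifting $d_1$ and $d_2$ along $\pi$, and a graded $D$-linear map $f_2:D\otimes R\to D(-1)$ with $\partial_1\partial_2=-z f_2$: it is $M_2\xrightarrow{\delta_2}M_1\xrightarrow{\delta_1}M_0\to 0$ with $M_2=(D\otimes R)\oplus(D\otimes A^1)(-1)$, $M_1=(D\otimes A^1)\oplus D(-1)$, $M_0=D$, $$\delta_1(x,y)=\partial_1(x)+zy,\qquad \delta_2(x,y)=(\partial_2(x)-zy,\ \partial_1(y)+f_2(x)).$$ Then: 1. The sequence $A\otimes R\to A\otimes A^1\to A\to S\to0$ is the start of a projective resolution of $S$ over $A$ (it is exact and its terms $A\otimes R$, $A\otimes A^1$, $A$ are projective). 2. The sum defining $R_D$ is direct, $R_D=\lambda(P_z)\oplus[z,A^1]$, and (1) is the start of a projective resolution of $S$ over $D$. 3. Maps $\partial_1,\partial_2,f_2$ as above exist, and for every choice of them the sequence ${}^1M_*$ is isomorphic to (1): there are isomorphisms of graded left $D$-modules $\vartheta_1:M_1\to D\otimes D^1$ and $\vartheta_2:M_2\to D\otimes R_D$ with $d_1'\vartheta_1=\delta_1$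 and $d_2'\vartheta_2=\vartheta_1\delta_2$. In particular, $H_1({}^1M_*)=0$. -/

import Mathlib

open scoped TensorProduct DirectSum Polynomial
open MulOpposite

noncomputable section

namespace PBW

/-! ### Rings over a noncommutative base ring

An `S`-ring `B` (a ring with a unital ring homomorphism `S → B`, `s ↦ s • 1`) is encoded by
`[Ring B] [Module S B] [IsScalarTower S B B]`. The left action of `S` on `B` is `s • b`, the right
action is `b * (s • 1)`. -/

section SRing

variable {S B : Type*} [Ring S] [Ring B] [Module S B] [IsScalarTower S B B]

/-- A left `S`-submodule of an `S`-ring which is stable under the right action of `S` as well,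
i.e. an `S`-subbimodule. -/
class IsSubbimodule (V : Submodule S B) : Prop where
  mul_mem : ∀ v ∈ V, ∀ s : S, v * (s • (1 : B)) ∈ V

/-- The right `S`-module structure of a subbimodule. -/
instance IsSubbimodule.rightModule (V : Submodule S B) [IsSubbimodule V] : Module Sᵐᵒᵖ V where
  smul s v := ⟨(v : B) * (s.unop • (1 : B)), IsSubbimodule.mul_mem _ v.2 _⟩
  one_smul v := Subtype.ext (by change (v : B) * ((1 : S) • (1 : B)) = v; simp)
  mul_smul s t v := Subtype.ext (by
    change (v : B) * ((t.unop * s.unop) • (1 : B))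
      = (v : B) * (t.unop • (1 : B)) * (s.unop • (1 : B))
    rw [mul_assoc, smul_mul_assoc, one_mul, mul_smul])
  smul_zero s := Subtype.ext (by change (0 : B) * (s.unop • (1 : B)) = 0; simp)
  smul_add s v w := Subtype.ext (by
    change ((v : B) + w) * (s.unop • (1 : B))
      = (v : B) * (s.unop • (1 : B)) + (w : B) * (s.unop • (1 : B))
    rw [add_mul])
  add_smul s t v := Subtype.ext (by
    change (v : B) * ((s.unop + t.unop) • (1 : B))
      = (v : B) * (s.unop • (1 : B)) + (v : B) * (t.unop • (1 : B))
    rw [add_smul, mul_add])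
  zero_smul v := Subtype.ext (by change (v : B) * ((0 : S) • (1 : B)) = 0; simp)

theorem IsSubbimodule.coe_op_smul (V : Submodule S B) [IsSubbimodule V] (s : S) (v : V) :
    ((op s • v : V) : B) = (v : B) * (s • (1 : B)) := rfl

instance IsSubbimodule.smulCommClass (V : Submodule S B) [IsSubbimodule V] :
    SMulCommClass S Sᵐᵒᵖ V where
  smul_comm s t v := Subtype.ext (smul_mul_assoc s (v : B) (t.unop • (1 : B))).symm

/-- The components of a graded `S`-ring are subbimodules. -/
instance IsSubbimodule.of_gradedRing (𝒜 : ℕ → Submodule S B) [GradedRing 𝒜] (n : ℕ) :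
    IsSubbimodule (𝒜 n) where
  mul_mem v hv s := by
    simpa using SetLike.mul_mem_graded hv ((𝒜 0).smul_mem s (SetLike.one_mem_graded 𝒜))

end SRing

/-! ### The tensor ring of a bimodule -/

section TensorRing

variable (S V : Type*) [Ring S] [AddCommGroup V] [Module S V] [Module Sᵐᵒᵖ V]

/-- The defining relations of the tensor ring: the ring structure of `S`, the additive structure
of `V`, and the two actions of `S` on `V`. -/
inductive TensorRing.Rel : FreeAlgebra ℤ (S ⊕ V) → FreeAlgebra ℤ (S ⊕ V) → Prop
  | one : Rel (FreeAlgebra.ι ℤ (Sum.inl 1)) 1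
  | add_scalar (s t : S) : Rel (FreeAlgebra.ι ℤ (Sum.inl (s + t)))
      (FreeAlgebra.ι ℤ (Sum.inl s) + FreeAlgebra.ι ℤ (Sum.inl t))
  | mul_scalar (s t : S) : Rel (FreeAlgebra.ι ℤ (Sum.inl (s * t)))
      (FreeAlgebra.ι ℤ (Sum.inl s) * FreeAlgebra.ι ℤ (Sum.inl t))
  | add (v w : V) : Rel (FreeAlgebra.ι ℤ (Sum.inr (v + w)))
      (FreeAlgebra.ι ℤ (Sum.inr v) + FreeAlgebra.ι ℤ (Sum.inr w))
  | left (s : S) (v : V) : Rel (FreeAlgebra.ι ℤ (Sum.inr (s • v)))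
      (FreeAlgebra.ι ℤ (Sum.inl s) * FreeAlgebra.ι ℤ (Sum.inr v))
  | right (s : S) (v : V) : Rel (FreeAlgebra.ι ℤ (Sum.inr (op s • v)))
      (FreeAlgebra.ι ℤ (Sum.inr v) * FreeAlgebra.ι ℤ (Sum.inl s))

/-- The tensor ring `T_S(V)` of an `S`-bimodule `V`: the universal ring under `S` equipped with an
`S`-bimodule map from `V`. -/
def TensorRing : Type _ := RingQuot (TensorRing.Rel S V)

namespace TensorRing

instance : Ring (TensorRing S V) := inferInstanceAs (Ring (RingQuot (TensorRing.Rel S V)))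

/-- The quotient map from the free ring. -/
def mk : FreeAlgebra ℤ (S ⊕ V) →+* TensorRing S V := RingQuot.mkRingHom _

variable {S V} in
theorem mk_rel {x y : FreeAlgebra ℤ (S ⊕ V)} (h : Rel S V x y) : mk S V x = mk S V y :=
  RingQuot.mkRingHom_rel h

/-- The structure map `S → T_S(V)`. -/
def inS : S →+* TensorRing S V where
  toFun s := mk S V (FreeAlgebra.ι ℤ (Sum.inl s))
  map_one' := by rw [mk_rel Rel.one, map_one]
  map_mul' s t := by rw [mk_rel (Rel.mul_scalar s t), map_mul]
  map_zero' := by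
    have h := mk_rel (Rel.add_scalar (S := S) (V := V) 0 0)
    rw [add_zero, map_add] at h
    simpa using h
  map_add' s t := by rw [mk_rel (Rel.add_scalar s t), map_add]

instance : Module S (TensorRing S V) := Module.compHom _ (inS S V)

variable {S V} in
theorem smul_def (s : S) (x : TensorRing S V) : s • x = inS S V s * x := rfl

instance : IsScalarTower S (TensorRing S V) (TensorRing S V) where
  smul_assoc s x y := mul_assoc (inS S V s) x y

theorem smul_one_eq (s : S) : s • (1 : TensorRing S V) = inS S V s := mul_one _

/-- The canonical left `S`-linear map `V → T_S(V)`. -/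
def ι : V →ₗ[S] TensorRing S V where
  toFun v := mk S V (FreeAlgebra.ι ℤ (Sum.inr v))
  map_add' v w := by rw [mk_rel (Rel.add v w), map_add]
  map_smul' s v := by rw [mk_rel (Rel.left s v), map_mul]; rfl

variable {S V}

theorem ι_op_smul (s : S) (v : V) : ι S V (op s • v) = ι S V v * inS S V s :=
  (mk_rel (Rel.right s v)).trans (map_mul _ _ _)

/-- The universal property of the tensor ring. -/
def lift {B : Type*} [Ring B] (φ : S →+* B) (f : V →+ B)
    (hl : ∀ (s : S) (v : V), f (s • v) = φ s * f v)
    (hr : ∀ (s : S) (v : V), f (op s • v) = f v * φ s) : TensorRing S V →+* B :=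
  RingQuot.lift ⟨(FreeAlgebra.lift ℤ (Sum.elim φ f) : FreeAlgebra ℤ (S ⊕ V) →ₐ[ℤ] B).toRingHom, by
    intro x y h
    cases h <;> simp [hl, hr]⟩

section lift

variable {B : Type*} [Ring B] (φ : S →+* B) (f : V →+ B)
    (hl : ∀ (s : S) (v : V), f (s • v) = φ s * f v)
    (hr : ∀ (s : S) (v : V), f (op s • v) = f v * φ s)

theorem lift_mk (x : FreeAlgebra ℤ (S ⊕ V)) :
    lift φ f hl hr (mk S V x) = FreeAlgebra.lift ℤ (Sum.elim φ f) x :=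
  RingQuot.lift_mkRingHom_apply _ _ _

theorem lift_inS (s : S) : lift φ f hl hr (inS S V s) = φ s := by
  refine (lift_mk φ f hl hr _).trans ?_
  simp

theorem lift_ι (v : V) : lift φ f hl hr (ι S V v) = f v := by
  refine (lift_mk φ f hl hr _).trans ?_
  simp

theorem lift_smul (s : S) (x : TensorRing S V) :
    lift φ f hl hr (s • x) = φ s * lift φ f hl hr x := by
  rw [smul_def, map_mul, lift_inS]

end lift

theorem hom_ext {B : Type*} [Ring B] {f g : TensorRing S V →+* B}
    (hs : ∀ s, f (inS S V s) = g (inS S V s)) (hv : ∀ v, f (ι S V v) = g (ι S V v)) : f = g := by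
  have : ((f.comp (mk S V)).toIntAlgHom : FreeAlgebra ℤ (S ⊕ V) →ₐ[ℤ] B)
      = (g.comp (mk S V)).toIntAlgHom := by
    refine FreeAlgebra.hom_ext (funext ?_)
    rintro (s | v)
    · exact hs s
    · exact hv v
  exact RingQuot.ringQuot_ext f g (congrArg AlgHom.toRingHom this)

variable (S V)

/-- The component `V ⊗ ⋯ ⊗ V` (`n` factors) of degree `n` of the tensor ring: the span of the
products of `n` elements of `V`. -/
def deg (n : ℕ) : Submodule S (TensorRing S V) := LinearMap.range (ι S V) ^ n

theorem inS_mem_deg (s : S) : inS S V s ∈ deg S V 0 := ⟨s, smul_one_eq S V s⟩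

theorem ι_mem_deg (v : V) : ι S V v ∈ deg S V 1 := by
  unfold deg
  rw [Submodule.pow_one]
  exact ⟨v, rfl⟩

variable {S V} in
theorem deg_mul_inS {n : ℕ} {x : TensorRing S V} (hx : x ∈ deg S V n) (s : S) :
    x * inS S V s ∈ deg S V n := by
  cases n with
  | zero =>
    obtain ⟨t, rfl⟩ := hx
    refine ⟨t * s, ?_⟩
    simp [smul_def]
  | succ n =>
    unfold deg at hx ⊢
    rw [Submodule.pow_succ] at hx ⊢
    refine Submodule.mul_induction_on hx ?_ ?_
    · rintro a ha _ ⟨v, rfl⟩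
      rw [mul_assoc, ← ι_op_smul]
      exact Submodule.mul_mem_mul ha ⟨_, rfl⟩
    · intro a b ha hb
      rw [add_mul]
      exact add_mem ha hb

instance : SetLike.GradedMonoid (deg S V) where
  one_mem := by simpa using inS_mem_deg S V 1
  mul_mem i j x y hx hy := by
    cases j with
    | zero =>
      obtain ⟨t, rfl⟩ := hy
      change x * (t • (1 : TensorRing S V)) ∈ _
      rw [smul_one_eq]
      exact deg_mul_inS hx t
    | succ j =>
      unfold deg at *
      rw [Submodule.pow_add _ j.succ_ne_zero]
      exact Submodule.mul_mem_mul hx hy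

/-- The decomposition map of the tensor ring, obtained from the universal property. -/
def decomp : TensorRing S V →+* ⨁ n, deg S V n :=
  lift
    { toFun := fun s => DirectSum.of (fun n => deg S V n) 0 ⟨inS S V s, inS_mem_deg S V s⟩
      map_one' := by
        rw [DirectSum.one_def]
        congr 1
        exact Subtype.ext (map_one _)
      map_mul' := fun s t => by
        rw [DirectSum.of_mul_of]
        exact DirectSum.of_eq_of_gradedMonoid_eq (Sigma.subtype_ext rfl (map_mul _ _ _))
      map_zero' := by
        rw [← map_zero (DirectSum.of (fun n => deg S V n) 0)]
        congr 1
        exact Subtype.ext (map_zero _)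
      map_add' := fun s t => by
        rw [← map_add]
        congr 1
        exact Subtype.ext (map_add _ _ _) }
    { toFun := fun v => DirectSum.of (fun n => deg S V n) 1 ⟨ι S V v, ι_mem_deg S V v⟩
      map_zero' := by
        rw [← map_zero (DirectSum.of (fun n => deg S V n) 1)]
        congr 1
        exact Subtype.ext (map_zero _)
      map_add' := fun v w => by
        rw [← map_add]
        congr 1
        exact Subtype.ext (map_add _ _ _) }
    (fun s v => by
      change DirectSum.of (fun n => deg S V n) 1 _ =
        DirectSum.of (fun n => deg S V n) 0 _ * DirectSum.of (fun n => deg S V n) 1 _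
      rw [DirectSum.of_mul_of]
      exact DirectSum.of_eq_of_gradedMonoid_eq (Sigma.subtype_ext rfl (map_smul (ι S V) s v)))
    (fun s v => by
      change DirectSum.of (fun n => deg S V n) 1 _ =
        DirectSum.of (fun n => deg S V n) 1 _ * DirectSum.of (fun n => deg S V n) 0 _
      rw [DirectSum.of_mul_of]
      exact DirectSum.of_eq_of_gradedMonoid_eq (Sigma.subtype_ext rfl (ι_op_smul s v)))

theorem decomp_inS (s : S) : decomp S V (inS S V s) =
    DirectSum.of (fun n => deg S V n) 0 ⟨inS S V s, inS_mem_deg S V s⟩ := lift_inS _ _ _ _ s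

theorem decomp_ι (v : V) : decomp S V (ι S V v) =
    DirectSum.of (fun n => deg S V n) 1 ⟨ι S V v, ι_mem_deg S V v⟩ := lift_ι _ _ _ _ v

theorem decomp_of_mem (n : ℕ) (x : TensorRing S V) (hx : x ∈ deg S V n) :
    decomp S V x = DirectSum.of (fun n => deg S V n) n ⟨x, hx⟩ := by
  induction n generalizing x with
  | zero =>
    obtain ⟨s, rfl⟩ := id hx
    have h : (LinearMap.toSpanSingleton S (TensorRing S V) 1) s = inS S V s := smul_one_eq S V s
    rw [show decomp S V ((LinearMap.toSpanSingleton S (TensorRing S V) 1) s) = _ from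
      (congrArg _ h).trans (decomp_inS S V s)]
    exact DirectSum.of_eq_of_gradedMonoid_eq (Sigma.subtype_ext rfl h.symm)
  | succ n ih =>
    have hx' := hx
    unfold deg at hx'
    rw [Submodule.pow_succ] at hx'
    induction hx' using Submodule.mul_induction_on' with
    | mem_mul_mem a ha b hb =>
      obtain ⟨v, rfl⟩ := hb
      rw [map_mul, ih a ha, decomp_ι, DirectSum.of_mul_of]
      exact DirectSum.of_eq_of_gradedMonoid_eq (Sigma.subtype_ext rfl rfl)
    | add a ha b hb iha ihb =>
      have ha' : a ∈ deg S V (n + 1) := by unfold deg; rw [Submodule.pow_succ]; exact ha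
      have hb' : b ∈ deg S V (n + 1) := by unfold deg; rw [Submodule.pow_succ]; exact hb
      rw [map_add, iha ha', ihb hb', ← map_add]
      rfl

instance gradedRing : GradedRing (deg S V) where
  decompose' := decomp S V
  left_inv x := by
    have : (DirectSum.coeRingHom (deg S V)).comp (decomp S V) = RingHom.id _ := by
      refine hom_ext (fun s => ?_) (fun v => ?_)
      · simp [decomp_inS]
      · simp [decomp_ι]
    exact congrArg (fun f : TensorRing S V →+* TensorRing S V => f x) this
  right_inv x := by
    induction x using DirectSum.induction_on with
    | zero => simp
    | of n x =>
      rw [DirectSum.coeAddMonoidHom_of]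
      exact decomp_of_mem S V n x x.2
    | add x y hx hy => rw [map_add, map_add, hx, hy]

/-- The term `T^{≤ n}` of the standard filtration. -/
def filt (n : ℕ) : Submodule S (TensorRing S V) := ⨆ k ≤ n, deg S V k

end TensorRing

end TensorRing

/-! ### The tensor product `B ⊗_S V` -/

section BalTensor

variable (S B V : Type*) [Ring S] [Ring B] [Module S B] [IsScalarTower S B B]
  [AddCommGroup V] [Module S V]

/-- The relations `b s ⊗ v = b ⊗ s v`. -/
def balRel : Submodule B (B ⊗[ℤ] V) :=
  Submodule.span B {x | ∃ (b : B) (s : S) (v : V),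
    x = (b * (s • (1 : B))) ⊗ₜ[ℤ] v - b ⊗ₜ[ℤ] (s • v)}

/-- The left `B`-module `B ⊗_S V`, for an `S`-ring `B` and a left `S`-module `V`. -/
def BalTensor : Type _ := (B ⊗[ℤ] V) ⧸ balRel S B V

namespace BalTensor

instance : AddCommGroup (BalTensor S B V) :=
  inferInstanceAs (AddCommGroup ((B ⊗[ℤ] V) ⧸ balRel S B V))

instance : Module B (BalTensor S B V) :=
  inferInstanceAs (Module B ((B ⊗[ℤ] V) ⧸ balRel S B V))

instance : Module S (BalTensor S B V) :=
  Module.compHom _ (RingHom.smulOneHom : S →+* B)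

variable {S B V} in
theorem smul_def (s : S) (x : BalTensor S B V) : s • x = (s • (1 : B)) • x := rfl

instance : IsScalarTower S B (BalTensor S B V) where
  smul_assoc s b x := by rw [smul_def, ← mul_smul, smul_mul_assoc, one_mul]

variable {B V} in
/-- The pure tensor `b ⊗ v`. -/
def tmul (b : B) (v : V) : BalTensor S B V := (balRel S B V).mkQ (b ⊗ₜ[ℤ] v)

variable {S B V}

theorem tmul_add (b : B) (v w : V) : tmul S b (v + w) = tmul S b v + tmul S b w := by
  simp only [tmul, TensorProduct.tmul_add, map_add]
  rfl

theorem tmul_zero (b : B) : tmul S b (0 : V) = 0 := by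
  simp only [tmul, TensorProduct.tmul_zero, map_zero]
  rfl

theorem add_tmul (b c : B) (v : V) : tmul S (b + c) v = tmul S b v + tmul S c v := by
  simp only [tmul, TensorProduct.add_tmul, map_add]
  rfl

theorem smul_tmul' (c b : B) (v : V) : c • tmul S b v = tmul S (c * b) v := rfl

theorem mul_tmul (b : B) (s : S) (v : V) : tmul S (b * (s • (1 : B))) v = tmul S b (s • v) := by
  refine (Submodule.Quotient.eq _).2 (Submodule.subset_span ⟨b, s, v, rfl⟩)

theorem induction_on {p : BalTensor S B V → Prop} (x : BalTensor S B V)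
    (h0 : p 0) (ht : ∀ b v, p (tmul S b v)) (ha : ∀ x y, p x → p y → p (x + y)) : p x := by
  obtain ⟨x, rfl⟩ := (balRel S B V).mkQ_surjective x
  induction x using TensorProduct.induction_on with
  | zero => rw [map_zero]; exact h0
  | tmul b v => exact ht b v
  | add x y hx hy => rw [map_add]; exact ha _ _ hx hy

section lift

variable {M : Type*} [AddCommGroup M] [Module B M] [Module S M] [IsScalarTower S B M]

/-- Auxiliary: the `B`-linear map `B ⊗_ℤ V → M`, `b ⊗ v ↦ b f(v)`. -/
def preLift (f : V →ₗ[S] M) : B ⊗[ℤ] V →ₗ[B] M where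
  toFun := TensorProduct.liftAddHom
    ((AddMonoidHom.flip (smulAddHom B M)).comp f.toAddMonoidHom).flip
    (fun r b v => by simp [mul_smul, Int.cast_smul_eq_zsmul])
  map_add' := map_add _
  map_smul' c x := by
    induction x using TensorProduct.induction_on with
    | zero => simp
    | tmul b v => simp [TensorProduct.smul_tmul', mul_smul]
    | add x y hx hy => rw [smul_add, map_add, map_add, smul_add, hx, hy]

theorem preLift_tmul (f : V →ₗ[S] M) (b : B) (v : V) : preLift f (b ⊗ₜ[ℤ] v) = b • f v := by
  simp [preLift]

/-- The `B`-linear map `B ⊗_S V → M`, `b ⊗ v ↦ b f(v)`, induced by an `S`-linear map `f`. -/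
def lift (f : V →ₗ[S] M) : BalTensor S B V →ₗ[B] M :=
  (balRel S B V).liftQ (preLift f) (by
    refine Submodule.span_le.2 ?_
    rintro _ ⟨b, s, v, rfl⟩
    simp [preLift_tmul, mul_smul])

theorem lift_tmul (f : V →ₗ[S] M) (b : B) (v : V) : lift f (tmul S b v) = b • f v :=
  preLift_tmul f b v

end lift

/-- For a morphism `φ : B → C` of `S`-rings, the map `φ ⊗ V : B ⊗_S V → C ⊗_S V`. -/
def baseChange {C : Type*} [Ring C] [Module S C] [IsScalarTower S C C] (φ : B →+* C)
    (hφ : ∀ s : S, φ (s • 1) = s • 1) : BalTensor S B V →+ BalTensor S C V :=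
  letI : Module B (BalTensor S C V) := Module.compHom _ φ
  haveI : IsScalarTower S B (BalTensor S C V) :=
    ⟨fun s b x => by
      change φ (s • b) • x = (s • (1 : C)) • φ b • x
      rw [← mul_smul, ← hφ, ← map_mul, smul_mul_assoc, one_mul]⟩
  (lift (B := B) (M := BalTensor S C V)
    { toFun := fun v => tmul S (1 : C) v
      map_add' := tmul_add 1
      map_smul' := fun s v => by
        change _ = (s • (1 : C)) • tmul S (1 : C) v
        rw [← mul_tmul, smul_tmul', one_mul, mul_one] }).toAddMonoidHom

theorem baseChange_tmul {C : Type*} [Ring C] [Module S C] [IsScalarTower S C C] (φ : B →+* C)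
    (hφ : ∀ s : S, φ (s • 1) = s • 1) (b : B) (v : V) :
    baseChange φ hφ (tmul S b v) = tmul S (φ b) v := by
  change φ b • tmul S (1 : C) v = _
  rw [smul_tmul', mul_one]

/-- The component of degree `n` of `B ⊗_S V`, for gradings on `B` and `V`. -/
def deg (𝒷 : ℕ → Submodule S B) (𝓋 : ℕ → Submodule S V) (n : ℕ) :
    AddSubgroup (BalTensor S B V) :=
  AddSubgroup.closure {x | ∃ i j : ℕ, i + j = n ∧ ∃ b ∈ 𝒷 i, ∃ v ∈ 𝓋 j, x = tmul S b v}

end BalTensor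

end BalTensor

/-! ### The decomposition `T_S(V) = S ⊕ T_S(V) ⊗_S V` -/

namespace TensorRing

variable {S V : Type*} [Ring S] [AddCommGroup V] [Module S V] [Module Sᵐᵒᵖ V]
  [SMulCommClass S Sᵐᵒᵖ V]

variable (S V) in
/-- The action of `S` on `(T ⊗_S V) ⊕ S` from the left. -/
def leftMulS : S →+* AddMonoid.End (BalTensor S (TensorRing S V) V × S) where
  toFun s := AddMonoidHom.mk' (fun p => (s • p.1, s * p.2))
    (fun p q => by simp [smul_add, mul_add])
  map_one' := AddMonoidHom.ext fun p => Prod.ext (one_smul S p.1) (one_mul p.2)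
  map_mul' s t := AddMonoidHom.ext fun p => Prod.ext (mul_smul s t p.1) (mul_assoc s t p.2)
  map_zero' := AddMonoidHom.ext fun p => Prod.ext (zero_smul S p.1) (zero_mul p.2)
  map_add' s t := AddMonoidHom.ext fun p => Prod.ext (add_smul s t p.1) (add_mul s t p.2)

variable (S V) in
/-- The multiplication by elements of `V` on `(T ⊗_S V) ⊕ S` from the left:
`v (n, s) = (v n + 1 ⊗ v s, 0)`. -/
def leftMulV : V →+ AddMonoid.End (BalTensor S (TensorRing S V) V × S) :=
  AddMonoidHom.mk'
    (fun v => AddMonoidHom.mk'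
      (fun p => (ι S V v • p.1 + BalTensor.tmul S 1 (op p.2 • v), 0))
      (fun p q => by
        refine Prod.ext ?_ (add_zero (0 : S)).symm
        simp only [Prod.fst_add, Prod.snd_add, op_add, add_smul, smul_add, BalTensor.tmul_add]
        abel))
    (fun v w => by
      refine AddMonoidHom.ext fun p => Prod.ext ?_ (add_zero (0 : S)).symm
      change ι S V (v + w) • p.1 + BalTensor.tmul S 1 (op p.2 • (v + w)) =
        (ι S V v • p.1 + BalTensor.tmul S 1 (op p.2 • v)) +
        (ι S V w • p.1 + BalTensor.tmul S 1 (op p.2 • w))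
      rw [map_add, add_smul, smul_add, BalTensor.tmul_add]
      abel)

variable (S V) in
/-- Left multiplication of `T = T_S(V)` on `(T ⊗_S V) ⊕ S`, where the pair `(∑ tᵢ ⊗ vᵢ, s)`
stands for the element `∑ tᵢ vᵢ + s` of `T`. -/
def leftMul : TensorRing S V →+* AddMonoid.End (BalTensor S (TensorRing S V) V × S) :=
  lift (leftMulS S V) (leftMulV S V)
    (fun s v => by
      refine AddMonoidHom.ext fun p => Prod.ext ?_ ?_
      · change ι S V (s • v) • p.1 + BalTensor.tmul S 1 (op p.2 • s • v) =
          s • (ι S V v • p.1 + BalTensor.tmul S 1 (op p.2 • v))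
        rw [map_smul, smul_add, smul_assoc, ← smul_comm s, ← BalTensor.mul_tmul,
          BalTensor.smul_def s (BalTensor.tmul S _ _), BalTensor.smul_tmul', one_mul, mul_one]
      · exact (mul_zero s).symm)
    (fun s v => by
      refine AddMonoidHom.ext fun p => Prod.ext ?_ rfl
      change ι S V (op s • v) • p.1 + BalTensor.tmul S 1 (op p.2 • op s • v) =
          ι S V v • s • p.1 + BalTensor.tmul S 1 (op (s * p.2) • v)
      rw [ι_op_smul, mul_smul, ← smul_one_eq, ← BalTensor.smul_def, ← mul_smul, ← op_mul])

theorem leftMul_inS (s : S) (p : BalTensor S (TensorRing S V) V × S) :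
    leftMul S V (inS S V s) p = (s • p.1, s * p.2) :=
  DFunLike.congr_fun (lift_inS (leftMulS S V) (leftMulV S V) _ _ s) p

theorem leftMul_ι (v : V) (p : BalTensor S (TensorRing S V) V × S) :
    leftMul S V (ι S V v) p = (ι S V v • p.1 + BalTensor.tmul S 1 (op p.2 • v), 0) :=
  DFunLike.congr_fun (lift_ι (leftMulS S V) (leftMulV S V) _ _ v) p

variable (S V) in
/-- The left `S`-linear map `T → T ⊗_S V`, `x ↦ ∑ x_T ⊗ x_V`, which on elements of positive degree
is the inverse of the multiplication map `T ⊗_S V → T⁺` and which vanishes on `S`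
(see `split_inS`, `split_mul_ι`). -/
def split : TensorRing S V →ₗ[S] BalTensor S (TensorRing S V) V where
  toFun x := (leftMul S V x (0, 1)).1
  map_add' x y := by rw [map_add]; rfl
  map_smul' s x := by
    rw [smul_def, map_mul]
    change (leftMul S V (inS S V s) (leftMul S V x (0, 1))).1 = _
    rw [leftMul_inS]
    rfl

theorem split_inS (s : S) : split S V (inS S V s) = 0 := by
  change (leftMul S V (inS S V s) (0, 1)).1 = 0
  rw [leftMul_inS, smul_zero]

theorem leftMul_zero (x : TensorRing S V) :
    ∀ n : BalTensor S (TensorRing S V) V, leftMul S V x (n, 0) = (x • n, 0) := by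
  obtain ⟨x, rfl⟩ := RingQuot.mkRingHom_surjective (TensorRing.Rel S V) x
  change ∀ n : BalTensor S (TensorRing S V) V, leftMul S V (mk S V x) (n, 0) = (mk S V x • n, 0)
  induction x using FreeAlgebra.induction with
  | grade0 r =>
    intro n
    rw [show algebraMap ℤ (FreeAlgebra ℤ (S ⊕ V)) r = (r : FreeAlgebra ℤ (S ⊕ V)) by simp,
      map_intCast, map_intCast]
    rw [Int.cast_smul_eq_zsmul]
    refine (AddMonoid.End.intCast_apply r _).trans ?_
    simp
  | grade1 a =>
    intro n
    rcases a with s | v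
    · refine (leftMul_inS s _).trans (Prod.ext ?_ (mul_zero s))
      change s • n = inS S V s • n
      rw [BalTensor.smul_def, smul_one_eq]
    · refine (leftMul_ι v _).trans (Prod.ext ?_ rfl)
      change ι S V v • n + BalTensor.tmul S 1 (op (0 : S) • v) = ι S V v • n
      rw [op_zero, zero_smul, BalTensor.tmul_zero, add_zero]
  | mul a b ha hb =>
    intro n
    rw [map_mul, map_mul]
    change leftMul S V (mk S V a) (leftMul S V (mk S V b) (n, 0)) = _
    rw [hb, ha, mul_smul]
  | add a b ha hb =>
    intro n
    rw [map_add, map_add]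
    change leftMul S V (mk S V a) (n, 0) + leftMul S V (mk S V b) (n, 0) = _
    rw [ha, hb, Prod.mk_add_mk, add_zero, add_smul]

theorem split_mul_ι (x : TensorRing S V) (v : V) :
    split S V (x * ι S V v) = BalTensor.tmul S x v := by
  change (leftMul S V (x * ι S V v) (0, 1)).1 = _
  rw [map_mul]
  change (leftMul S V x (leftMul S V (ι S V v) (0, 1))).1 = _
  rw [leftMul_ι, leftMul_zero]
  simp [BalTensor.smul_tmul']

end TensorRing

/-! ### Relations of an `S`-ring and the start of the resolution of `S` -/

section Relations

variable {S B : Type*} [Ring S] [Ring B] [Module S B] [IsScalarTower S B B]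

section Sub

variable (V : Submodule S B) [IsSubbimodule V]

/-- The canonical morphism of `S`-rings `π_B : T_S(V) → B` for a subbimodule `V` of an `S`-ring
`B`; it extends the inclusion of `V`. -/
def toRing : TensorRing S V →+* B :=
  TensorRing.lift (RingHom.smulOneHom : S →+* B) V.subtype.toAddMonoidHom
    (fun s v => by simp) (fun _ _ => rfl)

theorem toRing_smul (s : S) (x : TensorRing S V) : toRing V (s • x) = s • toRing V x := by
  refine (TensorRing.lift_smul _ _ _ _ s x).trans ?_
  change (s • (1 : B)) * _ = _
  rw [smul_mul_assoc, one_mul]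
  rfl

theorem toRing_smul_one (s : S) : toRing V (s • 1) = s • 1 := by
  rw [toRing_smul, map_one]

/-- The kernel `I` of `π_B : T_S(V) → B`. -/
def relIdeal : Submodule S (TensorRing S V) where
  carrier := {x | toRing V x = 0}
  add_mem' := fun {x y} hx hy => by
    rw [Set.mem_ofPred_eq] at *
    rw [map_add, hx, hy, add_zero]
  zero_mem' := map_zero _
  smul_mem' s x hx := by
    rw [Set.mem_ofPred_eq] at *
    rw [toRing_smul, hx, smul_zero]

/-- The ideal `I T¹ + T¹ I`. -/
def relIdealTilde : Submodule S (TensorRing S V) :=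
  relIdeal V * TensorRing.deg S V 1 ⊔ TensorRing.deg S V 1 * relIdeal V

variable {V} in
/-- A graded subbimodule `R` of `T = T_S(V)` is a bimodule of relations if `R ⊕ (I T¹ + T¹ I) = I`,
where `I` is the kernel of `T → B`. -/
structure IsRelationBimodule (R : Submodule S (TensorRing S V)) [IsSubbimodule R] : Prop where
  homogeneous : ∀ r ∈ R, ∀ n, GradedRing.proj (TensorRing.deg S V) n r ∈ R
  disjoint : Disjoint R (relIdealTilde V)
  sup_eq : R ⊔ relIdealTilde V = relIdeal V

theorem IsRelationBimodule.le {V : Submodule S B} [IsSubbimodule V]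
    {R : Submodule S (TensorRing S V)} [IsSubbimodule R] (h : IsRelationBimodule R) :
    R ≤ relIdeal V := h.sup_eq ▸ le_sup_left

/-- The map `d₁ : B ⊗ V → B`, `b ⊗ v ↦ b v`. -/
def d₁ : BalTensor S B V →ₗ[B] B := BalTensor.lift V.subtype

/-- The map `d₂ : B ⊗ X → B ⊗ V`, `b ⊗ x ↦ ∑ b π_B(x_T) ⊗ x_V`, for a left `S`-submodule `X` of
`T = T_S(V)`. -/
def d₂ (X : Submodule S (TensorRing S V)) : BalTensor S B X →ₗ[B] BalTensor S B V :=
  BalTensor.lift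
    { toFun := fun x =>
        BalTensor.baseChange (toRing V) (toRing_smul_one V) (TensorRing.split S V (x : _))
      map_add' := fun x y => by rw [Submodule.coe_add, map_add, map_add]
      map_smul' := fun s x => by
        rw [Submodule.coe_smul, map_smul, RingHom.id_apply]
        generalize TensorRing.split S V (x : TensorRing S V) = t
        induction t using BalTensor.induction_on with
        | h0 => simp
        | ht b v =>
          rw [BalTensor.smul_def, BalTensor.smul_def, BalTensor.smul_tmul',
            BalTensor.baseChange_tmul, BalTensor.baseChange_tmul, BalTensor.smul_tmul', map_mul,
            toRing_smul_one]
        | ha x y hx hy => rw [smul_add, map_add, hx, hy, map_add, smul_add] }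

end Sub

/-- A graded `S`-ring `B = ⨁ Bⁿ` is connected if `s ↦ s • 1` identifies `S` with `B⁰`. -/
structure IsConnected (ℬ : ℕ → Submodule S B) : Prop where
  injective : Function.Injective fun s : S => s • (1 : B)
  surjective : ∀ b ∈ ℬ 0, ∃ s : S, s • (1 : B) = b

/-- A graded `S`-ring `B = ⨁ Bⁿ` is strongly graded if `Bⁿ Bᵐ = Bⁿ⁺ᵐ` for all `n`, `m`. -/
def IsStronglyGraded (ℬ : ℕ → Submodule S B) : Prop :=
  ∀ n m : ℕ, ℬ n * ℬ m = ℬ (n + m)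

/-- The isomorphism `S ≃ B⁰` of a connected graded `S`-ring. -/
def zeroEquiv (ℬ : ℕ → Submodule S B) [GradedRing ℬ] (h : IsConnected ℬ) : S ≃+* ℬ 0 :=
  RingEquiv.ofBijective
    ({ toFun := fun s => ⟨s • (1 : B), (ℬ 0).smul_mem s (SetLike.one_mem_graded ℬ)⟩
       map_one' := Subtype.ext (one_smul S (1 : B))
       map_mul' := fun s t => Subtype.ext (by
        change (s * t) • (1 : B) = (s • (1 : B)) * (t • (1 : B))
        rw [smul_mul_assoc, one_mul, mul_smul])
       map_zero' := Subtype.ext (zero_smul S (1 : B))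
       map_add' := fun s t => Subtype.ext (add_smul s t (1 : B)) } : S →+* ℬ 0)
    ⟨fun _ _ hst => h.injective (congrArg Subtype.val hst),
      fun b => (h.surjective b b.2).imp fun _ hs => Subtype.ext hs⟩

/-- The projection `B → B⁰ = S` of a connected graded `S`-ring. -/
def augmentation (ℬ : ℕ → Submodule S B) [GradedRing ℬ] (h : IsConnected ℬ) : B →+* S :=
  (zeroEquiv ℬ h).symm.toRingHom.comp (GradedRing.projZeroRingHom' ℬ)

/-- The sequence `P₂ → P₁ → B → S → 0` is the start of a projective resolution of the left
`B`-module `S`, on which `B` acts through `ε`. -/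
structure IsResolutionStart {P₁ P₂ : Type*} [AddCommGroup P₁] [AddCommGroup P₂]
    [Module B P₁] [Module B P₂] (e₂ : P₂ →ₗ[B] P₁) (e₁ : P₁ →ₗ[B] B) (ε : B →+* S) : Prop where
  projective₁ : Module.Projective B P₁
  projective₂ : Module.Projective B P₂
  surjective : Function.Surjective ε
  exact₁ : Function.Exact e₁ ε
  exact₂ : Function.Exact e₂ e₁

end Relations

/-! ### The central extension associated to a filtered map -/

section Extension

variable {S B : Type*} [Ring S] [Ring B] [Module S B] [IsScalarTower S B B]
  {V : Submodule S B} [IsSubbimodule V]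

/-- A morphism `α : R → T` of filtered bimodules (`α(R ∩ T^{≤ n}) ⊆ T^{≤ n}`) on a subbimodule
`R` of `T = T_S(V)` whose component of degree `0` is the inclusion. -/
structure FilteredMap (R : Submodule S (TensorRing S V)) [IsSubbimodule R] where
  toLinearMap : R →ₗ[S] TensorRing S V
  map_right : ∀ (s : S) (r : R), toLinearMap (op s • r) = toLinearMap r * (s • 1)
  filtered : ∀ (n : ℕ) (r : R), (r : TensorRing S V) ∈ TensorRing.filt S V n →
    toLinearMap r ∈ TensorRing.filt S V n
  leading : ∀ (n : ℕ) (r : R), (r : TensorRing S V) ∈ TensorRing.deg S V n →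
    GradedRing.proj (TensorRing.deg S V) n (toLinearMap r) = r

variable {R : Submodule S (TensorRing S V)} [IsSubbimodule R] (α : FilteredMap R)

/-- The polynomial `α_z(r) = ∑ αᵢ(r) zⁱ` for `r ∈ R` of degree `n`; here `αᵢ(r)` is the component
of degree `n - i` of `α(r)`. -/
def FilteredMap.alphaZ (n : ℕ) (r : R) : (TensorRing S V)[X] :=
  ∑ i ∈ Finset.range (n + 1), Polynomial.monomial i
    (GradedRing.proj (TensorRing.deg S V) (n - i) (α.toLinearMap r))

/-- The subbimodule `P_z = α_z(R)` of `T[z]`. -/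
def FilteredMap.Pz : Submodule S (TensorRing S V)[X] :=
  Submodule.span S {p | ∃ (n : ℕ) (r : R), (r : TensorRing S V) ∈ TensorRing.deg S V n ∧
    p = α.alphaZ n r}

/-- The central extension `D = T[z] / ⟨P_z⟩` associated to `α`. -/
def CentralExt : Type _ := (TwoSidedIdeal.span (α.Pz : Set (TensorRing S V)[X])).ringCon.Quotient

namespace CentralExt

instance : Ring (CentralExt α) :=
  inferInstanceAs (Ring (TwoSidedIdeal.span (α.Pz : Set (TensorRing S V)[X])).ringCon.Quotient)

/-- The projection `T[z] → D`. -/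
def mk : (TensorRing S V)[X] →+* CentralExt α := RingCon.mk' _

/-- The structure map `S → D`. -/
def inS : S →+* CentralExt α :=
  (mk α).comp (Polynomial.C.comp (TensorRing.inS S V))

instance : Module S (CentralExt α) := Module.compHom _ (inS α)

theorem smul_def (s : S) (x : CentralExt α) : s • x = inS α s * x := rfl

instance : IsScalarTower S (CentralExt α) (CentralExt α) where
  smul_assoc s x y := mul_assoc (inS α s) x y

theorem smul_one_eq (s : S) : s • (1 : CentralExt α) = inS α s := mul_one _

theorem mk_smul (s : S) (p : (TensorRing S V)[X]) : mk α (s • p) = s • mk α p := by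
  rw [smul_def]
  change _ = mk α (Polynomial.C (TensorRing.inS S V s)) * mk α p
  rw [← map_mul]
  congr 1
  ext n
  rw [Polynomial.coeff_smul, Polynomial.coeff_C_mul]
  rfl

/-- The component of degree `n` of `D`, spanned by the classes of `t zʲ` with `t ∈ Tⁱ`,
`i + j = n`. -/
def deg (n : ℕ) : Submodule S (CentralExt α) :=
  Submodule.span S {x | ∃ i j : ℕ, i + j = n ∧ ∃ t ∈ TensorRing.deg S V i,
    x = mk α (Polynomial.C t * Polynomial.X ^ j)}

instance (n : ℕ) : IsSubbimodule (deg α n) where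
  mul_mem v hv s := by
    induction hv using Submodule.span_induction with
    | mem x hx =>
      obtain ⟨i, j, hij, t, ht, rfl⟩ := hx
      refine Submodule.subset_span ⟨i, j, hij, t * TensorRing.inS S V s,
        TensorRing.deg_mul_inS ht s, ?_⟩
      rw [smul_one_eq]
      change mk α _ * mk α (Polynomial.C (TensorRing.inS S V s)) = _
      rw [← map_mul, mul_assoc, (Polynomial.commute_X_pow _ j).eq, ← mul_assoc, ← map_mul]
    | zero => rw [zero_mul]; exact zero_mem _
    | add x y _ _ hx hy => rw [add_mul]; exact add_mem hx hy
    | smul a x _ hx => rw [smul_mul_assoc]; exact Submodule.smul_mem _ _ hx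

/-- The central element `z` of `D`. -/
def z : CentralExt α := mk α Polynomial.X

theorem z_mul (d : CentralExt α) : z α * d = d * z α := by
  obtain ⟨p, rfl⟩ := RingCon.mk'_surjective _ d
  change mk α Polynomial.X * mk α p = mk α p * mk α Polynomial.X
  rw [← map_mul, ← map_mul, Polynomial.X_mul]

/-- Multiplication by `z` on a left `D`-module. -/
def mulZ (M : Type*) [AddCommGroup M] [Module (CentralExt α) M] : M →ₗ[CentralExt α] M where
  toFun m := z α • m
  map_add' := smul_add _
  map_smul' d m := by rw [RingHom.id_apply, ← mul_smul, ← mul_smul, z_mul]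

theorem constantCoeff_alphaZ (n : ℕ) (r : R)
    (hr : (r : TensorRing S V) ∈ TensorRing.deg S V n) :
    Polynomial.constantCoeff (α.alphaZ n r) = r := by
  rw [FilteredMap.alphaZ, map_sum, Finset.sum_eq_single 0]
  · simpa using α.leading n r hr
  · intro i _ hi
    simp [Polynomial.coeff_monomial, hi]
  · intro h
    simp at h

/-- The projection `π : D → B` induced by `z ↦ 0`. -/
def toBase (hR : IsRelationBimodule R) : CentralExt α →+* B :=
  RingCon.lift _ ((toRing V).comp Polynomial.constantCoeff) (by
    have h : TwoSidedIdeal.span (α.Pz : Set (TensorRing S V)[X]) ≤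
        TwoSidedIdeal.ker ((toRing V).comp Polynomial.constantCoeff) := by
      refine TwoSidedIdeal.span_le.2 fun p hp => ?_
      rw [SetLike.mem_coe, TwoSidedIdeal.mem_ker]
      refine Submodule.span_induction ?_ (map_zero _) ?_ ?_ hp
      · rintro _ ⟨n, r, hr, rfl⟩
        rw [RingHom.comp_apply, constantCoeff_alphaZ α n r hr]
        exact hR.le r.2
      · intro x y _ _ hx hy
        rw [map_add, hx, hy, add_zero]
      · intro s x _ hx
        rw [RingHom.comp_apply] at hx ⊢
        rw [Polynomial.constantCoeff_apply] at hx ⊢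
        rw [Polynomial.coeff_smul, toRing_smul, hx, smul_zero]
    intro x y hxy
    have h2 := h ((TwoSidedIdeal.rel_iff _ x y).1 hxy)
    rw [TwoSidedIdeal.mem_ker, map_sub, sub_eq_zero] at h2
    exact h2)

theorem toBase_smul_one (hR : IsRelationBimodule R) (s : S) :
    toBase α hR (s • 1) = s • 1 := by
  rw [smul_one_eq]
  change toRing V (Polynomial.constantCoeff (Polynomial.C (TensorRing.inS S V s))) = _
  rw [Polynomial.constantCoeff_apply, Polynomial.coeff_C_zero, ← TensorRing.smul_one_eq,
    toRing_smul_one]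

/-- The bimodule map `V → D¹` sending `v` to its class. -/
def inclV : V →ₗ[S] deg α 1 where
  toFun v := ⟨mk α (Polynomial.C (TensorRing.ι S V v)), Submodule.subset_span
    ⟨1, 0, rfl, _, TensorRing.ι_mem_deg S V v, by rw [pow_zero, mul_one]⟩⟩
  map_add' v w := Subtype.ext (by simp)
  map_smul' s v := Subtype.ext (by
    change mk α (Polynomial.C (TensorRing.ι S V (s • v))) =
      s • mk α (Polynomial.C (TensorRing.ι S V v))
    rw [← mk_smul, map_smul, Polynomial.smul_C])

/-- The element `z` of `D¹`. -/
def zOne : deg α 1 := ⟨z α, Submodule.subset_span ⟨0, 1, rfl, 1,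
  SetLike.one_mem_graded (TensorRing.deg S V), by rw [map_one, one_mul, pow_one]; rfl⟩⟩

/-- The morphism of `S`-rings `ζ : T_S(V) → T_S(D¹)` extending `V → D¹`. -/
def zeta : TensorRing S V →+* TensorRing S (deg α 1) :=
  TensorRing.lift (TensorRing.inS S (deg α 1))
    ((TensorRing.ι S (deg α 1)).comp (inclV α)).toAddMonoidHom
    (fun s v => by
      change TensorRing.ι S (deg α 1) (inclV α (s • v)) = _
      rw [map_smul, map_smul]
      rfl)
    (fun s v => by
      change TensorRing.ι S (deg α 1) (inclV α (op s • v)) = _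
      have : inclV α (op s • v) = op s • inclV α v := by
        refine Subtype.ext ?_
        rw [IsSubbimodule.coe_op_smul, smul_one_eq]
        change mk α (Polynomial.C (TensorRing.ι S V (op s • v))) =
          mk α (Polynomial.C (TensorRing.ι S V v)) * mk α (Polynomial.C (TensorRing.inS S V s))
        rw [TensorRing.ι_op_smul, ← map_mul, ← map_mul]
      rw [this, TensorRing.ι_op_smul]
      rfl)

/-- The left `T_S(V)`-linear map `λ : T_S(V)[z] → T_S(D¹)`, `∑ tᵢ zⁱ ↦ ∑ ζ(tᵢ) z^{⊗ i}`. -/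
def lam (p : (TensorRing S V)[X]) : TensorRing S (deg α 1) :=
  p.eval₂ (zeta α) (TensorRing.ι S (deg α 1) (zOne α))

/-- The subbimodule `λ(P_z)` of `T_S(D¹)`. -/
def lamPz : Submodule S (TensorRing S (deg α 1)) := Submodule.span S (lam α '' α.Pz)

/-- The subbimodule `[z, V]` of `T_S(D¹)`, consisting of the elements `z ⊗ v - v ⊗ z`. -/
def commZ : Submodule S (TensorRing S (deg α 1)) :=
  Submodule.span S (Set.range fun v : V =>
    TensorRing.ι S (deg α 1) (zOne α) * TensorRing.ι S (deg α 1) (inclV α v) -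
      TensorRing.ι S (deg α 1) (inclV α v) * TensorRing.ι S (deg α 1) (zOne α))

/-- `R_D = λ(P_z) + [z, V]`. -/
def relD : Submodule S (TensorRing S (deg α 1)) := lamPz α ⊔ commZ α

end CentralExt

/-! ### The truncated sequence `¹M` -/

/-- The grading shift `M(-1)`. -/
def shift {M : Type*} [AddCommGroup M] (G : ℕ → AddSubgroup M) : ℕ → AddSubgroup M
  | 0 => ⊥
  | n + 1 => G n

/-- The grading of a submodule of `B` concentrated in degree one. -/
def degOne (W : Submodule S B) (n : ℕ) : Submodule S W := if n = 1 then ⊤ else ⊥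

/-- The grading of `D` by additive subgroups. -/
def grD (n : ℕ) : AddSubgroup (CentralExt α) := (CentralExt.deg α n).toAddSubgroup

/-- The grading of `D ⊗ V`, where `V` is concentrated in degree one. -/
def grDV (n : ℕ) : AddSubgroup (BalTensor S (CentralExt α) V) :=
  BalTensor.deg (CentralExt.deg α) (degOne V) n

/-- The grading of `D ⊗ R`. -/
def grDR (n : ℕ) : AddSubgroup (BalTensor S (CentralExt α) R) :=
  BalTensor.deg (CentralExt.deg α) (fun j => (TensorRing.deg S V j).comap R.subtype) n

/-- The grading of `D ⊗ D¹`. -/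
def grDD (n : ℕ) : AddSubgroup (BalTensor S (CentralExt α) (CentralExt.deg α 1)) :=
  BalTensor.deg (CentralExt.deg α) (degOne (CentralExt.deg α 1)) n

/-- The grading of `D ⊗ R_D`. -/
def grDRD (n : ℕ) : AddSubgroup (BalTensor S (CentralExt α) (CentralExt.relD α)) :=
  BalTensor.deg (CentralExt.deg α)
    (fun j => (TensorRing.deg S (CentralExt.deg α 1) j).comap (CentralExt.relD α).subtype) n

/-- The data from which the sequence `¹M` is formed: graded `D`-linear lifts `∂₁`, `∂₂` of
`d₁ : B ⊗ V → B` and `d₂ : B ⊗ R → B ⊗ V` along `π : D → B`, and a graded `D`-linear map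
`f₂ : D ⊗ R → D(-1)` such that `∂₁ ∂₂ = - z f₂`. -/
structure OneM (hR : IsRelationBimodule R) where
  del₁ : BalTensor S (CentralExt α) V →ₗ[CentralExt α] CentralExt α
  del₂ : BalTensor S (CentralExt α) R →ₗ[CentralExt α] BalTensor S (CentralExt α) V
  f₂ : BalTensor S (CentralExt α) R →ₗ[CentralExt α] CentralExt α
  graded₁ : ∀ n, ∀ x ∈ grDV α n, del₁ x ∈ grD α n
  graded₂ : ∀ n, ∀ x ∈ grDR α n, del₂ x ∈ grDV α n
  graded_f : ∀ n, ∀ x ∈ grDR α n, f₂ x ∈ shift (grD α) n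
  lifts₁ : ∀ x, CentralExt.toBase α hR (del₁ x) =
    d₁ V (BalTensor.baseChange (CentralExt.toBase α hR) (CentralExt.toBase_smul_one α hR) x)
  lifts₂ : ∀ x,
    BalTensor.baseChange (CentralExt.toBase α hR) (CentralExt.toBase_smul_one α hR) (del₂ x) =
      d₂ V R (BalTensor.baseChange (CentralExt.toBase α hR) (CentralExt.toBase_smul_one α hR) x)
  comp : ∀ x, del₁ (del₂ x) = -(CentralExt.z α * f₂ x)

namespace OneM

variable {α} {hR : IsRelationBimodule R}

/-- `δ₁ : M₁ = (D ⊗ V) ⊕ D(-1) → M₀ = D`, `δ₁(x, y) = ∂₁ x + z y`. -/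
def delta₁ (M : OneM α hR) :
    (BalTensor S (CentralExt α) V × CentralExt α) →ₗ[CentralExt α] CentralExt α :=
  M.del₁.coprod (CentralExt.mulZ α _)

/-- `δ₂ : M₂ = (D ⊗ R) ⊕ (D ⊗ V)(-1) → M₁`, `δ₂(x, y) = (∂₂ x - z y, ∂₁ y + f₂ x)`. -/
def delta₂ (M : OneM α hR) :
    (BalTensor S (CentralExt α) R × BalTensor S (CentralExt α) V) →ₗ[CentralExt α]
      (BalTensor S (CentralExt α) V × CentralExt α) :=
  (M.del₂.coprod (-CentralExt.mulZ α _)).prod (M.f₂.coprod M.del₁)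

end OneM

variable (R) in
/-- The grading of `M₁ = (D ⊗ V) ⊕ D(-1)`. -/
def grM₁ (n : ℕ) : AddSubgroup (BalTensor S (CentralExt α) V × CentralExt α) :=
  (grDV α n).prod (shift (grD α) n)

variable (R) in
/-- The grading of `M₂ = (D ⊗ R) ⊕ (D ⊗ V)(-1)`. -/
def grM₂ (n : ℕ) :
    AddSubgroup (BalTensor S (CentralExt α) R × BalTensor S (CentralExt α) V) :=
  (grDR α n).prod (shift (grDV α) n)

end Extension

end PBW

end

set_option linter.unusedSectionVars false

noncomputable section

namespace PBW

/-! ### Functoriality of the tensor product -/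

namespace BalTensor

variable {S B V W U : Type*} [Ring S] [Ring B] [Module S B] [IsScalarTower S B B]
  [AddCommGroup V] [Module S V] [AddCommGroup W] [Module S W] [AddCommGroup U] [Module S U]

/-! For an `S`-ring `B` and a subbimodule `V` with `T = T_S(V)`, right multiplication by `V` gives
`T = S ⊕ T ⊗ V` (`mulι_split_add`, `split_mulι`). Suppose that `T → B` is onto with kernel `I`, that
`B` is augmented over `S` with `V` mapping to zero, and that `X ⊆ I` is stable under `S` on both
sides and generates `I` as a two-sided ideal. Then `I = T X + I V`, and since `I V` dies in `B ⊗ V`,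
the sequence `B ⊗ X → B ⊗ V → B → S` is exact (`exact_d₁_augmentation`, `exact_d₂_d₁`).

This is used twice. For `A`, the equation `I = R + I T¹ + T¹ I` and induction on the degree show
that `R` generates `I` (`IsRelationBimodule.mem_span`). For `D`, the quotient of `T_D` by `R_D` is
`D` again: modulo the commutators `[z, v]` the map `λ` is a ring morphism, and it kills `P_z`
(`mem_span_relD`). Projectivity follows because `B ⊗ -` preserves projectives, together with `D¹ ≅
A¹ ⊕ S` (`degOneEquiv`) and `R_D ≅ R ⊕ A¹` (`relEquiv`). Setting `z = 0` separates the two summands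
of `R_D`, and a representation by `2 × 2` matrices shows that `v ↦ [z, v]` is injective.

For `¹M`, existence comes from writing `α_z(r) = r + z (…)` and reading it in `D` (`stdOneM`). For
an arbitrary choice, degree reasons force `∂₁(1 ⊗ v) = v + c(v) z`, so that `ϑ₁` is a change of
coordinates in `D¹`. After identifying `D ⊗ R_D` with `D ⊗ R ⊕ D ⊗ A¹`, the maps `ϑ₁ δ₂` and `d₂'`
differ by a sign on `A¹`. On `R` their difference is a cycle that vanishes modulo `z`. Exactness
over `D` gives it a homogeneous preimage, and the minimality of `R`
(`IsRelationBimodule.eq_zero_of_d₂`) puts the first coordinate of that preimage in `D^{>0} ⊗ R`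
(`exists_correction`). As `R` is projective, preimages can be chosen linearly
(`exists_correctionMap`). The resulting `ϑ₂` is block triangular, with diagonal blocks `1 + N` and
`-1`, where `N` strictly lowers the degree of the factor in `R`; hence it is bijective
(`exists_theta₂`), and exactness is transported to `¹M`. -/

theorem zero_tmul (v : V) : tmul S (0 : B) v = 0 := by
  rw [← zero_smul B (tmul S (1 : B) v), smul_tmul', zero_mul]

theorem tmul_neg (b : B) (v : V) : tmul S b (-v) = -tmul S b v := by
  rw [eq_neg_iff_add_eq_zero, ← tmul_add, neg_add_cancel, tmul_zero]

theorem tmul_eq_smul (b : B) (v : V) : tmul S b v = b • tmul S (1 : B) v := by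
  rw [smul_tmul', mul_one]

theorem smul_tmul_eq (s : S) (b : B) (v : V) : s • tmul S b v = tmul S (s • b) v := by
  rw [smul_def, smul_tmul', smul_mul_assoc, one_mul]

theorem one_tmul_smul (s : S) (v : V) : tmul S (1 : B) (s • v) = s • tmul S (1 : B) v := by
  rw [smul_tmul_eq, ← mul_tmul, one_mul]

variable (S B V) in
/-- The map `v ↦ 1 ⊗ v`. -/
def oneTmul : V →ₗ[S] BalTensor S B V where
  toFun v := tmul S 1 v
  map_add' := tmul_add 1
  map_smul' s v := one_tmul_smul s v

@[simp] theorem oneTmul_apply (v : V) : oneTmul S B V v = tmul S 1 v := rfl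

theorem addHom_ext {M : Type*} [AddCommMonoid M] {f g : BalTensor S B V →+ M}
    (h : ∀ b v, f (tmul S b v) = g (tmul S b v)) : f = g := by
  ext x
  induction x using induction_on with
  | h0 => rw [map_zero, map_zero]
  | ht b v => exact h b v
  | ha x y hx hy => rw [map_add, map_add, hx, hy]

theorem linearMap_ext {M : Type*} [AddCommGroup M] [Module B M] {f g : BalTensor S B V →ₗ[B] M}
    (h : ∀ v, f (tmul S 1 v) = g (tmul S 1 v)) : f = g := by
  ext x
  induction x using induction_on with
  | h0 => rw [map_zero, map_zero]
  | ht b v => rw [tmul_eq_smul, map_smul, map_smul, h]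
  | ha x y hx hy => rw [map_add, map_add, hx, hy]

/-- The additive map on `B ⊗_S V` induced by a balanced biadditive map. -/
def liftAdd {M : Type*} [AddCommGroup M] (f : B →+ V →+ M)
    (hf : ∀ (b : B) (s : S) (v : V), f (b * (s • (1 : B))) v = f b (s • v)) : BalTensor S B V →+ M :=
  QuotientAddGroup.lift (balRel S B V).toAddSubgroup
    (TensorProduct.liftAddHom f (fun r b v => by rw [map_zsmul, map_zsmul]; rfl)) (by
      intro x hx
      -- `balRel` is a `B`-span while the map is only additive, so vanishing is proved for all left
      -- multiples `c • x` at once.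
      have : ∀ c : B, TensorProduct.liftAddHom f (fun r b v => by rw [map_zsmul, map_zsmul]; rfl) (c • x) = 0 := by
        refine Submodule.span_induction ?_ (fun c => by simp) ?_ ?_ hx
        · rintro _ ⟨b, s, v, rfl⟩ c
          rw [smul_sub, map_sub, TensorProduct.smul_tmul', TensorProduct.smul_tmul',
            TensorProduct.liftAddHom_tmul, TensorProduct.liftAddHom_tmul, smul_eq_mul,
            smul_eq_mul, ← mul_assoc, hf, sub_self]
        · intro x y _ _ hx hy c
          rw [smul_add, map_add, hx, hy, add_zero]
        · intro b x _ hx c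
          rw [← mul_smul, hx]
      simpa using this 1)

/-- The map `B ⊗ f`. -/
def lTensor (f : V →ₗ[S] W) : BalTensor S B V →ₗ[B] BalTensor S B W :=
  lift ((oneTmul S B W).comp f)

theorem lTensor_tmul (f : V →ₗ[S] W) (b : B) (v : V) :
    lTensor f (tmul S b v) = tmul S b (f v) := by
  rw [lTensor, lift_tmul, LinearMap.comp_apply, oneTmul_apply, smul_tmul', mul_one]

/-- The isomorphism `B ⊗ V ≃ B ⊗ W` induced by an isomorphism `V ≃ W`. -/
def congr (e : V ≃ₗ[S] W) : BalTensor S B V ≃ₗ[B] BalTensor S B W :=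
  LinearEquiv.ofLinearMap (lTensor e.toLinearMap) (lTensor e.symm.toLinearMap)
    (linearMap_ext fun v => by simp [lTensor_tmul])
    (linearMap_ext fun v => by simp [lTensor_tmul])

theorem congr_tmul (e : V ≃ₗ[S] W) (b : B) (v : V) :
    congr e (tmul S b v) = tmul S b (e v) := lTensor_tmul _ b v

variable (S B V W) in
/-- The isomorphism `B ⊗ V ⊕ B ⊗ W ≃ B ⊗ (V ⊕ W)`. -/
def prodEquiv : (BalTensor S B V × BalTensor S B W) ≃ₗ[B] BalTensor S B (V × W) :=
  LinearEquiv.ofLinearMap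
    ((lTensor (LinearMap.inl S V W)).coprod (lTensor (LinearMap.inr S V W)))
    ((lTensor (LinearMap.fst S V W)).prod (lTensor (LinearMap.snd S V W)))
    (linearMap_ext fun v => by
      simp [lTensor_tmul, ← tmul_add])
    (by
      refine LinearMap.prod_ext (linearMap_ext fun v => ?_) (linearMap_ext fun v => ?_) <;>
      simp [lTensor_tmul, tmul_zero])

theorem prodEquiv_apply (x : BalTensor S B V) (y : BalTensor S B W) :
    prodEquiv S B V W (x, y) =
      lTensor (LinearMap.inl S V W) x + lTensor (LinearMap.inr S V W) y := rfl

variable (S B) in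
/-- The isomorphism `B ≃ B ⊗ S`. -/
def rid : B ≃ₗ[B] BalTensor S B S :=
  LinearEquiv.ofLinearMap (LinearMap.toSpanSingleton B _ (tmul S 1 1))
    (lift (LinearMap.toSpanSingleton S B 1))
    (linearMap_ext fun v => by
      simp only [LinearMap.comp_apply, lift_tmul, LinearMap.toSpanSingleton_apply, one_smul,
        LinearMap.id_apply]
      rw [smul_tmul', mul_one, ← smul_tmul_eq, ← one_tmul_smul, smul_eq_mul, mul_one])
    (by
      ext
      simp [lift_tmul])

theorem rid_apply (b : B) : rid S B b = b • tmul S (1 : B) (1 : S) := rfl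

/-- `B ⊗_S -` is left adjoint to restriction of scalars: a section of a surjection onto `B ⊗ V` is
the `B`-linear extension of an `S`-linear lift of `v ↦ 1 ⊗ v`. -/
instance projective [Module.Projective S V] : Module.Projective B (BalTensor S B V) := by
  refine Module.Projective.of_lifting_property'' fun f hf => ?_
  obtain ⟨h, hh⟩ := Module.projective_lifting_property (f.restrictScalars S) (oneTmul S B V) hf
  refine ⟨lift h, linearMap_ext fun v => ?_⟩
  rw [LinearMap.comp_apply, lift_tmul, one_smul]
  exact LinearMap.congr_fun hh v

section baseChange

variable {C : Type*} [Ring C] [Module S C] [IsScalarTower S C C] (φ : B →+* C)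
  (hφ : ∀ s : S, φ (s • 1) = s • 1)

theorem baseChange_smul (b : B) (x : BalTensor S B V) :
    baseChange φ hφ (b • x) = φ b • baseChange φ hφ x := by
  induction x using induction_on with
  | h0 => simp
  | ht c v => simp [smul_tmul', baseChange_tmul]
  | ha x y hx hy => rw [smul_add, map_add, hx, hy, map_add, smul_add]

theorem baseChange_smul_base (s : S) (x : BalTensor S B V) :
    baseChange φ hφ (s • x) = s • baseChange φ hφ x := by
  rw [smul_def, baseChange_smul, hφ, smul_def]

theorem baseChange_surjective (h : Function.Surjective φ) :
    Function.Surjective (baseChange (V := V) φ hφ) := by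
  intro x
  induction x using induction_on with
  | h0 => exact ⟨0, map_zero _⟩
  | ht c v =>
    obtain ⟨b, rfl⟩ := h c
    exact ⟨tmul S b v, baseChange_tmul φ hφ b v⟩
  | ha x y hx hy =>
    obtain ⟨x, rfl⟩ := hx
    obtain ⟨y, rfl⟩ := hy
    exact ⟨x + y, map_add _ _ _⟩

end baseChange

end BalTensor

/-! ### The tensor ring -/

namespace TensorRing

variable {S V : Type*} [Ring S] [AddCommGroup V] [Module S V] [Module Sᵐᵒᵖ V]

theorem induction_on {p : TensorRing S V → Prop} (x : TensorRing S V)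
    (hs : ∀ s, p (inS S V s)) (hv : ∀ v, p (ι S V v))
    (hm : ∀ x y, p x → p y → p (x * y)) (ha : ∀ x y, p x → p y → p (x + y)) : p x := by
  obtain ⟨x, rfl⟩ := RingQuot.mkRingHom_surjective (TensorRing.Rel S V) x
  change p (mk S V x)
  induction x using FreeAlgebra.induction with
  | grade0 r =>
    rw [show algebraMap ℤ (FreeAlgebra ℤ (S ⊕ V)) r = (r : FreeAlgebra ℤ (S ⊕ V)) by simp,
      map_intCast, ← map_intCast (inS S V)]
    exact hs _
  | grade1 a =>
    rcases a with s | v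
    · exact hs s
    · exact hv v
  | mul a b h1 h2 => rw [map_mul]; exact hm _ _ h1 h2
  | add a b h1 h2 => rw [map_add]; exact ha _ _ h1 h2

theorem deg_succ_induction {p : TensorRing S V → Prop} {n : ℕ}
    (hm : ∀ x ∈ deg S V n, ∀ v, p (x * ι S V v)) (ha : ∀ x y, p x → p y → p (x + y))
    {x : TensorRing S V} (hx : x ∈ deg S V (n + 1)) : p x := by
  unfold deg at hx hm
  rw [Submodule.pow_succ] at hx
  refine Submodule.mul_induction_on hx ?_ ha
  rintro x hx _ ⟨v, rfl⟩
  exact hm x hx v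

theorem mem_deg_zero {x : TensorRing S V} (hx : x ∈ deg S V 0) : ∃ s, inS S V s = x := by
  obtain ⟨s, rfl⟩ := hx
  exact ⟨s, (smul_one_eq S V s).symm⟩

theorem mem_deg_one {x : TensorRing S V} (hx : x ∈ deg S V 1) : ∃ v, ι S V v = x := by
  unfold deg at hx
  rw [Submodule.pow_one] at hx
  exact hx

/-- A ring homomorphism maps components to components if it does so in degrees zero and one. -/
theorem map_deg_mem {B : Type*} [Ring B] [Module S B] (𝒷 : ℕ → Submodule S B)
    [SetLike.GradedMonoid 𝒷] (f : TensorRing S V →+* B) (h0 : ∀ s, f (inS S V s) ∈ 𝒷 0)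
    (h1 : ∀ v, f (ι S V v) ∈ 𝒷 1) (n : ℕ) {x : TensorRing S V} (hx : x ∈ deg S V n) :
    f x ∈ 𝒷 n := by
  induction n generalizing x with
  | zero =>
    obtain ⟨s, rfl⟩ := mem_deg_zero hx
    exact h0 s
  | succ n ih =>
    refine deg_succ_induction (p := fun x => f x ∈ 𝒷 (n + 1)) (fun x hx v => ?_)
      (fun x y hx hy => ?_) hx
    · rw [map_mul]
      exact SetLike.mul_mem_graded (ih hx) (h1 v)
    · rw [map_add]
      exact add_mem hx hy

/-! ### The splitting `T = S ⊕ T ⊗ V`. -/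

section split

variable [SMulCommClass S Sᵐᵒᵖ V]

variable (S V) in
/-- The projection of the tensor ring onto its component of degree zero. -/
def eps : TensorRing S V →+ S where
  toFun x := (leftMul S V x (0, 1)).2
  map_zero' := by rw [map_zero]; rfl
  map_add' x y := by rw [map_add]; rfl

theorem leftMul_one (x : TensorRing S V) : leftMul S V x (0, 1) = (split S V x, eps S V x) := rfl

variable (S V) in
/-- The multiplication map `T ⊗ V → T`. -/
def mulι : BalTensor S (TensorRing S V) V →ₗ[TensorRing S V] TensorRing S V :=
  BalTensor.lift (ι S V)

theorem mulι_tmul (x : TensorRing S V) (v : V) :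
    mulι S V (BalTensor.tmul S x v) = x * ι S V v := BalTensor.lift_tmul _ _ _

theorem split_mulι (u : BalTensor S (TensorRing S V) V) : split S V (mulι S V u) = u := by
  induction u using BalTensor.induction_on with
  | h0 => simp
  | ht b v => rw [mulι_tmul, split_mul_ι]
  | ha x y hx hy => rw [map_add, map_add, hx, hy]

/-- The action `leftMul` was designed so that `(u, s) ↦ mulι u + s` is `T`-linear; it suffices to
check this on the generators of `T`. Evaluation at `(0, 1)` then recovers `x` from its splitting. -/
theorem mul_leftMul (x : TensorRing S V) (p : BalTensor S (TensorRing S V) V × S) :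
    mulι S V (leftMul S V x p).1 + inS S V (leftMul S V x p).2 =
      x * (mulι S V p.1 + inS S V p.2) := by
  induction x using induction_on generalizing p with
  | hs s =>
    rw [leftMul_inS]
    simp only
    rw [BalTensor.smul_def, map_smul, smul_one_eq, smul_eq_mul, map_mul, mul_add]
  | hv v =>
    rw [leftMul_ι]
    simp only
    rw [map_add, mulι_tmul, map_smul, one_mul, ι_op_smul, smul_eq_mul, map_zero, add_zero, mul_add]
  | hm x y hx hy =>
    rw [map_mul]
    change mulι S V (leftMul S V x (leftMul S V y p)).1 +
      inS S V (leftMul S V x (leftMul S V y p)).2 = _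
    rw [hx, hy, mul_assoc]
  | ha x y hx hy =>
    rw [map_add]
    change mulι S V ((leftMul S V x p).1 + (leftMul S V y p).1) +
      inS S V ((leftMul S V x p).2 + (leftMul S V y p).2) = _
    rw [map_add, map_add, add_mul, ← hx, ← hy]
    abel

theorem mulι_split_add (x : TensorRing S V) :
    mulι S V (split S V x) + inS S V (eps S V x) = x := by
  have h := mul_leftMul x (0, 1)
  rw [leftMul_one] at h
  simpa using h

/-- Without a constant term, `leftMul y (0, 1)` lies in `T ⊗ V`, where `leftMul` is the ordinary
action of `T`. A constant term of `y` would add a contribution of `split x`. -/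
theorem split_mul (x y : TensorRing S V) (hy : eps S V y = 0) :
    split S V (x * y) = x • split S V y := by
  change (leftMul S V (x * y) (0, 1)).1 = _
  rw [map_mul]
  change (leftMul S V x (leftMul S V y (0, 1))).1 = _
  rw [leftMul_one, hy, leftMul_zero]

/-- The elements of `T` which come from `T ⊗ V` with left factors of degree `n`. -/
theorem split_mem {n : ℕ} {x : TensorRing S V} (hx : x ∈ deg S V (n + 1)) :
    split S V x ∈ AddSubgroup.closure
      {y | ∃ b ∈ deg S V n, ∃ v : V, y = BalTensor.tmul S b v} := by
  refine deg_succ_induction (p := fun x => split S V x ∈ _) (fun x hx v => ?_)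
    (fun x y hx hy => ?_) hx
  · rw [split_mul_ι]
    exact AddSubgroup.subset_closure ⟨x, hx, v, rfl⟩
  · rw [map_add]
    exact add_mem hx hy

end split

end TensorRing

/-! ### Exactness of the beginning of the resolution -/

section Exactness

variable {S B : Type*} [Ring S] [Ring B] [Module S B] [IsScalarTower S B B]
  (V : Submodule S B) [IsSubbimodule V]

open TensorRing

theorem toRing_inS (s : S) : toRing V (inS S V s) = s • 1 := by
  rw [← smul_one_eq, toRing_smul_one]

theorem toRing_ι (v : V) : toRing V (ι S V v) = v := lift_ι _ _ _ _ v

theorem d₁_tmul (b : B) (v : V) : d₁ V (BalTensor.tmul S b v) = b * v := BalTensor.lift_tmul _ _ _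

theorem d₂_tmul (X : Submodule S (TensorRing S V)) (b : B) (x : X) :
    d₂ V X (BalTensor.tmul S b x) = b •
      BalTensor.baseChange (toRing V) (toRing_smul_one V) (split S V (x : TensorRing S V)) :=
  BalTensor.lift_tmul _ _ _

/-- Lets cycles in `B ⊗ V` be studied through elements of the kernel of `T → B`. -/
theorem d₁_baseChange (u : BalTensor S (TensorRing S V) V) :
    d₁ V (BalTensor.baseChange (toRing V) (toRing_smul_one V) u) = toRing V (mulι S V u) := by
  induction u using BalTensor.induction_on with
  | h0 => simp
  | ht b v => rw [BalTensor.baseChange_tmul, d₁_tmul, mulι_tmul, map_mul, toRing_ι]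
  | ha x y hx hy => simp only [map_add, hx, hy]

variable {V} {ε : B →+* S} (hε : ∀ s : S, ε (s • 1) = s) (hεV : ∀ v ∈ V, ε v = 0)

include hε hεV

omit hε in
theorem augmentation_d₁ (x : BalTensor S B V) : ε (d₁ V x) = 0 := by
  induction x using BalTensor.induction_on with
  | h0 => simp
  | ht b v => rw [d₁_tmul, map_mul, hεV _ v.2, mul_zero]
  | ha x y hx hy => rw [map_add, map_add, hx, hy, add_zero]

theorem augmentation_toRing (x : TensorRing S V) : ε (toRing V x) = eps S V x := by
  conv_lhs => rw [← mulι_split_add x]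
  rw [map_add, map_add, ← d₁_baseChange, augmentation_d₁ hεV, zero_add, toRing_inS, hε]

/-- If `x ∈ T` lifts an element of the kernel of `ε`, then `eps x = 0`, so `x` equals `mulι (split
x)` and comes from `T ⊗ V`. -/
theorem exact_d₁_augmentation (hsurj : Function.Surjective (toRing V)) :
    Function.Exact (d₁ V) ε := by
  intro b
  constructor
  · intro hb
    obtain ⟨x, rfl⟩ := hsurj b
    rw [augmentation_toRing hε hεV] at hb
    refine ⟨BalTensor.baseChange (toRing V) (toRing_smul_one V) (split S V x), ?_⟩
    rw [d₁_baseChange]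
    conv_rhs => rw [← mulι_split_add x]
    rw [hb, map_zero, add_zero]
  · rintro ⟨x, rfl⟩
    exact augmentation_d₁ hεV x

/-- A cycle lifts to `T ⊗ V`, and the product `x ∈ T` of the lift lies in the kernel `I`. The left
ideal `L = T X + T I V` turns out to be two-sided, so it contains `x`. Splitting sends `X` to the
image of `d₂` and `I V` to zero in `B ⊗ V`, and it is left `T`-linear on `I`. -/
theorem exact_d₂_d₁ (hsurj : Function.Surjective (toRing V)) {X : Submodule S (TensorRing S V)}
    (hXr : ∀ x ∈ X, ∀ s, x * inS S V s ∈ X) (hX : X ≤ relIdeal V)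
    (hgen : ∀ x, toRing V x = 0 → x ∈ TwoSidedIdeal.span (X : Set (TensorRing S V))) :
    Function.Exact (d₂ V X) (d₁ V) := by
  have heps : ∀ x, toRing V x = 0 → eps S V x = 0 := fun x hx => by
    rw [← augmentation_toRing hε hεV, hx, map_zero]
  intro y
  constructor
  · intro hy
    obtain ⟨u, rfl⟩ := BalTensor.baseChange_surjective (toRing V) (toRing_smul_one V) hsurj y
    rw [d₁_baseChange] at hy
    rw [← split_mulι u]
    generalize mulι S V u = x at hy
    let L : Submodule (TensorRing S V) (TensorRing S V) := Submodule.span _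
      ((X : Set (TensorRing S V)) ∪ {x | ∃ j, toRing V j = 0 ∧ ∃ v, x = j * ι S V v})
    have hLI : ∀ x ∈ L, toRing V x = 0 := by
      intro x hx
      refine Submodule.span_induction ?_ (map_zero _) ?_ ?_ hx
      · rintro x (hx | ⟨j, hj, v, rfl⟩)
        · exact hX hx
        · rw [map_mul, hj, zero_mul]
      · intro x y _ _ hx hy
        rw [map_add, hx, hy, add_zero]
      · intro t x _ hx
        rw [smul_eq_mul, map_mul, hx, mul_zero]
    -- Right multiplication by `S` preserves both kinds of generators. Right multiplication by `v`
    -- is free of charge: `L ⊆ I`, so `x v` is itself a generator of the second kind.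
    have hLr : ∀ (t : TensorRing S V), ∀ x ∈ L, x * t ∈ L := by
      intro t
      induction t using TensorRing.induction_on with
      | hs s =>
        intro x hx
        refine Submodule.span_induction ?_ ?_ ?_ ?_ hx
        · rintro x (hx | ⟨j, hj, v, rfl⟩)
          · exact Submodule.subset_span (Or.inl (hXr x hx s))
          · refine Submodule.subset_span (Or.inr ⟨j, hj, op s • v, ?_⟩)
            rw [ι_op_smul, mul_assoc]
        · rw [zero_mul]; exact zero_mem _
        · intro x y _ _ hx hy
          rw [add_mul]; exact add_mem hx hy
        · intro t x _ hx
          rw [smul_mul_assoc]; exact Submodule.smul_mem _ _ hx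
      | hv v =>
        intro x hx
        exact Submodule.subset_span (Or.inr ⟨x, hLI x hx, v, rfl⟩)
      | hm t t' h h' =>
        intro x hx
        rw [← mul_assoc]
        exact h' _ (h _ hx)
      | ha t t' h h' =>
        intro x hx
        rw [mul_add]
        exact add_mem (h _ hx) (h' _ hx)
    have hxL : x ∈ L := by
      let L' : TwoSidedIdeal (TensorRing S V) := TwoSidedIdeal.mk' L L.zero_mem L.add_mem
        L.neg_mem (fun {x y} hy => L.smul_mem x hy) (fun {x y} hx => hLr y x hx)
      have hle : TwoSidedIdeal.span (X : Set (TensorRing S V)) ≤ L' :=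
        TwoSidedIdeal.span_le.2 fun x hx =>
          (TwoSidedIdeal.mem_mk' _ _ _ _ _ _ _).2 (Submodule.subset_span (Or.inl hx))
      exact (TwoSidedIdeal.mem_mk' _ _ _ _ _ _ _).1 (hle (hgen x hy))
    refine Submodule.span_induction (p := fun x _ =>
      BalTensor.baseChange (toRing V) (toRing_smul_one V) (split S V x) ∈ Set.range (d₂ V X))
      ?_ ?_ ?_ ?_ hxL
    · rintro x (hx | ⟨j, hj, v, rfl⟩)
      · exact ⟨BalTensor.tmul S 1 ⟨x, hx⟩, by rw [d₂_tmul, one_smul]⟩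
      · exact ⟨0, by rw [map_zero, split_mul_ι, BalTensor.baseChange_tmul, hj,
          BalTensor.zero_tmul]⟩
    · exact ⟨0, by simp⟩
    · rintro x y _ _ ⟨x', hx⟩ ⟨y', hy⟩
      exact ⟨x' + y', by simp only [map_add, hx, hy]⟩
    · rintro t x hx ⟨x', hx'⟩
      refine ⟨toRing V t • x', ?_⟩
      rw [map_smul, hx', smul_eq_mul, split_mul _ _ (heps x (hLI x hx)),
        BalTensor.baseChange_smul]
  · rintro ⟨x, rfl⟩
    induction x using BalTensor.induction_on with
    | h0 => simp
    | ht b x =>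
      have h := mulι_split_add (x : TensorRing S V)
      rw [heps _ (hX x.2), map_zero, add_zero] at h
      rw [d₂_tmul, map_smul, d₁_baseChange, h, show toRing V x = 0 from hX x.2, smul_zero]
    | ha x y hx hy => rw [map_add, map_add, hx, hy, add_zero]

end Exactness

end PBW

end
noncomputable section

namespace PBW

open TensorRing

/-! ### The kernel of `T ⊗ V → B ⊗ V` -/

section Kernel

variable {S B : Type*} [Ring S] [Ring B] [Module S B] [IsScalarTower S B B]
  {V : Submodule S B} [IsSubbimodule V]

theorem mem_relIdeal {x : TensorRing S V} : x ∈ relIdeal V ↔ toRing V x = 0 := Iff.rfl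

/-- The kernel of `T ⊗ V → B ⊗ V` consists of the elements of `I ⊗ V`. -/
theorem mulι_mem_of_baseChange_eq_zero (hsurj : Function.Surjective (toRing V))
    {u : BalTensor S (TensorRing S V) V}
    (hu : BalTensor.baseChange (toRing V) (toRing_smul_one V) u = 0) :
    mulι S V u ∈ relIdeal V * deg S V 1 := by
  -- The map `b ⊗ v ↦ σ(b) v` from `B ⊗ V` to `T / I T¹`, for a set-theoretic section `σ` of `T →
  -- B`, is well defined, and its composite with `T ⊗ V → B ⊗ V` is multiplication modulo `I T¹`.
  let K : AddSubgroup (TensorRing S V) := (relIdeal V * deg S V 1).toAddSubgroup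
  let σ := Function.surjInv hsurj
  have hσ : ∀ b, toRing V (σ b) = b := Function.surjInv_eq hsurj
  have hK : ∀ {x y : TensorRing S V} (v : V), toRing V x = toRing V y →
      (QuotientAddGroup.mk (x * ι S V v) : TensorRing S V ⧸ K) =
        QuotientAddGroup.mk (y * ι S V v) := by
    intro x y v h
    rw [QuotientAddGroup.eq]
    have h2 : -(x * ι S V v) + y * ι S V v = (y - x) * ι S V v := by rw [sub_mul]; abel
    rw [h2]
    refine Submodule.mul_mem_mul ?_ (ι_mem_deg S V v)
    rw [mem_relIdeal, map_sub, h, sub_self]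
  let f : B →+ V →+ TensorRing S V ⧸ K := AddMonoidHom.mk'
    (fun b => AddMonoidHom.mk' (fun v => QuotientAddGroup.mk (σ b * ι S V v))
      (fun v w => by rw [map_add, mul_add]; rfl))
    (fun b c => by
      ext v
      change (QuotientAddGroup.mk (σ (b + c) * ι S V v) : TensorRing S V ⧸ K) =
        QuotientAddGroup.mk (σ b * ι S V v) + QuotientAddGroup.mk (σ c * ι S V v)
      rw [hK v (y := σ b + σ c) (by rw [map_add, hσ, hσ, hσ]), add_mul]
      rfl)
  let F : BalTensor S B V →+ TensorRing S V ⧸ K := BalTensor.liftAdd f (fun b s v => by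
    change (QuotientAddGroup.mk (σ (b * s • 1) * ι S V v) : TensorRing S V ⧸ K) =
      QuotientAddGroup.mk (σ b * ι S V (s • v))
    rw [hK v (y := σ b * inS S V s) (by rw [map_mul, hσ, hσ, toRing_inS]), mul_assoc,
      ← smul_def, map_smul])
  have hF : F.comp (BalTensor.baseChange (toRing V) (toRing_smul_one V)) =
      (QuotientAddGroup.mk' K).comp (mulι S V).toAddMonoidHom := by
    refine BalTensor.addHom_ext fun b v => ?_
    rw [AddMonoidHom.comp_apply, BalTensor.baseChange_tmul]
    change (QuotientAddGroup.mk (σ (toRing V b) * ι S V v) : TensorRing S V ⧸ K) =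
      QuotientAddGroup.mk (mulι S V (BalTensor.tmul S b v))
    rw [mulι_tmul]
    exact hK v (hσ _)
  have h := DFunLike.congr_fun hF u
  rw [AddMonoidHom.comp_apply, hu, map_zero] at h
  exact (QuotientAddGroup.eq_zero_iff _).1 h.symm

end Kernel

/-! ### Connected strongly graded rings -/

section Graded

variable {S A : Type*} [Ring S] [Ring A] [Module S A] [IsScalarTower S A A]
  {𝒜 : ℕ → Submodule S A} [GradedRing 𝒜]

theorem augmentation_smul_one (hconn : IsConnected 𝒜) (s : S) :
    augmentation 𝒜 hconn (s • 1) = s := by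
  change (zeroEquiv 𝒜 hconn).symm _ = s
  rw [RingEquiv.symm_apply_eq]
  refine Subtype.ext ?_
  exact DirectSum.decompose_of_mem_same 𝒜 ((𝒜 0).smul_mem s (SetLike.one_mem_graded 𝒜))

theorem augmentation_of_mem (hconn : IsConnected 𝒜) {n : ℕ} (hn : n ≠ 0) {a : A}
    (ha : a ∈ 𝒜 n) : augmentation 𝒜 hconn a = 0 := by
  change (zeroEquiv 𝒜 hconn).symm _ = 0
  rw [RingEquiv.symm_apply_eq, map_zero]
  refine Subtype.ext ?_
  exact DirectSum.decompose_of_mem_ne 𝒜 ha hn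

theorem augmentation_surjective (hconn : IsConnected 𝒜) :
    Function.Surjective (augmentation 𝒜 hconn) :=
  fun s => ⟨s • 1, augmentation_smul_one hconn s⟩

theorem toRing_mem {n : ℕ} {x : TensorRing S (𝒜 1)} (hx : x ∈ deg S (𝒜 1) n) :
    toRing (𝒜 1) x ∈ 𝒜 n := by
  refine map_deg_mem 𝒜 _ (fun s => ?_) (fun v => ?_) n hx
  · rw [toRing_inS]
    exact (𝒜 0).smul_mem s (SetLike.one_mem_graded 𝒜)
  · rw [toRing_ι]
    exact v.2

theorem toRing_proj (n : ℕ) (x : TensorRing S (𝒜 1)) :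
    toRing (𝒜 1) (GradedRing.proj (deg S (𝒜 1)) n x) = GradedRing.proj 𝒜 n (toRing (𝒜 1) x) := by
  induction x using DirectSum.Decomposition.inductionOn (deg S (𝒜 1)) with
  | zero => simp
  | @homogeneous i m =>
    rw [GradedRing.proj_apply, GradedRing.proj_apply]
    by_cases h : i = n
    · subst h
      rw [DirectSum.decompose_of_mem_same _ m.2, DirectSum.decompose_of_mem_same _ (toRing_mem m.2)]
    · rw [DirectSum.decompose_of_mem_ne _ m.2 h,
        DirectSum.decompose_of_mem_ne _ (toRing_mem m.2) h, map_zero]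
  | add x y hx hy => simp only [map_add, hx, hy]

/-- Strong grading makes `A` generated in degree one, since `A^{n+1} = Aⁿ A¹`. -/
theorem toRing_surjective (hconn : IsConnected 𝒜) (hstr : IsStronglyGraded 𝒜) :
    Function.Surjective (toRing (𝒜 1)) := by
  have h : ∀ n, ∀ a ∈ 𝒜 n, ∃ x, toRing (𝒜 1) x = a := by
    intro n
    induction n with
    | zero =>
      intro a ha
      obtain ⟨s, rfl⟩ := hconn.surjective a ha
      exact ⟨inS S (𝒜 1) s, toRing_inS _ s⟩
    | succ n ih =>
      intro a ha
      rw [← hstr n 1] at ha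
      refine Submodule.mul_induction_on ha ?_ ?_
      · intro b hb c hc
        obtain ⟨x, rfl⟩ := ih b hb
        exact ⟨x * ι S (𝒜 1) ⟨c, hc⟩, by rw [map_mul, toRing_ι]⟩
      · rintro _ _ ⟨x, rfl⟩ ⟨y, rfl⟩
        exact ⟨x + y, map_add _ _ _⟩
  intro a
  induction a using DirectSum.Decomposition.inductionOn 𝒜 with
  | zero => exact ⟨0, map_zero _⟩
  | @homogeneous i m => exact h i m m.2
  | add x y hx hy =>
    obtain ⟨x, rfl⟩ := hx
    obtain ⟨y, rfl⟩ := hy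
    exact ⟨x + y, map_add _ _ _⟩

theorem exists_toRing_eq (hconn : IsConnected 𝒜) (hstr : IsStronglyGraded 𝒜) {n : ℕ} {a : A}
    (ha : a ∈ 𝒜 n) : ∃ x ∈ deg S (𝒜 1) n, toRing (𝒜 1) x = a := by
  obtain ⟨x, rfl⟩ := toRing_surjective hconn hstr a
  refine ⟨GradedRing.proj (deg S (𝒜 1)) n x, SetLike.coe_mem _, ?_⟩
  rw [toRing_proj]
  exact DirectSum.decompose_of_mem_same 𝒜 ha

variable {R : Submodule S (TensorRing S (𝒜 1))} [IsSubbimodule R]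

/-- A Nakayama argument by degree: the component of degree `n + 1` of an element of `I T¹ + T¹ I`
only involves components of degree `n` of elements of `I`, and these lie in the ideal by induction.
In degree zero `I T¹ + T¹ I` contributes nothing. -/
theorem IsRelationBimodule.mem_span (hR : IsRelationBimodule R) {x : TensorRing S (𝒜 1)}
    (hx : toRing (𝒜 1) x = 0) : x ∈ TwoSidedIdeal.span (R : Set (TensorRing S (𝒜 1))) := by
  set J := TwoSidedIdeal.span (R : Set (TensorRing S (𝒜 1)))
  have h : ∀ n x, toRing (𝒜 1) x = 0 → GradedRing.proj (deg S (𝒜 1)) n x ∈ J := by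
    intro n
    induction n with
    | zero =>
      intro x hx
      have h0 : toRing (𝒜 1) (GradedRing.proj (deg S (𝒜 1)) 0 x) = 0 := by
        rw [toRing_proj, hx, map_zero]
      have hx' : x ∈ R ⊔ relIdealTilde (𝒜 1) := by rw [hR.sup_eq]; exact hx
      obtain ⟨r, hr, y, hy, rfl⟩ := Submodule.mem_sup.1 hx'
      obtain ⟨p, hp, q, hq, rfl⟩ := Submodule.mem_sup.1 hy
      rw [map_add, map_add]
      refine J.add_mem (TwoSidedIdeal.subset_span (hR.homogeneous r hr 0)) (J.add_mem ?_ ?_)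
      · refine Submodule.mul_induction_on hp (fun a _ b hb => ?_) (fun a b ha hb => ?_)
        · rw [GradedRing.proj_apply,
            DirectSum.coe_decompose_mul_of_right_mem_of_not_le _ hb (by simp)]
          exact J.zero_mem
        · rw [map_add]; exact J.add_mem ha hb
      · refine Submodule.mul_induction_on hq (fun b hb a _ => ?_) (fun a b ha hb => ?_)
        · rw [GradedRing.proj_apply,
            DirectSum.coe_decompose_mul_of_left_mem_of_not_le _ hb (by simp)]
          exact J.zero_mem
        · rw [map_add]; exact J.add_mem ha hb
    | succ n ih =>
      intro x hx
      have hx' : x ∈ R ⊔ relIdealTilde (𝒜 1) := by rw [hR.sup_eq]; exact hx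
      obtain ⟨r, hr, y, hy, rfl⟩ := Submodule.mem_sup.1 hx'
      obtain ⟨p, hp, q, hq, rfl⟩ := Submodule.mem_sup.1 hy
      rw [map_add, map_add]
      refine J.add_mem (TwoSidedIdeal.subset_span (hR.homogeneous r hr _)) (J.add_mem ?_ ?_)
      · refine Submodule.mul_induction_on hp (fun a ha b hb => ?_) (fun a b ha hb => ?_)
        · rw [GradedRing.proj_apply,
            DirectSum.coe_decompose_mul_of_right_mem_of_le _ hb (by simp)]
          exact J.mul_mem_right _ _ (ih a ha)
        · rw [map_add]; exact J.add_mem ha hb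
      · refine Submodule.mul_induction_on hq (fun b hb a ha => ?_) (fun a b ha hb => ?_)
        · rw [GradedRing.proj_apply, add_comm n 1,
            DirectSum.coe_decompose_mul_of_left_mem_of_le _ hb (by simp)]
          refine J.mul_mem_left _ _ ?_
          rw [Nat.add_sub_cancel_left]
          exact ih a ha
        · rw [map_add]; exact J.add_mem ha hb
  classical
  rw [← DirectSum.sum_support_decompose (deg S (𝒜 1)) x]
  exact sum_mem fun n _ => h n x hx

/-- A relation in a bimodule of relations is not a consequence of relations of smaller degree. -/
theorem IsRelationBimodule.eq_zero_of_d₂ (hR : IsRelationBimodule R) (hconn : IsConnected 𝒜)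
    (hstr : IsStronglyGraded 𝒜) (ρ : R) {u : BalTensor S A R}
    (hu : u ∈ AddSubgroup.closure
      {x | ∃ i, 0 < i ∧ ∃ a ∈ 𝒜 i, ∃ r : R, x = BalTensor.tmul S a r})
    (h : d₂ (𝒜 1) R (BalTensor.tmul S 1 ρ + u) = 0) : ρ = 0 := by
  have heps : ∀ r ∈ R, eps S (𝒜 1) r = 0 := fun r hr => by
    rw [← augmentation_toRing (augmentation_smul_one hconn)
      (fun v hv => augmentation_of_mem hconn one_ne_zero hv),
      show toRing (𝒜 1) r = 0 from hR.le hr, map_zero]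
  -- The image of `u` is the splitting of some `τ ∈ T¹ I`, because its left coefficients lift to
  -- positive degree. Then `ρ + τ` splits to zero in `A ⊗ A¹`, hence lies in `I T¹`, and `ρ` lies in
  -- `R ∩ (I T¹ + T¹ I) = 0`.
  have hτ : ∃ τ ∈ deg S (𝒜 1) 1 * relIdeal (𝒜 1), eps S (𝒜 1) τ = 0 ∧
      d₂ (𝒜 1) R u = BalTensor.baseChange (toRing (𝒜 1)) (toRing_smul_one (𝒜 1))
        (split S (𝒜 1) τ) := by
    clear h
    induction hu using AddSubgroup.closure_induction with
    | mem x hx =>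
      obtain ⟨i, hi, a, ha, r, rfl⟩ := hx
      obtain ⟨t, ht, rfl⟩ := exists_toRing_eq hconn hstr ha
      have hr : toRing (𝒜 1) (r : TensorRing S (𝒜 1)) = 0 := hR.le r.2
      have hmem : toRing (𝒜 1) (t * r) = 0 := by rw [map_mul, hr, mul_zero]
      refine ⟨t * r, ?_, ?_, ?_⟩
      · obtain ⟨i, rfl⟩ : ∃ k, i = 1 + k := ⟨i - 1, by omega⟩
        -- `Submodule.pow_add` factors `T^{1+i}` as `T¹ Tⁱ` only for `i ≠ 0`; for `i = 0` the
        -- element `t` already lies in `T¹`.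
        have ht' : t ∈ deg S (𝒜 1) 1 * deg S (𝒜 1) i ∨ i = 0 := by
          by_cases h0 : i = 0
          · exact Or.inr h0
          · refine Or.inl ?_
            unfold deg at ht ⊢
            rwa [Submodule.pow_add _ h0] at ht
        rcases ht' with ht' | rfl
        · refine Submodule.mul_induction_on ht' (fun b hb c _ => ?_) (fun a b ha hb => ?_)
          · rw [mul_assoc]
            refine Submodule.mul_mem_mul hb ?_
            rw [mem_relIdeal, map_mul, hr, mul_zero]
          · rw [add_mul]; exact add_mem ha hb
        · exact Submodule.mul_mem_mul ht (hR.le r.2)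
      · rw [← augmentation_toRing (augmentation_smul_one hconn)
          (fun v hv => augmentation_of_mem hconn one_ne_zero hv), hmem, map_zero]
      · rw [d₂_tmul, split_mul _ _ (heps _ r.2), BalTensor.baseChange_smul]
    | zero => exact ⟨0, zero_mem _, map_zero _, by simp⟩
    | add x y _ _ hx hy =>
      obtain ⟨a, ha, ha', ha2⟩ := hx
      obtain ⟨b, hb, hb', hb2⟩ := hy
      exact ⟨a + b, add_mem ha hb, by rw [map_add, ha', hb', add_zero],
        by simp only [map_add, ha2, hb2]⟩
    | neg x _ hx =>
      obtain ⟨a, ha, ha', ha2⟩ := hx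
      exact ⟨-a, neg_mem ha, by rw [map_neg, ha', neg_zero], by simp only [map_neg, ha2]⟩
  obtain ⟨τ, hτ, hτ0, hτ2⟩ := hτ
  rw [map_add, hτ2, d₂_tmul, one_smul, ← map_add, ← map_add] at h
  have h1 := mulι_mem_of_baseChange_eq_zero (toRing_surjective hconn hstr) h
  have h2 := mulι_split_add ((ρ : TensorRing S (𝒜 1)) + τ)
  rw [map_add (eps S (𝒜 1)), heps _ ρ.2, hτ0, add_zero, map_zero, add_zero] at h2
  rw [h2] at h1
  have h3 : (ρ : TensorRing S (𝒜 1)) ∈ relIdealTilde (𝒜 1) := by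
    have := sub_mem (Submodule.mem_sup_left (T := deg S (𝒜 1) 1 * relIdeal (𝒜 1)) h1)
      (Submodule.mem_sup_right (S := relIdeal (𝒜 1) * deg S (𝒜 1) 1) hτ)
    rwa [add_sub_cancel_right] at this
  exact Subtype.ext (Submodule.disjoint_def.1 hR.disjoint _ ρ.2 h3)

theorem isResolutionStart (hconn : IsConnected 𝒜) (hstr : IsStronglyGraded 𝒜)
    (hA : Module.Projective S (𝒜 1)) (hR : IsRelationBimodule R)
    (hRproj : Module.Projective S R) :
    IsResolutionStart (d₂ (𝒜 1) R) (d₁ (𝒜 1)) (augmentation 𝒜 hconn) where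
  projective₁ := inferInstance
  projective₂ := inferInstance
  surjective := augmentation_surjective hconn
  exact₁ := exact_d₁_augmentation (augmentation_smul_one hconn)
    (fun v hv => augmentation_of_mem hconn one_ne_zero hv) (toRing_surjective hconn hstr)
  exact₂ := exact_d₂_d₁ (augmentation_smul_one hconn)
    (fun v hv => augmentation_of_mem hconn one_ne_zero hv) (toRing_surjective hconn hstr)
    (fun x hx s => by rw [← smul_one_eq]; exact IsSubbimodule.mul_mem x hx s) hR.le
    (fun _ hx => hR.mem_span hx)

end Graded

end PBW

end

noncomputable section

namespace PBW

open TensorRing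

/-! ### The filtered map in polynomial form -/

namespace FilteredMap

variable {S B : Type*} [Ring S] [Ring B] [Module S B] [IsScalarTower S B B]
  {V : Submodule S B} [IsSubbimodule V]
  {R : Submodule S (TensorRing S V)} [IsSubbimodule R]

theorem proj_smul (n : ℕ) (s : S) (x : TensorRing S V) :
    GradedRing.proj (deg S V) n (s • x) = s • GradedRing.proj (deg S V) n x := by
  rw [GradedRing.proj_apply, GradedRing.proj_apply, DirectSum.decompose_smul]
  rfl

theorem proj_mul_inS (n : ℕ) (s : S) (x : TensorRing S V) :
    GradedRing.proj (deg S V) n (x * inS S V s) = GradedRing.proj (deg S V) n x * inS S V s := by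
  rw [GradedRing.proj_apply,
    DirectSum.coe_decompose_mul_of_right_mem_of_le _ (inS_mem_deg S V s) (Nat.zero_le n)]
  rfl

/-! ### Homogeneous components of `R`. -/

section component

variable (hR : ∀ r ∈ R, ∀ n, GradedRing.proj (deg S V) n r ∈ R)

/-- The projection of `R` onto its homogeneous elements of degree `n`. -/
def component (n : ℕ) : R →ₗ[S] R where
  toFun r := ⟨GradedRing.proj (deg S V) n r, hR r r.2 n⟩
  map_add' x y := Subtype.ext (by
    simp only [Submodule.coe_add, map_add])
  map_smul' s r := Subtype.ext (by
    simp only [Submodule.coe_smul, proj_smul, RingHom.id_apply])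

theorem component_mem (n : ℕ) (r : R) :
    (component hR n r : TensorRing S V) ∈ deg S V n := SetLike.coe_mem _

theorem component_of_mem {n : ℕ} {r : R} (hr : (r : TensorRing S V) ∈ deg S V n) :
    component hR n r = r := Subtype.ext (DirectSum.decompose_of_mem_same _ hr)

theorem component_of_mem_ne {n m : ℕ} {r : R} (hr : (r : TensorRing S V) ∈ deg S V n)
    (h : n ≠ m) : component hR m r = 0 := Subtype.ext (DirectSum.decompose_of_mem_ne _ hr h)

theorem finite_component (r : R) : {n | component hR n r ≠ 0}.Finite := by
  classical
  refine (DFinsupp.support (DirectSum.decompose (deg S V) (r : TensorRing S V))).finite_toSet.subset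
    fun n hn => ?_
  rw [Finset.mem_coe, DFinsupp.mem_support_iff]
  intro h
  refine hn (Subtype.ext ?_)
  change ((DirectSum.decompose (deg S V) (r : TensorRing S V) n : deg S V n) : TensorRing S V) = 0
  rw [h]
  rfl

include hR in
theorem homogeneous_induction {p : R → Prop}
    (hom : ∀ (n : ℕ) (r : R), (r : TensorRing S V) ∈ deg S V n → p r)
    (add : ∀ x y, p x → p y → p (x + y)) (r : R) : p r := by
  classical
  have h : r = ∑ n ∈ DFinsupp.support (DirectSum.decompose (deg S V) (r : TensorRing S V)),
      component hR n r := by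
    refine Subtype.ext ?_
    rw [AddSubmonoidClass.coe_finsetSum]
    exact (DirectSum.sum_support_decompose (deg S V) (r : TensorRing S V)).symm
  rw [h]
  exact Finset.sum_induction _ p add (hom 0 0 (zero_mem _))
    fun n _ => hom n _ (component_mem hR n r)

variable {M : Type*} [AddCommGroup M] [Module S M]

theorem finite_support_apply_component (φ : ℕ → R →ₗ[S] M) (r : R) :
    (Function.support fun n => φ n (component hR n r)).Finite :=
  (finite_component hR r).subset fun n hn h => hn (by simp only [h, map_zero])

/-- The linear map on `R` which is given by `φ n` in degree `n`. -/
def gradedSum (φ : ℕ → R →ₗ[S] M) : R →ₗ[S] M where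
  toFun r := ∑ᶠ n, φ n (component hR n r)
  map_add' x y := by
    rw [← finsum_add_distrib (finite_support_apply_component hR φ x)
      (finite_support_apply_component hR φ y)]
    simp only [map_add]
  map_smul' s x := by
    rw [RingHom.id_apply, smul_finsum' s (finite_support_apply_component hR φ x)]
    simp only [map_smul]

theorem gradedSum_of_mem (φ : ℕ → R →ₗ[S] M) {n : ℕ} {r : R}
    (hr : (r : TensorRing S V) ∈ deg S V n) : gradedSum hR φ r = φ n r := by
  change ∑ᶠ n, φ n (component hR n r) = _
  rw [finsum_eq_single _ n, component_of_mem hR hr]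
  intro m hm
  rw [component_of_mem_ne hR hr hm.symm, map_zero]

end component

/-! ### The additive map `α_z` and its image. -/

variable (α : FilteredMap R)

theorem alphaZ_coeff (n : ℕ) (r : R) (i : ℕ) : (α.alphaZ n r).coeff i =
    if i ≤ n then GradedRing.proj (deg S V) (n - i) (α.toLinearMap r) else 0 := by
  rw [alphaZ, Polynomial.finsetSum_coeff]
  simp only [Polynomial.coeff_monomial]
  rw [Finset.sum_ite_eq']
  simp only [Finset.mem_range, Nat.lt_succ_iff]

/-- The linear map `r ↦ ∑ αᵢ(r) zⁱ` on elements of degree `n`. -/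
def alphaZₗ (n : ℕ) : R →ₗ[S] (TensorRing S V)[X] where
  toFun r := α.alphaZ n r
  map_add' x y := by
    ext i
    rw [Polynomial.coeff_add]
    simp only [alphaZ_coeff, map_add]
    split_ifs <;> simp
  map_smul' s x := by
    ext i
    rw [RingHom.id_apply, Polynomial.coeff_smul]
    simp only [alphaZ_coeff, map_smul, proj_smul]
    split_ifs <;> simp

variable (hR : ∀ r ∈ R, ∀ n, GradedRing.proj (deg S V) n r ∈ R)

/-- The map `α_z : R → T[z]`. -/
def polyMap : R →ₗ[S] (TensorRing S V)[X] := gradedSum hR α.alphaZₗ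

theorem polyMap_of_mem {n : ℕ} {r : R} (hr : (r : TensorRing S V) ∈ deg S V n) :
    α.polyMap hR r = α.alphaZ n r := gradedSum_of_mem hR _ hr

/-- `α_z` is `S`-linear on all of `R`, so the span defining `P_z` is just its range. -/
theorem mem_Pz {p : (TensorRing S V)[X]} : p ∈ α.Pz ↔ ∃ r, α.polyMap hR r = p := by
  constructor
  · intro hp
    change p ∈ LinearMap.range (α.polyMap hR)
    refine Submodule.span_le.2 ?_ hp
    rintro _ ⟨n, r, hr, rfl⟩
    exact ⟨r, α.polyMap_of_mem hR hr⟩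
  · rintro ⟨r, rfl⟩
    refine homogeneous_induction hR (p := fun r => α.polyMap hR r ∈ α.Pz) (fun n r hr => ?_)
      (fun x y hx hy => ?_) r
    · exact Submodule.subset_span ⟨n, r, hr, α.polyMap_of_mem hR hr⟩
    · rw [map_add]
      exact add_mem hx hy

/-- The leading component of `α` is the inclusion. Thus `α_z(r)` has the form `r + z (…)`, and `z ↦
0` recovers `r`. -/
theorem polyMap_coeff_zero (r : R) : (α.polyMap hR r).coeff 0 = r := by
  refine homogeneous_induction hR (p := fun r => (α.polyMap hR r).coeff 0 = r) (fun n r hr => ?_)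
      (fun x y hx hy => ?_) r
  · rw [α.polyMap_of_mem hR hr]
    exact CentralExt.constantCoeff_alphaZ α n r hr
  · rw [map_add, Polynomial.coeff_add, hx, hy, Submodule.coe_add]

/-- Right linearity of `α` passes to `α_z`; this makes `λ(P_z)` stable under `S` on the right. -/
theorem polyMap_op_smul (s : S) (r : R) :
    α.polyMap hR (op s • r) = α.polyMap hR r * Polynomial.C (inS S V s) := by
  refine homogeneous_induction hR
    (p := fun r => α.polyMap hR (op s • r) = α.polyMap hR r * Polynomial.C (inS S V s))
    (fun n r hr => ?_) (fun x y hx hy => ?_) r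
  · have hr' : ((op s • r : R) : TensorRing S V) ∈ deg S V n := by
      rw [IsSubbimodule.coe_op_smul, smul_one_eq]
      exact deg_mul_inS hr s
    rw [α.polyMap_of_mem hR hr, α.polyMap_of_mem hR hr']
    ext i
    rw [Polynomial.coeff_mul_C, alphaZ_coeff, alphaZ_coeff, α.map_right, smul_one_eq,
      proj_mul_inS]
    split_ifs
    · rfl
    · rw [zero_mul]
  · rw [smul_add, map_add, map_add, add_mul, hx, hy]

/-- A polynomial homogeneous of degree `n` satisfies every property which is closed under sums and
holds for the monomials of degree `n`. -/
theorem polyMap_induction {p : (TensorRing S V)[X] → Prop} {n : ℕ} {r : R}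
    (hr : (r : TensorRing S V) ∈ deg S V n)
    (hm : ∀ i j, i + j = n → ∀ t ∈ deg S V j, p (Polynomial.monomial i t))
    (ha : ∀ x y, p x → p y → p (x + y)) : p (α.polyMap hR r) := by
  rw [α.polyMap_of_mem hR hr, alphaZ]
  refine Finset.sum_induction _ p ha ?_ fun i hi => ?_
  -- The property of the zero polynomial is the case `t = 0` of the monomial hypothesis.
  · rw [← Polynomial.monomial_zero_right n]
    exact hm n 0 (by omega) 0 (zero_mem _)
  · rw [Finset.mem_range] at hi
    exact hm i (n - i) (by omega) _ (SetLike.coe_mem _)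

end FilteredMap

/-! ### The grading of the central extension -/

namespace CentralExt

variable {S B : Type*} [Ring S] [Ring B] [Module S B] [IsScalarTower S B B]
  {V : Submodule S B} [IsSubbimodule V]
  {R : Submodule S (TensorRing S V)} [IsSubbimodule R] (α : FilteredMap R)

theorem mk_surjective : Function.Surjective (mk α) := RingCon.mk'_surjective _

variable {α} in
theorem mk_eq_zero {p : (TensorRing S V)[X]} (hp : p ∈ α.Pz) : mk α p = 0 := by
  rw [← map_zero (mk α)]
  refine (RingCon.eq _).2 ?_
  exact (TwoSidedIdeal.mem_iff _ _).1 (TwoSidedIdeal.subset_span hp)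

variable {α} in
/-- The universal property of the central extension. -/
def lift {Q : Type*} [Ring Q] (f : (TensorRing S V)[X] →+* Q) (hf : ∀ p ∈ α.Pz, f p = 0) :
    CentralExt α →+* Q :=
  RingCon.lift _ f (by
    have h : TwoSidedIdeal.span (α.Pz : Set (TensorRing S V)[X]) ≤ TwoSidedIdeal.ker f :=
      TwoSidedIdeal.span_le.2 fun p hp => (TwoSidedIdeal.mem_ker f).2 (hf p hp)
    intro x y hxy
    have h2 := h ((TwoSidedIdeal.rel_iff _ x y).1 hxy)
    rw [TwoSidedIdeal.mem_ker, map_sub, sub_eq_zero] at h2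
    exact h2)

/-- The morphism of `S`-rings `T → D`. -/
def ofT : TensorRing S V →+* CentralExt α := (mk α).comp Polynomial.C

theorem ofT_inS (s : S) : ofT α (TensorRing.inS S V s) = s • 1 := (smul_one_eq α s).symm

theorem ofT_smul_one (s : S) : ofT α (s • 1) = s • 1 := by
  rw [TensorRing.smul_one_eq, ofT_inS]

theorem ofT_ι (v : V) : ofT α (ι S V v) = inclV α v := rfl

theorem mk_monomial (i : ℕ) (t : TensorRing S V) :
    mk α (Polynomial.monomial i t) = ofT α t * z α ^ i := by
  rw [← Polynomial.C_mul_X_pow_eq_monomial, map_mul, map_pow]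
  rfl

theorem z_smul_one (s : S) : z α * (s • 1) = s • z α := by
  rw [z_mul, smul_mul_assoc, one_mul]

instance : SetLike.GradedMonoid (deg α) where
  one_mem := Submodule.subset_span ⟨0, 0, rfl, 1, SetLike.one_mem_graded _, by simp⟩
  mul_mem m n x y hx hy := by
    induction hy using Submodule.span_induction generalizing x with
    | mem y hy =>
      obtain ⟨i, j, hij, t, ht, rfl⟩ := hy
      induction hx using Submodule.span_induction with
      | mem x hx =>
        obtain ⟨k, l, hkl, u, hu, rfl⟩ := hx
        refine Submodule.subset_span ⟨k + i, l + j, by omega, u * t,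
          SetLike.mul_mem_graded hu ht, ?_⟩
        rw [← map_mul, mul_assoc, ← mul_assoc (Polynomial.X ^ l),
          (Polynomial.commute_X_pow _ l).eq, map_mul Polynomial.C, pow_add]
        simp only [mul_assoc]
      | zero => rw [zero_mul]; exact zero_mem _
      | add x x' _ _ hx hx' => rw [add_mul]; exact add_mem hx hx'
      | smul s x _ hx => rw [smul_mul_assoc]; exact Submodule.smul_mem _ _ hx
    | zero => rw [mul_zero]; exact zero_mem _
    | add y y' _ _ hy hy' => rw [mul_add]; exact add_mem (hy x hx) (hy' x hx)
    | smul s y _ hy =>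
      rw [show x * s • y = x * (s • 1) * y by rw [mul_assoc, smul_mul_assoc, one_mul]]
      exact hy _ (IsSubbimodule.mul_mem _ hx s)

theorem ofT_mem {n : ℕ} {t : TensorRing S V} (ht : t ∈ TensorRing.deg S V n) :
    ofT α t ∈ deg α n :=
  Submodule.subset_span ⟨n, 0, rfl, t, ht, by rw [pow_zero, mul_one]; rfl⟩

theorem mem_deg_zero {d : CentralExt α} (hd : d ∈ deg α 0) : ∃ s : S, s • 1 = d := by
  change d ∈ LinearMap.range (LinearMap.toSpanSingleton S (CentralExt α) 1)
  refine Submodule.span_le.2 ?_ hd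
  rintro _ ⟨i, j, hij, t, ht, rfl⟩
  obtain ⟨rfl, rfl⟩ : i = 0 ∧ j = 0 := by omega
  obtain ⟨s, rfl⟩ := TensorRing.mem_deg_zero ht
  refine ⟨s, ?_⟩
  rw [pow_zero, mul_one]
  exact (ofT_inS α s).symm

theorem deg_induction {p : CentralExt α → Prop} (hom : ∀ n, ∀ d ∈ deg α n, p d)
    (add : ∀ x y, p x → p y → p (x + y)) (d : CentralExt α) : p d := by
  obtain ⟨q, rfl⟩ := mk_surjective α d
  induction q using Polynomial.induction_on' with
  | add x y hx hy => rw [map_add]; exact add _ _ hx hy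
  | monomial i t =>
    induction t using DirectSum.Decomposition.inductionOn (TensorRing.deg S V) with
    | zero => rw [Polynomial.monomial_zero_right, map_zero]; exact hom 0 0 (zero_mem _)
    | @homogeneous j t =>
      exact hom (j + i) _ (Submodule.subset_span ⟨j, i, rfl, t, t.2, by
        rw [Polynomial.C_mul_X_pow_eq_monomial]⟩)
    | add x y hx hy => rw [map_add (Polynomial.monomial _), map_add]; exact add _ _ hx hy

/-! ### Projections of `D` onto its components, obtained from a degree-recording map `D → D[X]`. -/

/-- The morphism `T → D[X]` with `v ↦ v X`. -/
def gradingT : TensorRing S V →+* (CentralExt α)[X] :=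
  TensorRing.lift (Polynomial.C.comp (inS α))
    ((Polynomial.monomial 1).toAddMonoidHom.comp
      ((ofT α).toAddMonoidHom.comp (ι S V).toAddMonoidHom))
    (fun s v => by
      change Polynomial.monomial 1 (ofT α (ι S V (s • v))) =
        Polynomial.C (inS α s) * Polynomial.monomial 1 (ofT α (ι S V v))
      rw [Polynomial.C_mul_monomial, map_smul, TensorRing.smul_def, map_mul]
      rfl)
    (fun s v => by
      change Polynomial.monomial 1 (ofT α (ι S V (op s • v))) =
        Polynomial.monomial 1 (ofT α (ι S V v)) * Polynomial.C (inS α s)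
      rw [Polynomial.monomial_mul_C, TensorRing.ι_op_smul, map_mul]
      rfl)

theorem gradingT_of_mem {n : ℕ} {t : TensorRing S V} (ht : t ∈ TensorRing.deg S V n) :
    gradingT α t = Polynomial.monomial n (ofT α t) := by
  induction n generalizing t with
  | zero =>
    obtain ⟨s, rfl⟩ := TensorRing.mem_deg_zero ht
    exact TensorRing.lift_inS _ _ _ _ s
  | succ n ih =>
    refine TensorRing.deg_succ_induction
      (p := fun t => gradingT α t = Polynomial.monomial (n + 1) (ofT α t))
      (fun x hx v => ?_) (fun x y hx hy => ?_) ht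
    · rw [map_mul, ih hx, map_mul, ← Polynomial.monomial_mul_monomial]
      congr 1
      exact TensorRing.lift_ι _ _ _ _ v
    · rw [map_add, hx, hy, map_add, map_add (Polynomial.monomial _)]

/-- The morphism `T[z] → D[X]` with `v ↦ v X` and `z ↦ z X`. -/
def gradingPoly : (TensorRing S V)[X] →+* (CentralExt α)[X] :=
  Polynomial.eval₂RingHom' (gradingT α) (Polynomial.monomial 1 (z α)) fun t => by
    induction t using TensorRing.induction_on with
    | hs s =>
      rw [gradingT_of_mem α (TensorRing.inS_mem_deg S V s), Commute, SemiconjBy,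
        Polynomial.monomial_mul_monomial, Polynomial.monomial_mul_monomial, z_mul, add_comm]
    | hv v =>
      rw [gradingT_of_mem α (TensorRing.ι_mem_deg S V v), Commute, SemiconjBy,
        Polynomial.monomial_mul_monomial, Polynomial.monomial_mul_monomial, z_mul]
    | hm x y hx hy => rw [map_mul]; exact hx.mul_left hy
    | ha x y hx hy => rw [map_add]; exact hx.add_left hy

theorem gradingPoly_monomial {i j n : ℕ} (hij : i + j = n) {t : TensorRing S V}
    (ht : t ∈ TensorRing.deg S V j) : gradingPoly α (Polynomial.monomial i t) =
      Polynomial.monomial n (mk α (Polynomial.monomial i t)) := by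
  change Polynomial.eval₂ _ _ _ = _
  rw [Polynomial.eval₂_monomial, gradingT_of_mem α ht, Polynomial.monomial_pow,
    Polynomial.monomial_mul_monomial, mk_monomial, one_mul, add_comm, hij]

/-- The morphism `D → D[X]` with `d ↦ d Xⁿ` for `d ∈ Dⁿ`. -/
def grading : CentralExt α →+* (CentralExt α)[X] :=
  lift (gradingPoly α) (by
    intro p hp
    refine Submodule.span_induction ?_ (map_zero _) ?_ ?_ hp
    · rintro _ ⟨n, r, hr, rfl⟩
      -- `α_z(r)` is homogeneous of degree `n`, so recording degrees only multiplies its class,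
      -- which is zero in `D`, by `Xⁿ`.
      have : gradingPoly α (α.alphaZ n r) = Polynomial.monomial n (mk α (α.alphaZ n r)) := by
        simp only [FilteredMap.alphaZ, map_sum]
        refine Finset.sum_congr rfl fun i hi => ?_
        rw [Finset.mem_range] at hi
        exact gradingPoly_monomial α (by omega) (SetLike.coe_mem _)
      rw [this, mk_eq_zero (Submodule.subset_span ⟨n, r, hr, rfl⟩), Polynomial.monomial_zero_right]
    · intro x y _ _ hx hy
      rw [map_add, hx, hy, add_zero]
    · intro s x _ hx
      rw [show s • x = Polynomial.C (TensorRing.inS S V s) * x by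
        ext n
        rw [Polynomial.coeff_smul, Polynomial.coeff_C_mul, TensorRing.smul_def], map_mul, hx,
        mul_zero])

theorem grading_of_mem {n : ℕ} {d : CentralExt α} (hd : d ∈ deg α n) :
    grading α d = Polynomial.monomial n d := by
  have h : ∀ (s : S) (d : CentralExt α), grading α (s • d) =
      Polynomial.C (inS α s) * grading α d := fun s d => by
    rw [smul_def, map_mul]
    congr 1
    change gradingPoly α (Polynomial.monomial 0 (TensorRing.inS S V s)) = _
    rw [gradingPoly_monomial α rfl (TensorRing.inS_mem_deg S V s)]
    rfl
  induction hd using Submodule.span_induction with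
  | mem x hx =>
    obtain ⟨i, j, hij, t, ht, rfl⟩ := hx
    rw [Polynomial.C_mul_X_pow_eq_monomial]
    exact gradingPoly_monomial α (by omega) ht
  | zero => rw [map_zero, Polynomial.monomial_zero_right]
  | add x y _ _ hx hy => rw [map_add, hx, hy, map_add (Polynomial.monomial _)]
  | smul s x _ hx => rw [h, hx, Polynomial.C_mul_monomial]; rfl

/-- The projection of `D` onto its component of degree `n`. -/
def proj (n : ℕ) : CentralExt α →+ CentralExt α :=
  (Polynomial.lcoeff _ n).toAddMonoidHom.comp (grading α).toAddMonoidHom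

theorem proj_apply (n : ℕ) (d : CentralExt α) : proj α n d = (grading α d).coeff n := rfl

theorem proj_of_mem {n m : ℕ} {d : CentralExt α} (hd : d ∈ deg α m) :
    proj α n d = if m = n then d else 0 := by
  rw [proj_apply, grading_of_mem α hd, Polynomial.coeff_monomial]

/-- Scalars have degree zero. This is the balancing condition that lets the projections act on `D ⊗
D¹`. -/
theorem proj_mul_smul_one (n : ℕ) (d : CentralExt α) (s : S) :
    proj α n (d * (s • 1)) = proj α n d * (s • 1) := by
  rw [proj_apply, map_mul, grading_of_mem α
    ((deg α 0).smul_mem s (SetLike.one_mem_graded (deg α))), Polynomial.monomial_zero_left,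
    Polynomial.coeff_mul_C]
  rfl

end CentralExt

end PBW

end

noncomputable section

namespace PBW

open TensorRing

namespace CentralExt

/-! ### The component of degree one of the central extension -/

section General

variable {S B : Type*} [Ring S] [Ring B] [Module S B] [IsScalarTower S B B]
  {V : Submodule S B} [IsSubbimodule V]
  {R : Submodule S (TensorRing S V)} [IsSubbimodule R] (α : FilteredMap R)

variable (S V) in
/-- The morphism from `T` to the square zero extension of `S` by `V × S` with kernel `T^{≥ 2}`. -/
def squareZeroT : TensorRing S V →+* TrivSqZeroExt S (V × S) :=
  TensorRing.lift (TrivSqZeroExt.inlHom S (V × S))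
    ((TrivSqZeroExt.inrHom S (V × S)).toAddMonoidHom.comp (LinearMap.inl S V S).toAddMonoidHom)
    (fun s v => by
      ext <;> simp)
    (fun s v => by
      ext <;> simp)

theorem squareZeroT_ι (v : V) : squareZeroT S V (ι S V v) = TrivSqZeroExt.inr (v, 0) :=
  TensorRing.lift_ι _ _ _ _ v

theorem squareZeroT_inS (s : S) : squareZeroT S V (TensorRing.inS S V s) = TrivSqZeroExt.inl s :=
  TensorRing.lift_inS _ _ _ _ s

theorem _root_.TrivSqZeroExt.mul_eq_zero_of_fst {x y : TrivSqZeroExt S (V × S)}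
    (hx : x.fst = 0) (hy : y.fst = 0) : x * y = 0 := by
  ext <;> simp [hx, hy]

theorem squareZeroT_fst {n : ℕ} {t : TensorRing S V} (ht : t ∈ TensorRing.deg S V (n + 1)) :
    (squareZeroT S V t).fst = 0 := by
  refine deg_succ_induction (p := fun t => (squareZeroT S V t).fst = 0) (fun x _ v => ?_)
    (fun x y hx hy => ?_) ht
  · simp [squareZeroT_ι]
  · rw [map_add, TrivSqZeroExt.fst_add, hx, hy, add_zero]

theorem squareZeroT_eq_zero {n : ℕ} {t : TensorRing S V} (ht : t ∈ TensorRing.deg S V (n + 2)) :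
    squareZeroT S V t = 0 := by
  refine deg_succ_induction (p := fun t => squareZeroT S V t = 0) (fun x hx v => ?_)
    (fun x y hx hy => ?_) ht
  · rw [map_mul]
    refine TrivSqZeroExt.mul_eq_zero_of_fst (squareZeroT_fst hx) ?_
    simp [squareZeroT_ι]
  · rw [map_add, hx, hy, add_zero]

variable (S V) in
/-- The extension of `squareZeroT` to `T[z]`. -/
def squareZeroPoly : (TensorRing S V)[X] →+* TrivSqZeroExt S (V × S) :=
  Polynomial.eval₂RingHom' (squareZeroT S V) (TrivSqZeroExt.inr (0, 1)) fun t => by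
    induction t using TensorRing.induction_on with
    | hs s =>
      rw [squareZeroT_inS, Commute, SemiconjBy]
      ext <;> simp
    | hv v =>
      rw [squareZeroT_ι, Commute, SemiconjBy]
      ext <;> simp
    | hm x y hx hy => rw [map_mul]; exact hx.mul_left hy
    | ha x y hx hy => rw [map_add]; exact hx.add_left hy

theorem squareZeroPoly_monomial_eq_zero {i j : ℕ} (hij : 2 ≤ i + j) {t : TensorRing S V}
    (ht : t ∈ TensorRing.deg S V j) : squareZeroPoly S V (Polynomial.monomial i t) = 0 := by
  change Polynomial.eval₂ _ _ _ = _
  rw [Polynomial.eval₂_monomial]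
  obtain rfl | rfl | hi : i = 0 ∨ i = 1 ∨ 2 ≤ i := by omega
  · obtain ⟨j, rfl⟩ : ∃ k, j = k + 2 := ⟨j - 2, by omega⟩
    rw [squareZeroT_eq_zero ht, zero_mul]
  · obtain ⟨j, rfl⟩ : ∃ k, j = k + 1 := ⟨j - 1, by omega⟩
    rw [pow_one]
    exact TrivSqZeroExt.mul_eq_zero_of_fst (squareZeroT_fst ht) (by simp)
  · obtain ⟨i, rfl⟩ : ∃ k, i = k + 2 := ⟨i - 2, by omega⟩
    rw [pow_add, pow_two, TrivSqZeroExt.inr_mul_inr, mul_zero, mul_zero]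

end General

section Connected

variable {S A : Type*} [Ring S] [Ring A] [Module S A] [IsScalarTower S A A]
  {𝒜 : ℕ → Submodule S A} [GradedRing 𝒜]
  {R : Submodule S (TensorRing S (𝒜 1))} [IsSubbimodule R]

/-- `T → A` is injective in degree zero because `A` is connected, and in degree one because it
restricts there to the inclusion of `A¹`. So there are no nonzero relations in these degrees. -/
theorem two_le_of_mem (hconn : IsConnected 𝒜) (hR : IsRelationBimodule R) {n : ℕ} {r : R}
    (hr : (r : TensorRing S (𝒜 1)) ∈ TensorRing.deg S (𝒜 1) n) (h0 : r ≠ 0) : 2 ≤ n := by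
  have h1 : toRing (𝒜 1) (r : TensorRing S (𝒜 1)) = 0 := hR.le r.2
  by_contra hn
  refine h0 (Subtype.ext ?_)
  obtain rfl | rfl : n = 0 ∨ n = 1 := by omega
  · obtain ⟨s, hs⟩ := TensorRing.mem_deg_zero hr
    rw [← hs, toRing_inS, ← zero_smul S (1 : A)] at h1
    rw [← hs, hconn.injective h1, map_zero]
    rfl
  · obtain ⟨v, hv⟩ := TensorRing.mem_deg_one hr
    rw [← hv, toRing_ι] at h1
    rw [← hv, Subtype.ext (h1.trans Submodule.coe_zero.symm), map_zero]
    rfl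

variable (hconn : IsConnected 𝒜) (hR : IsRelationBimodule R) (α : FilteredMap R)

/-- The morphism from `D` to the square zero extension of `S` by `V × S`. -/
def squareZero : CentralExt α →+* TrivSqZeroExt S (𝒜 1 × S) :=
  lift (squareZeroPoly S (𝒜 1)) (by
    intro p hp
    obtain ⟨r, rfl⟩ := (α.mem_Pz hR.homogeneous).1 hp
    refine FilteredMap.homogeneous_induction hR.homogeneous
      (p := fun r => squareZeroPoly S (𝒜 1) (α.polyMap hR.homogeneous r) = 0)
      (fun n r hr => ?_) (fun x y hx hy => ?_) r
    -- Nonzero relations have degree at least two, and every monomial of degree at least two dies in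
    -- the square zero extension.
    · by_cases h0 : r = 0
      · rw [h0, map_zero, map_zero]
      · have h2 := two_le_of_mem hconn hR hr h0
        refine α.polyMap_induction hR.homogeneous (p := fun p => squareZeroPoly S (𝒜 1) p = 0) hr
          (fun i j hij t ht => squareZeroPoly_monomial_eq_zero (hij ▸ h2) ht) fun x y hx hy => ?_
        rw [map_add, hx, hy, add_zero]
    · rw [map_add, map_add, hx, hy, add_zero])

/-- The map `V ⊕ S → D¹`, `(v, s) ↦ v + s z`. -/
def degOneHom : (𝒜 1 × S) →ₗ[S] deg α 1 :=
  (inclV α).coprod (LinearMap.toSpanSingleton S _ (zOne α))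

theorem degOneHom_apply (v : 𝒜 1) (s : S) :
    degOneHom α (v, s) = inclV α v + s • zOne α := rfl

/-- Provides a retraction of `V ⊕ S → D¹`: the relations of `D` impose nothing in degree one. -/
theorem squareZero_degOneHom (p : 𝒜 1 × S) :
    squareZero hconn hR α (degOneHom α p) = TrivSqZeroExt.inr p := by
  obtain ⟨v, s⟩ := p
  have h1 : squareZero hconn hR α (inclV α v) = TrivSqZeroExt.inr (v, 0) := by
    change squareZeroPoly S (𝒜 1) (Polynomial.C (ι S (𝒜 1) v)) = _
    change Polynomial.eval₂ _ _ _ = _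
    rw [Polynomial.eval₂_C, squareZeroT_ι]
  have h2 : squareZero hconn hR α (s • z α) = TrivSqZeroExt.inr (0, s) := by
    rw [smul_def, map_mul]
    change squareZeroPoly S (𝒜 1) (Polynomial.C (TensorRing.inS S (𝒜 1) s)) *
      squareZeroPoly S (𝒜 1) Polynomial.X = _
    change Polynomial.eval₂ _ _ _ * Polynomial.eval₂ _ _ _ = _
    rw [Polynomial.eval₂_C, Polynomial.eval₂_X, squareZeroT_inS]
    ext <;> simp
  rw [degOneHom_apply, Submodule.coe_add, map_add, h1, Submodule.coe_smul]
  change _ + squareZero hconn hR α (s • z α) = _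
  rw [h2, ← TrivSqZeroExt.inr_add, Prod.mk_add_mk, add_zero, zero_add]

theorem degOneHom_surjective : Function.Surjective (degOneHom α) := by
  intro w
  have h : (w : CentralExt α) ∈ LinearMap.range ((deg α 1).subtype.comp (degOneHom α)) := by
    refine Submodule.span_le.2 ?_ w.2
    rintro _ ⟨i, j, hij, t, ht, rfl⟩
    obtain ⟨rfl, rfl⟩ | ⟨rfl, rfl⟩ : i = 1 ∧ j = 0 ∨ i = 0 ∧ j = 1 := by omega
    · obtain ⟨v, rfl⟩ := TensorRing.mem_deg_one ht
      refine ⟨(v, 0), ?_⟩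
      rw [LinearMap.comp_apply, degOneHom_apply, zero_smul, add_zero, pow_zero, mul_one]
      rfl
    · obtain ⟨s, rfl⟩ := TensorRing.mem_deg_zero ht
      refine ⟨(0, s), ?_⟩
      rw [LinearMap.comp_apply, degOneHom_apply, map_zero, zero_add, pow_one, map_mul]
      rfl
  obtain ⟨p, hp⟩ := h
  exact ⟨p, Subtype.ext hp⟩

/-- The isomorphism `V ⊕ S ≃ D¹`, `(v, s) ↦ v + s z`. -/
def degOneEquiv : (𝒜 1 × S) ≃ₗ[S] deg α 1 :=
  LinearEquiv.ofBijective (degOneHom α) ⟨fun p q h => by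
    have h2 := squareZero_degOneHom hconn hR α p
    rw [h, squareZero_degOneHom hconn hR α q] at h2
    exact (TrivSqZeroExt.inr_injective h2).symm, degOneHom_surjective α⟩

theorem degOneEquiv_apply (v : 𝒜 1) (s : S) :
    degOneEquiv hconn hR α (v, s) = inclV α v + s • zOne α := rfl

theorem degOneEquiv_symm_inclV (v : 𝒜 1) :
    (degOneEquiv hconn hR α).symm (inclV α v) = (v, 0) := by
  rw [LinearEquiv.symm_apply_eq, degOneEquiv_apply, zero_smul, add_zero]

theorem degOneEquiv_symm_zOne : (degOneEquiv hconn hR α).symm (zOne α) = (0, 1) := by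
  rw [LinearEquiv.symm_apply_eq, degOneEquiv_apply, map_zero, one_smul, zero_add]

theorem inclV_op_smul (s : S) (v : 𝒜 1) : inclV α (op s • v) = op s • inclV α v := by
  refine Subtype.ext ?_
  rw [IsSubbimodule.coe_op_smul, ← ofT_ι, ← ofT_ι, ι_op_smul, map_mul, ofT_inS]

theorem op_smul_zOne (s : S) : op s • zOne α = s • zOne α :=
  Subtype.ext (z_smul_one α s)

/-- As `z` commutes with scalars, `D¹ ≅ V ⊕ S` also respects the right actions, so maps defined by
coordinates on `D¹` extend to `T_S(D¹)`. -/
theorem degOneEquiv_symm_op_smul (s : S) (w : deg α 1) :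
    (degOneEquiv hconn hR α).symm (op s • w) = (op s • ((degOneEquiv hconn hR α).symm w).1,
      ((degOneEquiv hconn hR α).symm w).2 * s) := by
  obtain ⟨⟨v, t⟩, rfl⟩ := (degOneEquiv hconn hR α).surjective w
  rw [LinearEquiv.symm_apply_apply, LinearEquiv.symm_apply_eq, degOneEquiv_apply,
    degOneEquiv_apply, smul_add, ← smul_comm t, op_smul_zOne, inclV_op_smul, mul_smul]

/-! ### The bimodule `R_D` -/

/-- The morphism `T_S(D¹) → T_S(V)` with `z ↦ 0`. -/
def killZ : TensorRing S (deg α 1) →+* TensorRing S (𝒜 1) :=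
  TensorRing.lift (TensorRing.inS S (𝒜 1))
    ((ι S (𝒜 1)).comp ((LinearMap.fst S (𝒜 1) S).comp
      (degOneEquiv hconn hR α).symm.toLinearMap)).toAddMonoidHom
    (fun s w => by
      change ι S (𝒜 1) ((degOneEquiv hconn hR α).symm (s • w)).1 = _
      rw [map_smul, Prod.smul_fst, map_smul]
      rfl)
    (fun s w => by
      change ι S (𝒜 1) ((degOneEquiv hconn hR α).symm (op s • w)).1 = _
      rw [degOneEquiv_symm_op_smul, ι_op_smul]
      rfl)

theorem killZ_ι (w : deg α 1) : killZ hconn hR α (ι S _ w) =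
    ι S (𝒜 1) ((degOneEquiv hconn hR α).symm w).1 := TensorRing.lift_ι _ _ _ _ w

theorem killZ_inS (s : S) : killZ hconn hR α (TensorRing.inS S _ s) =
    TensorRing.inS S (𝒜 1) s := TensorRing.lift_inS _ _ _ _ s

theorem zeta_ι (v : 𝒜 1) : zeta α (ι S (𝒜 1) v) = ι S _ (inclV α v) :=
  TensorRing.lift_ι _ _ _ _ v

theorem zeta_inS (s : S) : zeta α (TensorRing.inS S (𝒜 1) s) = TensorRing.inS S _ s :=
  TensorRing.lift_inS _ _ _ _ s

theorem killZ_zOne : killZ hconn hR α (ι S _ (zOne α)) = 0 := by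
  rw [killZ_ι, degOneEquiv_symm_zOne, map_zero]

theorem killZ_zeta (t : TensorRing S (𝒜 1)) : killZ hconn hR α (zeta α t) = t := by
  have h : (killZ hconn hR α).comp (zeta α) = RingHom.id _ := by
    refine TensorRing.hom_ext (fun s => ?_) (fun v => ?_)
    · rw [RingHom.comp_apply, zeta_inS, killZ_inS]
      rfl
    · rw [RingHom.comp_apply, zeta_ι, killZ_ι, degOneEquiv_symm_inclV]
      rfl
  exact DFunLike.congr_fun h t

theorem killZ_mem {n : ℕ} {x : TensorRing S (deg α 1)}
    (hx : x ∈ TensorRing.deg S (deg α 1) n) : killZ hconn hR α x ∈ TensorRing.deg S (𝒜 1) n := by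
  refine map_deg_mem _ _ (fun s => ?_) (fun w => ?_) n hx
  · rw [killZ_inS]
    exact TensorRing.inS_mem_deg _ _ s
  · rw [killZ_ι]
    exact TensorRing.ι_mem_deg _ _ _

theorem zeta_mem {n : ℕ} {t : TensorRing S (𝒜 1)}
    (ht : t ∈ TensorRing.deg S (𝒜 1) n) : zeta α t ∈ TensorRing.deg S (deg α 1) n := by
  refine map_deg_mem _ _ (fun s => ?_) (fun v => ?_) n ht
  · rw [zeta_inS]
    exact TensorRing.inS_mem_deg _ _ s
  · rw [zeta_ι]
    exact TensorRing.ι_mem_deg _ _ _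

theorem lam_monomial (i : ℕ) (t : TensorRing S (𝒜 1)) :
    lam α (Polynomial.monomial i t) = zeta α t * ι S _ (zOne α) ^ i :=
  Polynomial.eval₂_monomial _ _

theorem lam_add (p q : (TensorRing S (𝒜 1))[X]) : lam α (p + q) = lam α p + lam α q :=
  Polynomial.eval₂_add _ _

/-- The map `λ` as a linear map. -/
def lamₗ : (TensorRing S (𝒜 1))[X] →ₗ[S] TensorRing S (deg α 1) where
  toFun := lam α
  map_add' := lam_add α
  map_smul' s p := by
    induction p using Polynomial.induction_on' with
    | add p q hp hq => rw [smul_add, lam_add, lam_add, smul_add, hp, hq]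
    | monomial i t =>
      rw [Polynomial.smul_monomial, lam_monomial, lam_monomial, RingHom.id_apply,
        TensorRing.smul_def, TensorRing.smul_def, map_mul, zeta_inS, mul_assoc]

theorem commute_zOne_inS (s : S) :
    Commute (ι S _ (zOne α)) (TensorRing.inS S (deg α 1) s) := by
  change ι S _ (zOne α) * _ = _ * ι S _ (zOne α)
  rw [← ι_op_smul, op_smul_zOne, map_smul, TensorRing.smul_def]

/-- `λ` need not be multiplicative, since `z` need not be central in `T_S(D¹)`; but `z` does commute
with scalars there. -/
theorem lam_mul_C (p : (TensorRing S (𝒜 1))[X]) (s : S) :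
    lam α (p * Polynomial.C (TensorRing.inS S (𝒜 1) s)) = lam α p * TensorRing.inS S _ s := by
  induction p using Polynomial.induction_on' with
  | add p q hp hq => rw [add_mul, lam_add, lam_add, add_mul, hp, hq]
  | monomial i t =>
    rw [Polynomial.monomial_mul_C, lam_monomial, lam_monomial, map_mul, zeta_inS, mul_assoc,
      mul_assoc, ((commute_zOne_inS α s).pow_left i).eq]

theorem killZ_lam (p : (TensorRing S (𝒜 1))[X]) : killZ hconn hR α (lam α p) = p.coeff 0 := by
  induction p using Polynomial.induction_on' with
  | add p q hp hq => rw [lam_add, map_add, hp, hq, Polynomial.coeff_add]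
  | monomial i t =>
    rw [lam_monomial, map_mul, killZ_zeta, map_pow, killZ_zOne, Polynomial.coeff_monomial]
    split_ifs with h
    · rw [h, pow_zero, mul_one]
    · rw [zero_pow h, mul_zero]

theorem toRing_zeta (t : TensorRing S (𝒜 1)) : toRing (deg α 1) (zeta α t) = ofT α t := by
  have h : (toRing (deg α 1)).comp (zeta α) = ofT α := by
    refine TensorRing.hom_ext (fun s => ?_) (fun v => ?_)
    · rw [RingHom.comp_apply, zeta_inS, toRing_inS, ofT_inS]
    · rw [RingHom.comp_apply, zeta_ι, toRing_ι]
      rfl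
  exact DFunLike.congr_fun h t

theorem toRing_zOne : toRing (deg α 1) (ι S _ (zOne α)) = z α := toRing_ι _ _

theorem toRing_lam (p : (TensorRing S (𝒜 1))[X]) : toRing (deg α 1) (lam α p) = mk α p := by
  induction p using Polynomial.induction_on' with
  | add p q hp hq => rw [lam_add, map_add, hp, hq, map_add]
  | monomial i t =>
    rw [lam_monomial, map_mul, map_pow, toRing_zeta, toRing_zOne, mk_monomial]

theorem toRing_degOne_surjective : Function.Surjective (toRing (deg α 1)) := fun d => by
  obtain ⟨p, rfl⟩ := mk_surjective α d
  exact ⟨lam α p, toRing_lam α p⟩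

/-! ### The commutators `[z, v]`. -/

/-- The map `v ↦ [z, v] = z ⊗ v - v ⊗ z`. -/
def commHom : 𝒜 1 →ₗ[S] TensorRing S (deg α 1) where
  toFun v := ι S _ (zOne α) * ι S _ (inclV α v) - ι S _ (inclV α v) * ι S _ (zOne α)
  map_add' v w := by
    simp only [map_add, mul_add, add_mul]
    abel
  map_smul' s v := by
    simp only [map_smul, RingHom.id_apply, smul_sub, TensorRing.smul_def]
    rw [← mul_assoc, (commute_zOne_inS α s).eq, mul_assoc, mul_assoc]

theorem commHom_apply (v : 𝒜 1) : commHom α v =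
    ι S _ (zOne α) * ι S _ (inclV α v) - ι S _ (inclV α v) * ι S _ (zOne α) := rfl

theorem commHom_mem (v : 𝒜 1) : commHom α v ∈ TensorRing.deg S (deg α 1) 2 :=
  sub_mem (SetLike.mul_mem_graded (TensorRing.ι_mem_deg _ _ _) (TensorRing.ι_mem_deg _ _ _))
    (SetLike.mul_mem_graded (TensorRing.ι_mem_deg _ _ _) (TensorRing.ι_mem_deg _ _ _))

theorem range_commHom : LinearMap.range (commHom α) = commZ α :=
  le_antisymm (by rintro _ ⟨v, rfl⟩; exact Submodule.subset_span ⟨v, rfl⟩)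
    (Submodule.span_le.2 (by rintro _ ⟨v, rfl⟩; exact ⟨v, rfl⟩))

/-- A representation of `T_S(D¹)` by matrices in which no `[z, v]` with `v ≠ 0` vanishes. -/
def matrixRep : TensorRing S (deg α 1) →+* Matrix (Fin 2) (Fin 2) (TensorRing S (𝒜 1)) :=
  TensorRing.lift ((Matrix.scalar (Fin 2)).comp (TensorRing.inS S (𝒜 1)))
    (AddMonoidHom.mk' (fun w =>
      !![0, TensorRing.inS S (𝒜 1) ((degOneEquiv hconn hR α).symm w).2;
        0, ι S (𝒜 1) ((degOneEquiv hconn hR α).symm w).1])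
      (fun v w => by ext i j; fin_cases i <;> fin_cases j <;> simp))
    (fun s w => by
      ext i j
      fin_cases i <;> fin_cases j <;> simp [TensorRing.smul_def])
    (fun s w => by
      ext i j
      fin_cases i <;> fin_cases j <;> simp [degOneEquiv_symm_op_smul, ι_op_smul])

theorem matrixRep_ι (w : deg α 1) : matrixRep hconn hR α (ι S _ w) =
    !![0, TensorRing.inS S (𝒜 1) ((degOneEquiv hconn hR α).symm w).2;
        0, ι S (𝒜 1) ((degOneEquiv hconn hR α).symm w).1] := TensorRing.lift_ι _ _ _ _ w

include hconn hR in
-- `matrixRep` sends `z` to `E₀₁` and `v` to `v E₁₁`. Hence `z v ↦ v E₀₁` and `v z ↦ 0`, and `v` is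
-- read off from the entry `(0, 1)` of the commutator.
theorem commHom_injective : Function.Injective (commHom α) := by
  rw [← LinearMap.ker_eq_bot, LinearMap.ker_eq_bot']
  intro v hv
  have h := congrArg (fun x => toRing (𝒜 1) (matrixRep hconn hR α x 0 1)) hv
  simp only [commHom_apply, map_sub, map_mul, matrixRep_ι, degOneEquiv_symm_inclV,
    degOneEquiv_symm_zOne] at h
  refine Subtype.ext ?_
  simpa [toRing_ι] using h

theorem killZ_commHom (v : 𝒜 1) : killZ hconn hR α (commHom α v) = 0 := by
  rw [commHom_apply, map_sub, map_mul, map_mul, killZ_zOne, mul_zero, zero_mul, sub_zero]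

theorem toRing_commHom (v : 𝒜 1) : toRing (deg α 1) (commHom α v) = 0 := by
  rw [commHom_apply, map_sub, map_mul, map_mul, toRing_zOne, z_mul, sub_self]

/-! ### The decomposition `R_D ≅ R ⊕ V` and the generation of the relations of `D`. -/

/-- The map `r ↦ λ(α_z(r))`. -/
def lamRel : R →ₗ[S] TensorRing S (deg α 1) := (lamₗ α).comp (α.polyMap hR.homogeneous)

theorem lamRel_apply (r : R) : lamRel hR α r = lam α (α.polyMap hR.homogeneous r) := rfl

theorem killZ_lamRel (r : R) : killZ hconn hR α (lamRel hR α r) = r := by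
  rw [lamRel_apply, killZ_lam, α.polyMap_coeff_zero]

theorem toRing_lamRel (r : R) : toRing (deg α 1) (lamRel hR α r) = 0 := by
  rw [lamRel_apply, toRing_lam]
  exact mk_eq_zero ((α.mem_Pz hR.homogeneous).2 ⟨r, rfl⟩)

theorem lamRel_mem {n : ℕ} {r : R} (hr : (r : TensorRing S (𝒜 1)) ∈ TensorRing.deg S (𝒜 1) n) :
    lamRel hR α r ∈ TensorRing.deg S (deg α 1) n := by
  rw [lamRel_apply]
  refine α.polyMap_induction hR.homogeneous (p := fun p => lam α p ∈ _) hr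
    (fun i j hij t ht => ?_) (fun x y hx hy => ?_)
  · rw [lam_monomial, ← hij, add_comm]
    refine SetLike.mul_mem_graded (zeta_mem α ht) ?_
    simpa using SetLike.pow_mem_graded i (TensorRing.ι_mem_deg S (deg α 1) (zOne α))
  · rw [lam_add]
    exact add_mem hx hy

theorem range_lamRel : LinearMap.range (lamRel hR α) = lamPz α := by
  refine le_antisymm ?_ (Submodule.span_le.2 ?_)
  · rintro _ ⟨r, rfl⟩
    exact Submodule.subset_span ⟨_, (α.mem_Pz hR.homogeneous).2 ⟨r, rfl⟩, rfl⟩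
  · rintro _ ⟨p, hp, rfl⟩
    obtain ⟨r, rfl⟩ := (α.mem_Pz hR.homogeneous).1 hp
    exact ⟨r, rfl⟩

include hconn hR in
-- Setting `z = 0` kills commutators and sends `λ(α_z(r))` to `r`.
theorem disjoint_lamPz_commZ : Disjoint (lamPz α) (commZ α) := by
  rw [Submodule.disjoint_def, ← range_lamRel hR, ← range_commHom]
  rintro _ ⟨r, rfl⟩ ⟨v, hv⟩
  have h := killZ_lamRel hconn hR α r
  rw [← hv, killZ_commHom] at h
  rw [show r = 0 from Subtype.ext h.symm, map_zero]

/-- The map `(r, v) ↦ λ(α_z(r)) + [z, v]`. -/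
def relHom : (R × 𝒜 1) →ₗ[S] TensorRing S (deg α 1) := (lamRel hR α).coprod (commHom α)

theorem range_relHom : LinearMap.range (relHom hR α) = relD α := by
  rw [relHom, LinearMap.range_coprod, range_lamRel, range_commHom]
  rfl

include hconn in
theorem relHom_injective : Function.Injective (relHom hR α) := by
  rw [← LinearMap.ker_eq_bot, LinearMap.ker_eq_bot']
  rintro ⟨r, v⟩ h
  change lamRel hR α r + commHom α v = 0 at h
  have h1 := congrArg (killZ hconn hR α) h
  rw [map_add, killZ_lamRel, killZ_commHom, add_zero, map_zero] at h1
  have h2 : r = 0 := Subtype.ext h1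
  rw [h2, map_zero, zero_add, ← map_zero (commHom α)] at h
  rw [h2, commHom_injective hconn hR α h]
  rfl

/-- The isomorphism `R ⊕ V ≃ R_D`. -/
def relEquiv : (R × 𝒜 1) ≃ₗ[S] relD α :=
  (LinearEquiv.ofInjective (relHom hR α) (relHom_injective hconn hR α)).trans
    (LinearEquiv.ofEq _ _ (range_relHom hR α))

theorem coe_relEquiv (r : R) (v : 𝒜 1) : (relEquiv hconn hR α (r, v) : TensorRing S (deg α 1)) =
    lamRel hR α r + commHom α v := rfl

include hR in
theorem relD_mul_inS (x : TensorRing S (deg α 1)) (hx : x ∈ relD α) (s : S) :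
    x * TensorRing.inS S (deg α 1) s ∈ relD α := by
  rw [← range_relHom hR] at hx ⊢
  obtain ⟨⟨r, v⟩, rfl⟩ := hx
  refine ⟨(op s • r, op s • v), ?_⟩
  change lamRel hR α (op s • r) + commHom α (op s • v) = (lamRel hR α r + commHom α v) * _
  rw [add_mul, lamRel_apply, α.polyMap_op_smul, lam_mul_C]
  congr 1
  rw [commHom_apply, commHom_apply, inclV_op_smul, ι_op_smul, sub_mul, mul_assoc, mul_assoc,
    mul_assoc, (commute_zOne_inS α s).eq]

include hR in
theorem relD_le : relD α ≤ relIdeal (deg α 1) := by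
  rw [← range_relHom hR]
  rintro _ ⟨⟨r, v⟩, rfl⟩
  rw [mem_relIdeal]
  change toRing (deg α 1) (lamRel hR α r + commHom α v) = 0
  rw [map_add, toRing_lamRel, toRing_commHom, add_zero]

/-- Modulo the ideal `J` of `R_D`, the element `z` commutes with the image of `ζ`, so `λ` induces a
ring morphism `T[z] → T_D / J`. It kills `P_z` and descends to `G : D → T_D / J`. On generators `G ∘
π_D` agrees with the quotient map, so the kernel of `π_D` lies in `J`. -/
theorem mem_span_relD {x : TensorRing S (deg α 1)} (hx : toRing (deg α 1) x = 0) :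
    x ∈ TwoSidedIdeal.span (relD α : Set (TensorRing S (deg α 1))) := by
  set J := TwoSidedIdeal.span (relD α : Set (TensorRing S (deg α 1)))
  let q : TensorRing S (deg α 1) →+* J.ringCon.Quotient := RingCon.mk' _
  have hq : ∀ x, q x = 0 ↔ x ∈ J := fun x => by
    rw [TwoSidedIdeal.mem_iff, ← map_zero q]
    exact RingCon.eq _
  have hcomm : ∀ t, Commute (q (zeta α t)) (q (ι S _ (zOne α))) := by
    intro t
    induction t using TensorRing.induction_on with
    | hs s =>
      rw [zeta_inS]
      exact ((commute_zOne_inS α s).map q).symm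
    | hv v =>
      rw [zeta_ι]
      refine Commute.symm (sub_eq_zero.1 ?_)
      rw [← map_mul q, ← map_mul q, ← map_sub q, hq]
      refine TwoSidedIdeal.subset_span (Submodule.mem_sup_right ?_)
      rw [← range_commHom]
      exact ⟨v, rfl⟩
    | hm x y hx hy => rw [map_mul, map_mul]; exact hx.mul_left hy
    | ha x y hx hy => rw [map_add, map_add]; exact hx.add_left hy
  let g : (TensorRing S (𝒜 1))[X] →+* J.ringCon.Quotient :=
    Polynomial.eval₂RingHom' (q.comp (zeta α)) (q (ι S _ (zOne α))) hcomm
  have hg : ∀ p, g p = q (lam α p) := by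
    intro p
    induction p using Polynomial.induction_on' with
    | add p p' hp hp' => rw [map_add, hp, hp', lam_add, map_add]
    | monomial i t =>
      rw [lam_monomial, map_mul, map_pow]
      exact Polynomial.eval₂_monomial _ _
  let G : CentralExt α →+* J.ringCon.Quotient := lift g fun p hp => by
    rw [hg, hq]
    exact TwoSidedIdeal.subset_span
      (Submodule.mem_sup_left (Submodule.subset_span ⟨p, hp, rfl⟩))
  have hG : ∀ p, G (mk α p) = q (lam α p) := hg
  have h : G.comp (toRing (deg α 1)) = q := by
    have hS : ∀ s : S, G (s • 1) = q (TensorRing.inS S _ s) := fun s => by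
      rw [← ofT_inS]
      change G (mk α (Polynomial.monomial 0 _)) = _
      rw [hG, lam_monomial, pow_zero, mul_one, zeta_inS]
    refine TensorRing.hom_ext (fun s => ?_) (fun w => ?_)
    · rw [RingHom.comp_apply, toRing_inS, hS]
    · obtain ⟨⟨v, s⟩, rfl⟩ := degOneHom_surjective α w
      rw [RingHom.comp_apply, toRing_ι, degOneHom_apply, map_add (ι S _), map_add q,
        Submodule.coe_add, map_add]
      congr 1
      · change G (mk α (Polynomial.monomial 0 _)) = _
        rw [hG, lam_monomial, pow_zero, mul_one, zeta_ι]
      · rw [Submodule.coe_smul, ← one_mul (zOne α : CentralExt α), ← smul_mul_assoc, map_mul, hS,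
          map_smul, TensorRing.smul_def, map_mul]
        congr 1
        change G (mk α Polynomial.X) = _
        rw [hG, ← Polynomial.monomial_one_one_eq_X, lam_monomial, pow_one, map_one, one_mul]
  rw [← hq, ← h, RingHom.comp_apply, hx, map_zero]

end Connected

end CentralExt

end PBW

end

noncomputable section

namespace PBW

open TensorRing

/-! ### Gradings of tensor products -/

namespace BalTensor

variable {S B V : Type*} [Ring S] [Ring B] [Module S B] [IsScalarTower S B B]
  [AddCommGroup V] [Module S V] {𝒷 : ℕ → Submodule S B} {𝓋 : ℕ → Submodule S V}

theorem tmul_mem_deg {i j n : ℕ} (h : i + j = n) {b : B} (hb : b ∈ 𝒷 i) {v : V} (hv : v ∈ 𝓋 j) :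
    tmul S b v ∈ deg 𝒷 𝓋 n := AddSubgroup.subset_closure ⟨i, j, h, b, hb, v, hv, rfl⟩

theorem smul_mem_deg [SetLike.GradedMonoid 𝒷] {i n : ℕ} {b : B} (hb : b ∈ 𝒷 i)
    {x : BalTensor S B V} (hx : x ∈ deg 𝒷 𝓋 n) : b • x ∈ deg 𝒷 𝓋 (i + n) := by
  induction hx using AddSubgroup.closure_induction with
  | mem x hx =>
    obtain ⟨k, j, rfl, c, hc, v, hv, rfl⟩ := hx
    rw [smul_tmul']
    exact tmul_mem_deg (add_assoc i k j) (SetLike.mul_mem_graded hb hc) hv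
  | zero => rw [smul_zero]; exact zero_mem _
  | add x y _ _ hx hy => rw [smul_add]; exact add_mem hx hy
  | neg x _ hx => rw [smul_neg]; exact neg_mem hx

/-- A linear map on `B ⊗ V` is graded if it is graded on `V`. -/
theorem map_deg_mem {M : Type*} [AddCommGroup M] [Module B M] {G : ℕ → AddSubgroup M}
    (hG : ∀ i n, ∀ b ∈ 𝒷 i, ∀ m ∈ G n, b • m ∈ G (i + n)) (f : BalTensor S B V →ₗ[B] M)
    (hf : ∀ j, ∀ v ∈ 𝓋 j, f (tmul S 1 v) ∈ G j) {n : ℕ} {x : BalTensor S B V}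
    (hx : x ∈ deg 𝒷 𝓋 n) : f x ∈ G n := by
  induction hx using AddSubgroup.closure_induction with
  | mem x hx =>
    obtain ⟨i, j, rfl, b, hb, v, hv, rfl⟩ := hx
    rw [tmul_eq_smul, map_smul]
    exact hG i j b hb _ (hf j v hv)
  | zero => rw [map_zero]; exact zero_mem _
  | add x y _ _ hx hy => rw [map_add]; exact add_mem hx hy
  | neg x _ hx => rw [map_neg]; exact neg_mem hx

theorem smul_base_mem_deg {n : ℕ} (s : S) {x : BalTensor S B V} (hx : x ∈ deg 𝒷 𝓋 n) :
    s • x ∈ deg 𝒷 𝓋 n := by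
  induction hx using AddSubgroup.closure_induction with
  | mem x hx =>
    obtain ⟨k, j, h, c, hc, v, hv, rfl⟩ := hx
    rw [smul_tmul_eq]
    exact tmul_mem_deg h ((𝒷 k).smul_mem s hc) hv
  | zero => rw [smul_zero]; exact zero_mem _
  | add x y _ _ hx hy => rw [smul_add]; exact add_mem hx hy
  | neg x _ hx => rw [smul_neg]; exact neg_mem hx

end BalTensor

theorem mem_degOne {S B : Type*} [Ring S] [Ring B] [Module S B] {W : Submodule S B} (w : W) :
    w ∈ degOne W 1 := by
  rw [degOne, if_pos rfl]
  exact Submodule.mem_top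

theorem eq_zero_of_mem_degOne {S B : Type*} [Ring S] [Ring B] [Module S B] {W : Submodule S B}
    {w : W} {j : ℕ} (hw : w ∈ degOne W j) (hj : j ≠ 1) : w = 0 := by
  rw [degOne, if_neg hj] at hw
  exact hw

theorem shift_smul_mem {B M : Type*} [Ring B] [AddCommGroup M] [Module B M]
    {P : ℕ → B → Prop} {G : ℕ → AddSubgroup M}
    (hG : ∀ i n, ∀ b, P i b → ∀ m ∈ G n, b • m ∈ G (i + n)) (i n : ℕ) (b : B) (hb : P i b)
    (m : M) (hm : m ∈ shift G n) : b • m ∈ shift G (i + n) := by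
  cases n with
  | zero =>
    rw [show m = 0 from hm, smul_zero]
    exact zero_mem _
  | succ n => exact hG i n b hb m hm

namespace CentralExt

variable {S A : Type*} [Ring S] [Ring A] [Module S A] [IsScalarTower S A A]
  {𝒜 : ℕ → Submodule S A} [GradedRing 𝒜]
  {R : Submodule S (TensorRing S (𝒜 1))} [IsSubbimodule R]
  (hconn : IsConnected 𝒜) (hR : IsRelationBimodule R) (α : FilteredMap R)

theorem grD_smul (i n : ℕ) (b : CentralExt α) (hb : b ∈ deg α i) (m : CentralExt α)
    (hm : m ∈ grD α n) : b • m ∈ grD α (i + n) :=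
  SetLike.mul_mem_graded (A := deg α) hb hm

theorem shift_grD_smul (i n : ℕ) (b : CentralExt α) (hb : b ∈ deg α i) (m : CentralExt α)
    (hm : m ∈ shift (grD α) n) : b • m ∈ shift (grD α) (i + n) :=
  shift_smul_mem (P := fun i b => b ∈ deg α i) (grD_smul α) i n b hb m hm

theorem grDV_smul (i n : ℕ) (b : CentralExt α) (hb : b ∈ deg α i)
    (m : BalTensor S (CentralExt α) (𝒜 1)) (hm : m ∈ grDV α n) : b • m ∈ grDV α (i + n) :=
  BalTensor.smul_mem_deg hb hm

theorem grDR_smul (i n : ℕ) (b : CentralExt α) (hb : b ∈ deg α i)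
    (m : BalTensor S (CentralExt α) R) (hm : m ∈ grDR α n) : b • m ∈ grDR α (i + n) :=
  BalTensor.smul_mem_deg hb hm

theorem grDD_smul (i n : ℕ) (b : CentralExt α) (hb : b ∈ deg α i)
    (m : BalTensor S (CentralExt α) (deg α 1)) (hm : m ∈ grDD α n) : b • m ∈ grDD α (i + n) :=
  BalTensor.smul_mem_deg hb hm

theorem grDRD_smul (i n : ℕ) (b : CentralExt α) (hb : b ∈ deg α i)
    (m : BalTensor S (CentralExt α) (relD α)) (hm : m ∈ grDRD α n) : b • m ∈ grDRD α (i + n) :=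
  BalTensor.smul_mem_deg hb hm

theorem grM₁_smul (i n : ℕ) (b : CentralExt α) (hb : b ∈ deg α i)
    (m : BalTensor S (CentralExt α) (𝒜 1) × CentralExt α) (hm : m ∈ grM₁ R α n) :
    b • m ∈ grM₁ R α (i + n) :=
  ⟨grDV_smul α i n b hb _ hm.1, shift_grD_smul α i n b hb _ hm.2⟩

theorem grM₂_smul (i n : ℕ) (b : CentralExt α) (hb : b ∈ deg α i)
    (m : BalTensor S (CentralExt α) R × BalTensor S (CentralExt α) (𝒜 1))
    (hm : m ∈ grM₂ R α n) : b • m ∈ grM₂ R α (i + n) :=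
  ⟨grDR_smul α i n b hb _ hm.1,
    shift_smul_mem (P := fun i b => b ∈ deg α i) (grDV_smul α) i n b hb _ hm.2⟩

theorem one_mem_deg : (1 : CentralExt α) ∈ deg α 0 := SetLike.one_mem_graded (deg α)

/-- Splitting is compatible with gradings. -/
theorem baseChange_split_mem {B : Type*} [Ring B] [Module S B] [IsScalarTower S B B]
    {V : Submodule S B} [IsSubbimodule V] (φ : TensorRing S V →+* CentralExt α)
    (hφ : ∀ s : S, φ (s • 1) = s • 1)
    (hg : ∀ n, ∀ t ∈ TensorRing.deg S V n, φ t ∈ deg α n) {n : ℕ} {x : TensorRing S V}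
    (hx : x ∈ TensorRing.deg S V n) :
    BalTensor.baseChange φ hφ (split S V x) ∈ BalTensor.deg (deg α) (degOne V) n := by
  cases n with
  | zero =>
    obtain ⟨s, rfl⟩ := TensorRing.mem_deg_zero hx
    rw [split_inS, map_zero]
    exact zero_mem _
  | succ n =>
    have h := split_mem hx
    generalize split S V x = y at h ⊢
    induction h using AddSubgroup.closure_induction with
    | mem y hy =>
      obtain ⟨b, hb, v, rfl⟩ := hy
      rw [BalTensor.baseChange_tmul]
      exact BalTensor.tmul_mem_deg rfl (hg n b hb) (mem_degOne v)
    | zero => rw [map_zero]; exact zero_mem _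
    | add x y _ _ hx hy => rw [map_add]; exact add_mem hx hy
    | neg x _ hx => rw [map_neg]; exact neg_mem hx

/-! ### Existence of the sequence `¹M` -/

theorem toBase_mk (p : (TensorRing S (𝒜 1))[X]) :
    toBase α hR (mk α p) = toRing (𝒜 1) (p.coeff 0) := rfl

theorem toBase_ofT (t : TensorRing S (𝒜 1)) : toBase α hR (ofT α t) = toRing (𝒜 1) t := by
  change toBase α hR (mk α (Polynomial.C t)) = _
  rw [toBase_mk, Polynomial.coeff_C_zero]

theorem toBase_z : toBase α hR (z α) = 0 := by
  change toBase α hR (mk α Polynomial.X) = _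
  rw [toBase_mk, Polynomial.coeff_X_zero, map_zero]

theorem toBase_inclV (v : 𝒜 1) : toBase α hR (inclV α v) = v := by
  rw [← ofT_ι, toBase_ofT, toRing_ι]

theorem toBase_mem {n : ℕ} {d : CentralExt α} (hd : d ∈ deg α n) : toBase α hR d ∈ 𝒜 n := by
  induction hd using Submodule.span_induction with
  | mem x hx =>
    obtain ⟨i, j, rfl, t, ht, rfl⟩ := hx
    rw [Polynomial.C_mul_X_pow_eq_monomial, toBase_mk, Polynomial.coeff_monomial]
    split_ifs with h
    · rw [h]
      exact toRing_mem ht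
    · rw [map_zero]
      exact zero_mem _
  | zero => rw [map_zero]; exact zero_mem _
  | add x y _ _ hx hy => rw [map_add]; exact add_mem hx hy
  | smul s x _ hx =>
    rw [show s • x = (s • 1) * x by rw [smul_mul_assoc, one_mul], map_mul, toBase_smul_one,
      smul_mul_assoc, one_mul]
    exact Submodule.smul_mem _ _ hx

/-- The lift `1 ⊗ v ↦ v` of `d₁`. -/
def stdDel₁ : BalTensor S (CentralExt α) (𝒜 1) →ₗ[CentralExt α] CentralExt α :=
  BalTensor.lift ((deg α 1).subtype.comp (inclV α))

theorem stdDel₁_tmul (d : CentralExt α) (v : 𝒜 1) :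
    stdDel₁ α (BalTensor.tmul S d v) = d * inclV α v := BalTensor.lift_tmul _ _ _

theorem stdDel₁_baseChange (u : BalTensor S (TensorRing S (𝒜 1)) (𝒜 1)) :
    stdDel₁ α (BalTensor.baseChange (ofT α) (ofT_smul_one α) u) = ofT α (mulι S (𝒜 1) u) := by
  induction u using BalTensor.induction_on with
  | h0 => simp
  | ht b v => rw [BalTensor.baseChange_tmul, stdDel₁_tmul, mulι_tmul, map_mul, ofT_ι]
  | ha x y hx hy => simp only [map_add, hx, hy]

/-- The lift `1 ⊗ r ↦ ∑ r_T ⊗ r_V` of `d₂`. -/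
def stdDel₂ : BalTensor S (CentralExt α) R →ₗ[CentralExt α] BalTensor S (CentralExt α) (𝒜 1) :=
  BalTensor.lift
    { toFun := fun r => BalTensor.baseChange (ofT α) (ofT_smul_one α)
        (split S (𝒜 1) (r : TensorRing S (𝒜 1)))
      map_add' := fun x y => by rw [Submodule.coe_add, map_add, map_add]
      map_smul' := fun s x => by
        rw [Submodule.coe_smul, map_smul, BalTensor.baseChange_smul_base, RingHom.id_apply] }

theorem stdDel₂_tmul (d : CentralExt α) (r : R) : stdDel₂ α (BalTensor.tmul S d r) =
    d • BalTensor.baseChange (ofT α) (ofT_smul_one α)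
      (split S (𝒜 1) (r : TensorRing S (𝒜 1))) := BalTensor.lift_tmul _ _ _

/-- The map `1 ⊗ r ↦ ∑_{i ≥ 1} αᵢ(r) z^{i-1}`. -/
def stdF₂ : BalTensor S (CentralExt α) R →ₗ[CentralExt α] CentralExt α :=
  BalTensor.lift
    { toFun := fun r => mk α (α.polyMap hR.homogeneous r).divX
      map_add' := fun x y => by rw [map_add, Polynomial.divX_add, map_add]
      map_smul' := fun s x => by
        rw [map_smul, RingHom.id_apply, ← mk_smul]
        congr 1
        ext n
        rw [Polynomial.coeff_divX, Polynomial.coeff_smul, Polynomial.coeff_smul,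
          Polynomial.coeff_divX] }

theorem stdF₂_tmul (d : CentralExt α) (r : R) : stdF₂ hR α (BalTensor.tmul S d r) =
    d * mk α (α.polyMap hR.homogeneous r).divX := BalTensor.lift_tmul _ _ _

include hconn in
-- Removing the constant term and dividing by `z` lowers the degree by one. Degree zero, where the
-- shifted grading vanishes, is harmless because `R` has nothing there.
theorem stdF₂_mem (j : ℕ) (r : R) (hr : (r : TensorRing S (𝒜 1)) ∈ TensorRing.deg S (𝒜 1) j) :
    mk α (α.polyMap hR.homogeneous r).divX ∈ shift (grD α) j := by
  by_cases h0 : r = 0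
  · rw [h0, map_zero, Polynomial.divX_zero, map_zero]
    exact zero_mem _
  obtain ⟨k, rfl⟩ : ∃ k, j = k + 1 := ⟨j - 1, by have := two_le_of_mem hconn hR hr h0; omega⟩
  change _ ∈ deg α k
  refine α.polyMap_induction hR.homogeneous (p := fun p => mk α p.divX ∈ deg α k) hr
    (fun i j hij t ht => ?_) (fun x y hx hy => ?_)
  · cases i with
    | zero =>
      rw [Polynomial.monomial_zero_left, Polynomial.divX_C, map_zero]
      exact zero_mem _
    | succ i =>
      have : (Polynomial.monomial (i + 1) t).divX = Polynomial.monomial i t := by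
        ext n
        simp [Polynomial.coeff_divX, Polynomial.coeff_monomial]
      rw [this, ← Polynomial.C_mul_X_pow_eq_monomial]
      exact Submodule.subset_span ⟨j, i, by omega, t, ht, rfl⟩
  · rw [Polynomial.divX_add, map_add]
    exact add_mem hx hy

include hconn in
theorem eps_eq_zero {r : TensorRing S (𝒜 1)} (hr : toRing (𝒜 1) r = 0) :
    eps S (𝒜 1) r = 0 := by
  rw [← augmentation_toRing (augmentation_smul_one hconn)
    (fun v hv => augmentation_of_mem hconn one_ne_zero hv), hr, map_zero]

/-- The standard choice of the maps defining `¹M`. -/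
def stdOneM : OneM α hR where
  del₁ := stdDel₁ α
  del₂ := stdDel₂ α
  f₂ := stdF₂ hR α
  graded₁ n x hx := BalTensor.map_deg_mem (grD_smul α) _ (fun j v hv => by
    by_cases hj : j = 1
    · subst hj
      rw [stdDel₁_tmul, one_mul]
      exact (inclV α v).2
    · rw [eq_zero_of_mem_degOne hv hj, BalTensor.tmul_zero, map_zero]
      exact zero_mem _) hx
  graded₂ n x hx := BalTensor.map_deg_mem (grDV_smul α) _ (fun j r hr => by
    rw [stdDel₂_tmul, one_smul]
    exact baseChange_split_mem α _ _ (fun n t ht => ofT_mem α ht) hr) hx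
  graded_f n x hx := BalTensor.map_deg_mem (shift_grD_smul α) _ (fun j r hr => by
    rw [stdF₂_tmul, one_mul]
    exact stdF₂_mem hconn hR α j r hr) hx
  lifts₁ x := by
    induction x using BalTensor.induction_on with
    | h0 => simp
    | ht d v =>
      rw [stdDel₁_tmul, BalTensor.baseChange_tmul, d₁_tmul, map_mul, toBase_inclV]
    | ha x y hx hy => simp only [map_add, hx, hy]
  lifts₂ x := by
    induction x using BalTensor.induction_on with
    | h0 => simp
    | ht d r =>
      rw [stdDel₂_tmul, BalTensor.baseChange_tmul, d₂_tmul, BalTensor.baseChange_smul]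
      congr 1
      generalize split S (𝒜 1) (r : TensorRing S (𝒜 1)) = u
      induction u using BalTensor.induction_on with
      | h0 => simp
      | ht b v => simp only [BalTensor.baseChange_tmul, toBase_ofT]
      | ha x y hx hy => simp only [map_add, hx, hy]
    | ha x y hx hy => simp only [map_add, hx, hy]
  comp x := by
    induction x using BalTensor.induction_on with
    | h0 => simp
    | ht d r =>
      have h1 := mulι_split_add (r : TensorRing S (𝒜 1))
      rw [eps_eq_zero hconn (hR.le r.2), map_zero, add_zero] at h1
      -- In `D` the relation `α_z(r) = 0` reads `r = -z f₂(r)`, while `∂₁ ∂₂` multiplies the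
      -- splitting of `r` back together.
      have h2 : mk α (α.polyMap hR.homogeneous r) = 0 :=
        mk_eq_zero ((α.mem_Pz hR.homogeneous).2 ⟨r, rfl⟩)
      rw [← Polynomial.divX_mul_X_add (α.polyMap hR.homogeneous r), α.polyMap_coeff_zero,
        map_add, map_mul] at h2
      rw [stdDel₂_tmul, map_smul, stdDel₁_baseChange, h1, stdF₂_tmul, z_mul, mul_assoc, smul_eq_mul,
        ← mul_neg]
      congr 1
      exact eq_neg_of_add_eq_zero_right h2
    | ha x y hx hy => simp only [map_add, hx, hy, mul_add, neg_add]

/-! ### The resolution over the central extension -/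

include hconn in
theorem toBase_surjective (hstr : IsStronglyGraded 𝒜) : Function.Surjective (toBase α hR) :=
  fun a => by
    obtain ⟨t, rfl⟩ := toRing_surjective hconn hstr a
    exact ⟨ofT α t, toBase_ofT hR α t⟩

/-- Projectivity over `S` is inherited through `D¹ ≅ A¹ ⊕ S` and `R_D ≅ R ⊕ A¹`; exactness is the
general criterion applied to the generators `D¹` and relations `R_D` of `D`. -/
theorem isResolutionStart (hstr : IsStronglyGraded 𝒜)
    (hA : Module.Projective S (𝒜 1)) (hRproj : Module.Projective S R) :
    IsResolutionStart (d₂ (deg α 1) (relD α)) (d₁ (deg α 1))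
      ((augmentation 𝒜 hconn).comp (toBase α hR)) := by
  have h1 : Module.Projective S (deg α 1) := Module.Projective.of_equiv (degOneEquiv hconn hR α)
  have h2 : Module.Projective S (relD α) := Module.Projective.of_equiv (relEquiv hconn hR α)
  have hε : ∀ s : S, ((augmentation 𝒜 hconn).comp (toBase α hR)) (s • 1) = s := fun s => by
    rw [RingHom.comp_apply, toBase_smul_one, augmentation_smul_one]
  have hεV : ∀ v ∈ deg α 1, ((augmentation 𝒜 hconn).comp (toBase α hR)) v = 0 := fun v hv =>
    augmentation_of_mem hconn one_ne_zero (toBase_mem hR α hv)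
  refine ⟨BalTensor.projective, BalTensor.projective, ?_, ?_, ?_⟩
  · rw [RingHom.coe_comp]
    exact (augmentation_surjective hconn).comp (toBase_surjective hconn hR α hstr)
  · exact exact_d₁_augmentation hε hεV (toRing_degOne_surjective α)
  · exact exact_d₂_d₁ hε hεV (toRing_degOne_surjective α) (relD_mul_inS hR α) (relD_le hR α)
      (fun _ hx => mem_span_relD α hx)

end CentralExt

end PBW

end

noncomputable section

namespace PBW

open TensorRing

namespace CentralExt

variable {S A : Type*} [Ring S] [Ring A] [Module S A] [IsScalarTower S A A]
  {𝒜 : ℕ → Submodule S A} [GradedRing 𝒜]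
  {R : Submodule S (TensorRing S (𝒜 1))} [IsSubbimodule R]
  (hconn : IsConnected 𝒜) (hR : IsRelationBimodule R) (α : FilteredMap R)

/-! ### The projection of `D ⊗ D¹` onto its homogeneous components -/

/-- The projection of `D ⊗ D¹` onto `Dⁿ ⊗ D¹`. -/
def projDD (n : ℕ) :
    BalTensor S (CentralExt α) (deg α 1) →+ BalTensor S (CentralExt α) (deg α 1) :=
  BalTensor.liftAdd
    (AddMonoidHom.mk' (fun d => AddMonoidHom.mk' (fun w => BalTensor.tmul S (proj α n d) w)
        (fun v w => BalTensor.tmul_add _ v w))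
      (fun d d' => by
        ext w
        change BalTensor.tmul S (proj α n (d + d')) w = _
        rw [map_add, BalTensor.add_tmul]
        rfl))
    (fun d s w => by
      change BalTensor.tmul S (proj α n (d * s • 1)) w = BalTensor.tmul S (proj α n d) (s • w)
      rw [proj_mul_smul_one, BalTensor.mul_tmul])

theorem projDD_tmul (n : ℕ) (d : CentralExt α) (w : deg α 1) :
    projDD α n (BalTensor.tmul S d w) = BalTensor.tmul S (proj α n d) w := rfl

theorem projDD_of_mem {n m : ℕ} {x : BalTensor S (CentralExt α) (deg α 1)}
    (hx : x ∈ grDD α m) : projDD α n x = if m = n + 1 then x else 0 := by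
  induction hx using AddSubgroup.closure_induction with
  | mem x hx =>
    obtain ⟨i, j, rfl, d, hd, w, hw, rfl⟩ := hx
    by_cases hj : j = 1
    · subst hj
      rw [projDD_tmul, proj_of_mem α hd]
      by_cases h : i = n
      · rw [if_pos h, if_pos (by omega)]
      · rw [if_neg h, if_neg (by omega), BalTensor.zero_tmul]
    · rw [eq_zero_of_mem_degOne hw hj, BalTensor.tmul_zero, map_zero, ite_self]
  | zero => rw [map_zero, ite_self]
  | add x y _ _ hx hy => rw [map_add, hx, hy]; split_ifs <;> simp
  | neg x _ hx => rw [map_neg, hx]; split_ifs <;> simp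

theorem eq_zero_of_mem_grDD_zero {x : BalTensor S (CentralExt α) (deg α 1)}
    (hx : x ∈ grDD α 0) : x = 0 := by
  induction hx using AddSubgroup.closure_induction with
  | mem x hx =>
    obtain ⟨i, j, hij, d, hd, w, hw, rfl⟩ := hx
    rw [eq_zero_of_mem_degOne hw (by omega), BalTensor.tmul_zero]
  | zero => rfl
  | add x y _ _ hx hy => rw [hx, hy, add_zero]
  | neg x _ hx => rw [hx, neg_zero]

/-! ### The map `D ⊗ R ⊕ D ⊗ V → D ⊗ D¹` -/

/-- The isomorphism `D ⊗ R ⊕ D ⊗ V ≃ D ⊗ R_D`. -/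
def relTensorEquiv : (BalTensor S (CentralExt α) R × BalTensor S (CentralExt α) (𝒜 1))
    ≃ₗ[CentralExt α] BalTensor S (CentralExt α) (relD α) :=
  (BalTensor.prodEquiv S (CentralExt α) R (𝒜 1)).trans (BalTensor.congr (relEquiv hconn hR α))

theorem relTensorEquiv_one_tmul (r : R) (v : 𝒜 1) :
    relTensorEquiv hconn hR α (BalTensor.tmul S 1 r, BalTensor.tmul S 1 v) =
      BalTensor.tmul S 1 (relEquiv hconn hR α (r, v)) := by
  rw [relTensorEquiv, LinearEquiv.trans_apply, BalTensor.prodEquiv_apply, BalTensor.lTensor_tmul, BalTensor.lTensor_tmul,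
    ← BalTensor.tmul_add, BalTensor.congr_tmul]
  simp

theorem relTensorEquiv_one_tmul_left (r : R) :
    relTensorEquiv hconn hR α (BalTensor.tmul S 1 r, 0) =
      BalTensor.tmul S 1 (relEquiv hconn hR α (r, 0)) := by
  rw [← relTensorEquiv_one_tmul, BalTensor.tmul_zero]

theorem relTensorEquiv_one_tmul_right (v : 𝒜 1) :
    relTensorEquiv hconn hR α (0, BalTensor.tmul S 1 v) =
      BalTensor.tmul S 1 (relEquiv hconn hR α (0, v)) := by
  rw [← relTensorEquiv_one_tmul, BalTensor.tmul_zero]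

theorem relTensorEquiv_mem {n : ℕ}
    {x : BalTensor S (CentralExt α) R × BalTensor S (CentralExt α) (𝒜 1)}
    (hx : x ∈ grM₂ R α n) : relTensorEquiv hconn hR α x ∈ grDRD α n := by
  obtain ⟨x, y⟩ := x
  obtain ⟨hx, hy⟩ := hx
  rw [show (x, y) = LinearMap.inl (CentralExt α) _ _ x + LinearMap.inr (CentralExt α) _ _ y by
    simp, map_add]
  refine add_mem ?_ ?_
  · refine BalTensor.map_deg_mem (grDRD_smul α)
      ((relTensorEquiv hconn hR α).toLinearMap.comp (LinearMap.inl (CentralExt α) _ _))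
      (fun j r hr => ?_) hx
    change relTensorEquiv hconn hR α (BalTensor.tmul S 1 r, 0) ∈ _
    rw [relTensorEquiv_one_tmul_left]
    refine BalTensor.tmul_mem_deg (zero_add j) (one_mem_deg α) ?_
    rw [Submodule.mem_comap, Submodule.subtype_apply, coe_relEquiv, map_zero, add_zero]
    exact lamRel_mem hR α hr
  · cases n with
    | zero =>
      rw [show y = 0 from hy, map_zero, map_zero]
      exact zero_mem _
    | succ n =>
      -- The summand `D ⊗ V` enters `M₂` shifted by one, which matches `v` of degree one against
      -- `[z, v]` of degree two.
      refine BalTensor.map_deg_mem (G := fun n => grDRD α (n + 1))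
        (fun i n b hb m hm => grDRD_smul α i (n + 1) b hb m hm)
        ((relTensorEquiv hconn hR α).toLinearMap.comp (LinearMap.inr (CentralExt α) _ _))
        (fun j v hv => ?_) hy
      change relTensorEquiv hconn hR α (0, BalTensor.tmul S 1 v) ∈ _
      rw [relTensorEquiv_one_tmul_right]
      by_cases hj : j = 1
      · subst hj
        refine BalTensor.tmul_mem_deg (zero_add 2) (one_mem_deg α) ?_
        rw [Submodule.mem_comap, Submodule.subtype_apply, coe_relEquiv, map_zero, zero_add]
        exact commHom_mem α v
      · rw [eq_zero_of_mem_degOne hv hj, ← Prod.zero_eq_mk, map_zero, BalTensor.tmul_zero]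
        exact zero_mem _

theorem relTensorEquiv_symm_mem {n : ℕ} {x : BalTensor S (CentralExt α) (relD α)}
    (hx : x ∈ grDRD α n) : (relTensorEquiv hconn hR α).symm x ∈ grM₂ R α n := by
  refine BalTensor.map_deg_mem (grM₂_smul α) (relTensorEquiv hconn hR α).symm.toLinearMap
    (fun j x hx => ?_) hx
  obtain ⟨⟨r, v⟩, rfl⟩ := (relEquiv hconn hR α).surjective x
  rw [Submodule.mem_comap, Submodule.subtype_apply, coe_relEquiv] at hx
  rw [LinearEquiv.coe_coe, ← relTensorEquiv_one_tmul, LinearEquiv.symm_apply_apply]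
  -- Setting `z = 0` shows that `r` is homogeneous of degree `j`. Then `[z, v]` has degree `j` as
  -- well as degree two, so `v = 0` unless `j = 2`.
  have hr : (r : TensorRing S (𝒜 1)) ∈ TensorRing.deg S (𝒜 1) j := by
    have := killZ_mem hconn hR α hx
    rwa [map_add, killZ_lamRel, killZ_commHom, add_zero] at this
  refine ⟨BalTensor.tmul_mem_deg (zero_add j) (one_mem_deg α) hr, ?_⟩
  have hv : commHom α v ∈ TensorRing.deg S (deg α 1) j := by
    have := sub_mem hx (lamRel_mem hR α hr)
    rwa [add_sub_cancel_left] at this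
  by_cases hj : j = 2
  · subst hj
    exact BalTensor.tmul_mem_deg (zero_add 1) (one_mem_deg α) (mem_degOne v)
  · have h0 : commHom α v = 0 := by
      rw [← DirectSum.decompose_of_mem_same _ hv]
      exact DirectSum.decompose_of_mem_ne _ (commHom_mem α v) (Ne.symm hj)
    rw [← map_zero (commHom α)] at h0
    rw [commHom_injective hconn hR α h0, BalTensor.tmul_zero]
    exact zero_mem _

/-- The map `d₂'` on `D ⊗ R ⊕ D ⊗ V`. -/
def relDiff : (BalTensor S (CentralExt α) R × BalTensor S (CentralExt α) (𝒜 1))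
    →ₗ[CentralExt α] BalTensor S (CentralExt α) (deg α 1) :=
  (d₂ (deg α 1) (relD α)).comp (relTensorEquiv hconn hR α).toLinearMap

theorem relDiff_apply (x : BalTensor S (CentralExt α) R × BalTensor S (CentralExt α) (𝒜 1)) :
    relDiff hconn hR α x = d₂ (deg α 1) (relD α) (relTensorEquiv hconn hR α x) := rfl

theorem relDiff_right (v : 𝒜 1) : relDiff hconn hR α (0, BalTensor.tmul S 1 v) =
    BalTensor.tmul S (z α) (inclV α v) - BalTensor.tmul S (inclV α v : CentralExt α) (zOne α) := by
  rw [relDiff_apply, relTensorEquiv_one_tmul_right, d₂_tmul, one_smul, coe_relEquiv, map_zero,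
    zero_add, commHom_apply, map_sub, split_mul_ι, split_mul_ι, map_sub,
    BalTensor.baseChange_tmul, BalTensor.baseChange_tmul, toRing_zOne, toRing_ι]

theorem d₂_relD_mem {n : ℕ} {x : BalTensor S (CentralExt α) (relD α)} (hx : x ∈ grDRD α n) :
    d₂ (deg α 1) (relD α) x ∈ grDD α n := by
  refine BalTensor.map_deg_mem (grDD_smul α) _ (fun j x hx => ?_) hx
  rw [d₂_tmul, one_smul]
  refine baseChange_split_mem α _ _ (fun n t ht => ?_) hx
  refine TensorRing.map_deg_mem (deg α) _ (fun s => ?_) (fun v => ?_) n ht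
  · rw [toRing_inS]
    exact (deg α 0).smul_mem s (one_mem_deg α)
  · rw [toRing_ι]
    exact v.2

theorem relDiff_mem {n : ℕ}
    {x : BalTensor S (CentralExt α) R × BalTensor S (CentralExt α) (𝒜 1)}
    (hx : x ∈ grM₂ R α n) : relDiff hconn hR α x ∈ grDD α n :=
  d₂_relD_mem α (relTensorEquiv_mem hconn hR α hx)

include hR in
-- `M₂` is the sum of its homogeneous parts; directness of the sum is not needed.
theorem grM₂_induction
    {p : BalTensor S (CentralExt α) R × BalTensor S (CentralExt α) (𝒜 1) → Prop}
    (hom : ∀ n, ∀ x ∈ grM₂ R α n, p x) (add : ∀ x y, p x → p y → p (x + y)) (x) : p x := by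
  have h1 : ∀ d (r : R), p (BalTensor.tmul S d r, 0) := fun d r => by
    refine deg_induction α (p := fun d => p (BalTensor.tmul S d r, 0)) (fun n d hd => ?_)
      (fun x y hx hy => ?_) d
    · refine FilteredMap.homogeneous_induction hR.homogeneous
        (p := fun r => p (BalTensor.tmul S d r, 0)) (fun m r hr => ?_) (fun x y hx hy => ?_) r
      · exact hom (n + m) _ ⟨BalTensor.tmul_mem_deg rfl hd hr, zero_mem _⟩
      · have := add _ _ hx hy
        rwa [Prod.mk_add_mk, add_zero, ← BalTensor.tmul_add] at this
    · have := add _ _ hx hy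
      rwa [Prod.mk_add_mk, add_zero, ← BalTensor.add_tmul] at this
  have h2 : ∀ d (v : 𝒜 1), p (0, BalTensor.tmul S d v) := fun d v => by
    refine deg_induction α (p := fun d => p (0, BalTensor.tmul S d v)) (fun n d hd => ?_)
      (fun x y hx hy => ?_) d
    -- One unit of degree comes from `v` and one from the shift.
    · exact hom (n + 2) _ ⟨zero_mem _, BalTensor.tmul_mem_deg (n := n + 1) rfl hd (mem_degOne v)⟩
    · have := add _ _ hx hy
      rwa [Prod.mk_add_mk, add_zero, ← BalTensor.add_tmul] at this
  have h0 : p 0 := hom 0 0 (zero_mem _)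
  obtain ⟨x, y⟩ := x
  have h3 : p (x, 0) := by
    induction x using BalTensor.induction_on with
    | h0 => exact h0
    | ht b v => exact h1 b v
    | ha x y hx hy => simpa using add _ _ hx hy
  have h4 : p (0, y) := by
    induction y using BalTensor.induction_on with
    | h0 => exact h0
    | ht b v => exact h2 b v
    | ha x y hx hy => simpa using add _ _ hx hy
  simpa using add _ _ h3 h4

/-- Homogeneous elements in the image of `relDiff` are images of homogeneous elements. -/
theorem exists_homogeneous {n : ℕ}
    (x : BalTensor S (CentralExt α) R × BalTensor S (CentralExt α) (𝒜 1))
    (hx : relDiff hconn hR α x ∈ grDD α n) :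
    ∃ y ∈ grM₂ R α n, relDiff hconn hR α y = relDiff hconn hR α x := by
  cases n with
  | zero => exact ⟨0, zero_mem _, by rw [eq_zero_of_mem_grDD_zero α hx, map_zero]⟩
  | succ n =>
    -- Only the target needs a projection: `projDD n` selects total degree `n + 1`, and additivity
    -- in `x` reduces to homogeneous `x`, where either `x` itself or zero serves.
    have h : ∃ y ∈ grM₂ R α (n + 1),
        relDiff hconn hR α y = projDD α n (relDiff hconn hR α x) := by
      clear hx
      refine grM₂_induction hR α (p := fun x => ∃ y ∈ grM₂ R α (n + 1),
        relDiff hconn hR α y = projDD α n (relDiff hconn hR α x)) (fun m x hx => ?_) ?_ x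
      · rw [projDD_of_mem α (relDiff_mem hconn hR α hx)]
        split_ifs with h
        · exact ⟨x, h ▸ hx, rfl⟩
        · exact ⟨0, zero_mem _, map_zero _⟩
      · rintro x x' ⟨y, hy, h⟩ ⟨y', hy', h'⟩
        exact ⟨y + y', add_mem hy hy', by simp only [map_add, h, h']⟩
    rwa [projDD_of_mem α hx, if_pos rfl] at h

/-! ### Reduction modulo `z` -/

/-- The projection `D¹ → V`. -/
def degOneFst : deg α 1 →ₗ[S] 𝒜 1 :=
  (LinearMap.fst S (𝒜 1) S).comp (degOneEquiv hconn hR α).symm.toLinearMap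

theorem degOneFst_apply (w : deg α 1) :
    degOneFst hconn hR α w = ((degOneEquiv hconn hR α).symm w).1 := rfl

/-- The map `D ⊗ D¹ → A ⊗ V` given by `z ↦ 0`. -/
def reduce : BalTensor S (CentralExt α) (deg α 1) →+ BalTensor S A (𝒜 1) :=
  (BalTensor.baseChange (toBase α hR) (toBase_smul_one α hR)).comp
    (BalTensor.lTensor (degOneFst hconn hR α)).toAddMonoidHom

theorem reduce_tmul (d : CentralExt α) (w : deg α 1) :
    reduce hconn hR α (BalTensor.tmul S d w) =
      BalTensor.tmul S (toBase α hR d) ((degOneEquiv hconn hR α).symm w).1 := by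
  rw [reduce, AddMonoidHom.comp_apply, LinearMap.toAddMonoidHom_coe, BalTensor.lTensor_tmul,
    BalTensor.baseChange_tmul, degOneFst_apply]

theorem reduce_smul (d : CentralExt α) (x : BalTensor S (CentralExt α) (deg α 1)) :
    reduce hconn hR α (d • x) = toBase α hR d • reduce hconn hR α x := by
  rw [reduce, AddMonoidHom.comp_apply, AddMonoidHom.comp_apply, LinearMap.toAddMonoidHom_coe,
    map_smul, BalTensor.baseChange_smul]

theorem toBase_toRing (x : TensorRing S (deg α 1)) :
    toBase α hR (toRing (deg α 1) x) = toRing (𝒜 1) (killZ hconn hR α x) := by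
  have h : (toBase α hR).comp (toRing (deg α 1)) = (toRing (𝒜 1)).comp (killZ hconn hR α) := by
    refine TensorRing.hom_ext (fun s => ?_) (fun w => ?_)
    · rw [RingHom.comp_apply, RingHom.comp_apply, toRing_inS, killZ_inS, toRing_inS,
        toBase_smul_one]
    · obtain ⟨⟨v, s⟩, rfl⟩ := (degOneEquiv hconn hR α).surjective w
      rw [RingHom.comp_apply, RingHom.comp_apply, toRing_ι, killZ_ι, toRing_ι,
        LinearEquiv.symm_apply_apply, degOneEquiv_apply, Submodule.coe_add, map_add, toBase_inclV,
        Submodule.coe_smul, ← one_mul (zOne α : CentralExt α), ← smul_mul_assoc, map_mul]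
      change _ + _ * toBase α hR (z α) = _
      rw [toBase_z, mul_zero, add_zero]
  exact DFunLike.congr_fun h x

theorem killZ_smul_one (s : S) : killZ hconn hR α (s • 1) = s • 1 := by
  rw [TensorRing.smul_one_eq, killZ_inS, TensorRing.smul_one_eq]

/-- Splitting commutes with the morphism of tensor rings `z ↦ 0`. The map `κ` is the induced map on
`T ⊗ V`; it is compatible with multiplication, of which splitting is the inverse. -/
theorem reduce_split (x : TensorRing S (deg α 1)) :
    reduce hconn hR α (BalTensor.baseChange (toRing (deg α 1)) (toRing_smul_one (deg α 1))
      (split S (deg α 1) x)) = BalTensor.baseChange (toRing (𝒜 1)) (toRing_smul_one (𝒜 1))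
      (split S (𝒜 1) (killZ hconn hR α x)) := by
  let κ : BalTensor S (TensorRing S (deg α 1)) (deg α 1) →+
      BalTensor S (TensorRing S (𝒜 1)) (𝒜 1) :=
    (BalTensor.baseChange (killZ hconn hR α) (killZ_smul_one hconn hR α)).comp
      (BalTensor.lTensor (degOneFst hconn hR α)).toAddMonoidHom
  have hκ : ∀ t w, κ (BalTensor.tmul S t w) = BalTensor.tmul S (killZ hconn hR α t)
      ((degOneEquiv hconn hR α).symm w).1 := fun t w => by
    rw [AddMonoidHom.comp_apply, LinearMap.toAddMonoidHom_coe, BalTensor.lTensor_tmul,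
      BalTensor.baseChange_tmul, degOneFst_apply]
  have h1 : ∀ u, killZ hconn hR α (mulι S _ u) = mulι S _ (κ u) := fun u => by
    induction u using BalTensor.induction_on with
    | h0 => simp
    | ht t w => rw [mulι_tmul, map_mul, hκ, mulι_tmul, killZ_ι]
    | ha x y hx hy => simp only [map_add, hx, hy]
  have h2 : split S (𝒜 1) (killZ hconn hR α x) = κ (split S (deg α 1) x) := by
    conv_lhs => rw [← mulι_split_add x]
    rw [map_add, h1, killZ_inS, map_add, split_mulι, split_inS, add_zero]
  rw [h2]
  generalize split S (deg α 1) x = u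
  induction u using BalTensor.induction_on with
  | h0 => simp
  | ht t w =>
    rw [hκ, BalTensor.baseChange_tmul, BalTensor.baseChange_tmul, reduce_tmul,
      toBase_toRing hconn]
  | ha x y hx hy => simp only [map_add, hx, hy]

/-- Modulo `z` the relation `λ(α_z(r))` becomes `r`, and both terms `z ⊗ v` and `v ⊗ z` vanish. -/
theorem reduce_relDiff (x : BalTensor S (CentralExt α) R)
    (y : BalTensor S (CentralExt α) (𝒜 1)) :
    reduce hconn hR α (relDiff hconn hR α (x, y)) =
      d₂ (𝒜 1) R (BalTensor.baseChange (toBase α hR) (toBase_smul_one α hR) x) := by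
  have h1 : reduce hconn hR α (relDiff hconn hR α (x, 0)) =
      d₂ (𝒜 1) R (BalTensor.baseChange (toBase α hR) (toBase_smul_one α hR) x) := by
    induction x using BalTensor.induction_on with
    | h0 => rw [← Prod.zero_eq_mk]; simp
    | ht d r =>
      rw [show (BalTensor.tmul S d r, (0 : BalTensor S (CentralExt α) (𝒜 1))) =
        d • (BalTensor.tmul S 1 r, 0) by rw [Prod.smul_mk, smul_zero, BalTensor.smul_tmul',
          mul_one], map_smul, reduce_smul, relDiff_apply, relTensorEquiv_one_tmul_left, d₂_tmul,
        one_smul, reduce_split, coe_relEquiv, map_add (killZ hconn hR α), killZ_lamRel,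
        killZ_commHom, add_zero, BalTensor.baseChange_tmul, d₂_tmul]
    | ha x y hx hy =>
      rw [show (x + y, (0 : BalTensor S (CentralExt α) (𝒜 1))) = (x, 0) + (y, 0) by simp]
      simp only [map_add, hx, hy]
  have h2 : reduce hconn hR α (relDiff hconn hR α (0, y)) = 0 := by
    induction y using BalTensor.induction_on with
    | h0 => rw [← Prod.zero_eq_mk]; simp
    | ht d v =>
      rw [show ((0 : BalTensor S (CentralExt α) R), BalTensor.tmul S d v) =
        d • (0, BalTensor.tmul S 1 v) by rw [Prod.smul_mk, smul_zero, BalTensor.smul_tmul',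
          mul_one], map_smul, reduce_smul, relDiff_right, map_sub, reduce_tmul, reduce_tmul,
        toBase_z, BalTensor.zero_tmul, degOneEquiv_symm_zOne, BalTensor.tmul_zero, sub_zero,
        smul_zero]
    | ha x y hx hy =>
      rw [show ((0 : BalTensor S (CentralExt α) R), x + y) = (0, x) + (0, y) by simp]
      simp only [map_add, hx, hy, add_zero]
  rw [show (x, y) = (x, 0) + (0, y) by simp, map_add, map_add, h1, h2, add_zero]

end CentralExt

end PBW

end

noncomputable section

namespace PBW

open TensorRing

/-! ### Invertibility of `1 + N` for a map `N` that lowers a filtration. -/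

/-- If `N` lowers an increasing filtration starting at zero, then `x ↦ x + N x` is injective on
the union of the filtration. -/
theorem eq_zero_of_add_eq_zero_of_lowering {X : Type*} [AddCommGroup X] (N : X →+ X)
    (F : ℕ → AddSubgroup X) (h0 : F 0 = ⊥) (hN : ∀ m, ∀ x ∈ F (m + 1), N x ∈ F m)
    {m : ℕ} {x : X} (hx : x ∈ F m) (h : x + N x = 0) : x = 0 := by
  induction m with
  | zero => rw [h0] at hx; exact hx
  | succ m ih =>
    refine ih ?_
    rw [eq_neg_of_add_eq_zero_left h]
    exact neg_mem (hN m x hx)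

/-- If `N` lowers an increasing filtration starting at zero, then `x ↦ x + N x` is surjective on
each term of the filtration. -/
theorem exists_add_eq_of_lowering {X : Type*} [AddCommGroup X] (N : X →+ X)
    (F : ℕ → AddSubgroup X) (h0 : F 0 = ⊥) (hF : Monotone F)
    (hN : ∀ m, ∀ x ∈ F (m + 1), N x ∈ F m) {m : ℕ} {y : X} (hy : y ∈ F m) :
    ∃ x ∈ F m, x + N x = y := by
  induction m generalizing y with
  | zero =>
    rw [h0] at hy
    exact ⟨0, zero_mem _, by rw [show y = 0 from hy]; simp⟩
  | succ m ih =>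
    obtain ⟨x, hx, h⟩ := ih (hN m y hy)
    refine ⟨y - x, sub_mem hy (hF m.le_succ hx), ?_⟩
    rw [map_sub, ← h]
    abel

namespace CentralExt

variable {S A : Type*} [Ring S] [Ring A] [Module S A] [IsScalarTower S A A]
  {𝒜 : ℕ → Submodule S A} [GradedRing 𝒜]
  {R : Submodule S (TensorRing S (𝒜 1))} [IsSubbimodule R]
  (hconn : IsConnected 𝒜) {hR : IsRelationBimodule R} {α : FilteredMap R} (M : OneM α hR)

/-! ### The isomorphism in degree one -/

/-- The map `V → D¹` given by `∂₁`. -/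
def del₁V : 𝒜 1 →ₗ[S] deg α 1 :=
  ((M.del₁.restrictScalars S).comp (BalTensor.oneTmul S (CentralExt α) (𝒜 1))).codRestrict
    (deg α 1) fun v => M.graded₁ 1 _
      (BalTensor.tmul_mem_deg (zero_add 1) (one_mem_deg α) (mem_degOne v))

theorem coe_del₁V (v : 𝒜 1) : (del₁V M v : CentralExt α) = M.del₁ (BalTensor.tmul S 1 v) := rfl

theorem toBase_degOne (w : deg α 1) :
    toBase α hR w = ((degOneEquiv hconn hR α).symm w).1 := by
  have h := toBase_toRing hconn hR α (ι S _ w)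
  rwa [toRing_ι, killZ_ι, toRing_ι] at h

theorem degOneEquiv_symm_del₁V (v : 𝒜 1) :
    ((degOneEquiv hconn hR α).symm (del₁V M v)).1 = v := by
  refine Subtype.ext ?_
  rw [← toBase_degOne, coe_del₁V, M.lifts₁, BalTensor.baseChange_tmul, d₁_tmul, map_one, one_mul]

/-- Being a graded lift of `d₁`, an arbitrary `∂₁` can only differ from the inclusion of `V` by
multiples of `z`. -/
theorem del₁V_eq (v : 𝒜 1) : del₁V M v = inclV α v +
    ((degOneEquiv hconn hR α).symm (del₁V M v)).2 • zOne α := by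
  rw [← degOneEquiv_apply hconn hR α v, ← LinearEquiv.symm_apply_eq]
  exact Prod.ext (degOneEquiv_symm_del₁V hconn M v) rfl

/-- The isomorphism `V ⊕ S ≃ D¹`, `(v, s) ↦ ∂₁ v + s z`. -/
def degOneEquiv' : (𝒜 1 × S) ≃ₗ[S] deg α 1 :=
  LinearEquiv.ofBijective ((del₁V M).coprod (LinearMap.toSpanSingleton S _ (zOne α))) (by
    constructor
    · rw [← LinearMap.ker_eq_bot, LinearMap.ker_eq_bot']
      rintro ⟨v, s⟩ h
      replace h : del₁V M v + s • zOne α = 0 := h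
      have h1 := congrArg (fun w => ((degOneEquiv hconn hR α).symm w).1) h
      simp only [map_add, map_smul, degOneEquiv_symm_zOne, map_zero, Prod.fst_add, Prod.smul_fst,
        degOneEquiv_symm_del₁V, smul_zero, add_zero, Prod.fst_zero] at h1
      rw [h1, map_zero, zero_add] at h
      have h2 := congrArg (fun w => ((degOneEquiv hconn hR α).symm w).2) h
      simp only [map_smul, degOneEquiv_symm_zOne, map_zero, Prod.smul_snd, smul_eq_mul, mul_one,
        Prod.snd_zero] at h2
      rw [h1, h2]
      rfl
    · intro w
      obtain ⟨⟨v, s⟩, rfl⟩ := (degOneEquiv hconn hR α).surjective w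
      -- The new coordinates differ from the old ones by a unipotent triangular change; the
      -- coefficient of `z` in `∂₁ v` is subtracted.
      refine ⟨(v, s - ((degOneEquiv hconn hR α).symm (del₁V M v)).2), ?_⟩
      change del₁V M v + (s - ((degOneEquiv hconn hR α).symm (del₁V M v)).2) • zOne α = _
      rw [degOneEquiv_apply]
      nth_rewrite 1 [del₁V_eq hconn M v]
      generalize ((degOneEquiv hconn hR α).symm (del₁V M v)).2 = t
      rw [add_assoc, ← add_smul, add_sub_cancel])

theorem degOneEquiv'_apply (v : 𝒜 1) (s : S) :
    degOneEquiv' hconn M (v, s) = del₁V M v + s • zOne α := rfl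

/-- The isomorphism `ϑ₁ : M₁ ≃ D ⊗ D¹`. -/
def theta₁ : (BalTensor S (CentralExt α) (𝒜 1) × CentralExt α) ≃ₗ[CentralExt α]
    BalTensor S (CentralExt α) (deg α 1) :=
  ((LinearEquiv.prodCongr (LinearEquiv.refl _ _) (BalTensor.rid S (CentralExt α))).trans
    (BalTensor.prodEquiv S (CentralExt α) (𝒜 1) S)).trans
    (BalTensor.congr (degOneEquiv' hconn M))

theorem theta₁_apply (x : BalTensor S (CentralExt α) (𝒜 1)) (y : CentralExt α) :
    theta₁ hconn M (x, y) = BalTensor.lTensor (del₁V M) x + BalTensor.tmul S y (zOne α) := by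
  have h : theta₁ hconn M (x, y) = BalTensor.congr (degOneEquiv' hconn M)
      (BalTensor.prodEquiv S (CentralExt α) (𝒜 1) S (x, BalTensor.rid S (CentralExt α) y)) := rfl
  rw [h, BalTensor.prodEquiv_apply, BalTensor.rid_apply, map_add, map_smul, map_smul,
    BalTensor.lTensor_tmul, BalTensor.congr_tmul, LinearMap.inr_apply, degOneEquiv'_apply,
    map_zero, zero_add, one_smul, ← BalTensor.tmul_eq_smul]
  congr 1
  clear h
  induction x using BalTensor.induction_on with
  | h0 => simp
  | ht d v =>
    rw [BalTensor.lTensor_tmul, BalTensor.lTensor_tmul, BalTensor.congr_tmul, LinearMap.inl_apply,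
      degOneEquiv'_apply, zero_smul, add_zero]
  | ha x y hx hy => simp only [map_add, hx, hy]

theorem d₁_theta₁ (x : BalTensor S (CentralExt α) (𝒜 1) × CentralExt α) :
    d₁ (deg α 1) (theta₁ hconn M x) = M.delta₁ x := by
  obtain ⟨x, y⟩ := x
  have h : M.delta₁ (x, y) = M.del₁ x + z α * y := rfl
  rw [theta₁_apply, map_add, d₁_tmul, h, z_mul]
  congr 1
  clear h
  induction x using BalTensor.induction_on with
  | h0 => simp
  | ht d v =>
    rw [BalTensor.lTensor_tmul, d₁_tmul, coe_del₁V, ← smul_eq_mul, ← map_smul,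
      ← BalTensor.tmul_eq_smul]
  | ha x y hx hy => simp only [map_add, hx, hy]

theorem theta₁_mem {n : ℕ} {x : BalTensor S (CentralExt α) (𝒜 1) × CentralExt α}
    (hx : x ∈ grM₁ R α n) : theta₁ hconn M x ∈ grDD α n := by
  obtain ⟨x, y⟩ := x
  obtain ⟨hx, hy⟩ := hx
  rw [theta₁_apply]
  refine add_mem ?_ ?_
  · refine BalTensor.map_deg_mem (grDD_smul α) _ (fun j v hv => ?_) hx
    rw [BalTensor.lTensor_tmul]
    by_cases hj : j = 1
    · subst hj
      exact BalTensor.tmul_mem_deg (zero_add 1) (one_mem_deg α) (mem_degOne _)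
    · rw [eq_zero_of_mem_degOne hv hj, map_zero, BalTensor.tmul_zero]
      exact zero_mem _
  · cases n with
    | zero =>
      rw [show y = 0 from hy, BalTensor.zero_tmul]
      exact zero_mem _
    | succ n => exact BalTensor.tmul_mem_deg rfl hy (mem_degOne _)

theorem theta₁_symm_mem {n : ℕ} {x : BalTensor S (CentralExt α) (deg α 1)}
    (hx : x ∈ grDD α n) : (theta₁ hconn M).symm x ∈ grM₁ R α n := by
  refine BalTensor.map_deg_mem (grM₁_smul α) (theta₁ hconn M).symm.toLinearMap
    (fun j w hw => ?_) hx
  rw [LinearEquiv.coe_coe]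
  by_cases hj : j = 1
  · subst hj
    obtain ⟨⟨v, s⟩, rfl⟩ := (degOneEquiv' hconn M).surjective w
    have h : theta₁ hconn M (BalTensor.tmul S 1 v, s • 1) =
        BalTensor.tmul S 1 (degOneEquiv' hconn M (v, s)) := by
      rw [theta₁_apply, BalTensor.lTensor_tmul, degOneEquiv'_apply, BalTensor.tmul_add,
        BalTensor.one_tmul_smul, BalTensor.smul_tmul_eq]
    rw [← h, LinearEquiv.symm_apply_apply]
    exact ⟨BalTensor.tmul_mem_deg (zero_add 1) (one_mem_deg α) (mem_degOne _),
      (deg α 0).smul_mem s (one_mem_deg α)⟩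
  · rw [eq_zero_of_mem_degOne hw hj, BalTensor.tmul_zero, map_zero]
    exact zero_mem _

theorem reduce_theta₁ (x : BalTensor S (CentralExt α) (𝒜 1)) (y : CentralExt α) :
    reduce hconn hR α (theta₁ hconn M (x, y)) =
      BalTensor.baseChange (toBase α hR) (toBase_smul_one α hR) x := by
  rw [theta₁_apply, map_add, reduce_tmul, degOneEquiv_symm_zOne, BalTensor.tmul_zero, add_zero]
  induction x using BalTensor.induction_on with
  | h0 => simp
  | ht d v =>
    rw [BalTensor.lTensor_tmul, reduce_tmul, degOneEquiv_symm_del₁V, BalTensor.baseChange_tmul]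
  | ha x y hx hy => simp only [map_add, hx, hy]

/-! ### The isomorphism in degree two -/

theorem delta₂_apply (x : BalTensor S (CentralExt α) R)
    (y : BalTensor S (CentralExt α) (𝒜 1)) :
    M.delta₂ (x, y) = (M.del₂ x - z α • y, M.f₂ x + M.del₁ y) := by
  rw [sub_eq_add_neg]
  rfl

theorem delta₁_delta₂ (x : BalTensor S (CentralExt α) R × BalTensor S (CentralExt α) (𝒜 1)) :
    M.delta₁ (M.delta₂ x) = 0 := by
  obtain ⟨x, y⟩ := x
  have h : ∀ a b, M.delta₁ (a, b) = M.del₁ a + z α * b := fun _ _ => rfl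
  rw [delta₂_apply, h, map_sub, map_smul, M.comp, smul_eq_mul, mul_add]
  abel

theorem delta₂_mem {n : ℕ}
    {x : BalTensor S (CentralExt α) R × BalTensor S (CentralExt α) (𝒜 1)}
    (hx : x ∈ grM₂ R α n) : M.delta₂ x ∈ grM₁ R α n := by
  obtain ⟨x, y⟩ := x
  obtain ⟨hx, hy⟩ := hx
  rw [delta₂_apply]
  refine ⟨(grDV α n).sub_mem (M.graded₂ n x hx) ?_,
    (shift (grD α) n).add_mem (M.graded_f n x hx) ?_⟩
  · cases n with
    | zero =>
      rw [show y = 0 from hy, smul_zero]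
      exact zero_mem _
    | succ n =>
      have := grDV_smul α 1 n (z α) (zOne α).2 y hy
      rwa [add_comm] at this
  · cases n with
    | zero =>
      rw [show y = 0 from hy, map_zero]
      exact zero_mem _
    | succ n => exact M.graded₁ n y hy

/-- With `∂₁ v = v + c z`, the terms `z ⊗ c z` and `c z ⊗ z` coincide since `z` is central in `D`,
so they cancel; what remains is `-(z ⊗ v - v ⊗ z)`. -/
theorem theta₁_delta₂_right (v : 𝒜 1) : theta₁ hconn M (M.delta₂ (0, BalTensor.tmul S 1 v)) =
    -relDiff hconn hR α (0, BalTensor.tmul S 1 v) := by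
  rw [delta₂_apply, map_zero, zero_sub, map_zero, zero_add, ← coe_del₁V, theta₁_apply, map_neg,
    map_smul, BalTensor.lTensor_tmul, BalTensor.smul_tmul', mul_one, relDiff_right,
    del₁V_eq hconn M v, BalTensor.tmul_add, ← BalTensor.mul_tmul, Submodule.coe_add,
    BalTensor.add_tmul, z_smul_one, Submodule.coe_smul]
  change -(_ + BalTensor.tmul S (_ • z α) _) + (_ + BalTensor.tmul S (_ • z α) _) = _
  abel

/-! ### Correcting the difference between `ϑ₁ δ₂` and `d₂'` on `R`. -/

/-- The part of `(D ⊗ R)_n` generated by `Dⁱ ⊗ R` with `i > 0`. -/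
def grDRPos (R : Submodule S (TensorRing S (𝒜 1))) [IsSubbimodule R] (α : FilteredMap R) (n : ℕ) :
    AddSubgroup (BalTensor S (CentralExt α) R) :=
  AddSubgroup.closure {x | ∃ i j, i + j = n ∧ 0 < i ∧ ∃ d ∈ deg α i, ∃ r : R,
    (r : TensorRing S (𝒜 1)) ∈ TensorRing.deg S (𝒜 1) j ∧ x = BalTensor.tmul S d r}

theorem grDRPos_le (n : ℕ) : grDRPos R α n ≤ grDR α n :=
  AddSubgroup.closure_mono (by
    rintro _ ⟨i, j, h, _, d, hd, r, hr, rfl⟩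
    exact ⟨i, j, h, d, hd, r, hr, rfl⟩)

theorem grDRPos_smul {n : ℕ} (s : S) {x : BalTensor S (CentralExt α) R}
    (hx : x ∈ grDRPos R α n) : s • x ∈ grDRPos R α n := by
  induction hx using AddSubgroup.closure_induction with
  | mem x hx =>
    obtain ⟨i, j, h, hi, d, hd, r, hr, rfl⟩ := hx
    rw [BalTensor.smul_tmul_eq]
    exact AddSubgroup.subset_closure ⟨i, j, h, hi, s • d, (deg α i).smul_mem s hd, r, hr, rfl⟩
  | zero => rw [smul_zero]; exact zero_mem _
  | add x y _ _ hx hy => rw [smul_add]; exact add_mem hx hy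
  | neg x _ hx => rw [smul_neg]; exact neg_mem hx

/-- Elements of `D⁰` are scalars, which can be moved across the tensor sign into `R`. -/
theorem exists_grDRPos {n : ℕ} {x : BalTensor S (CentralExt α) R} (hx : x ∈ grDR α n) :
    ∃ ρ : R, ∃ y ∈ grDRPos R α n, x = BalTensor.tmul S 1 ρ + y := by
  induction hx using AddSubgroup.closure_induction with
  | mem x hx =>
    obtain ⟨i, j, h, d, hd, r, hr, rfl⟩ := hx
    cases i with
    | zero =>
      obtain ⟨s, rfl⟩ := mem_deg_zero α hd
      refine ⟨s • r, 0, zero_mem _, ?_⟩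
      rw [add_zero, ← BalTensor.smul_tmul_eq, BalTensor.one_tmul_smul]
    | succ i =>
      refine ⟨0, _, AddSubgroup.subset_closure ⟨i + 1, j, h, i.succ_pos, d, hd, r, hr, rfl⟩, ?_⟩
      rw [BalTensor.tmul_zero, zero_add]
  | zero => exact ⟨0, 0, zero_mem _, by rw [BalTensor.tmul_zero, add_zero]⟩
  | add x y _ _ hx hy =>
    obtain ⟨ρ, x, hx, rfl⟩ := hx
    obtain ⟨ρ', y, hy, rfl⟩ := hy
    refine ⟨ρ + ρ', x + y, add_mem hx hy, ?_⟩
    rw [BalTensor.tmul_add]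
    abel
  | neg x _ hx =>
    obtain ⟨ρ, y, hy, rfl⟩ := hx
    refine ⟨-ρ, -y, neg_mem hy, ?_⟩
    rw [BalTensor.tmul_neg]
    abel

theorem baseChange_grDRPos {n : ℕ} {x : BalTensor S (CentralExt α) R}
    (hx : x ∈ grDRPos R α n) :
    BalTensor.baseChange (toBase α hR) (toBase_smul_one α hR) x ∈ AddSubgroup.closure
      {x | ∃ i, 0 < i ∧ ∃ a ∈ 𝒜 i, ∃ r : R, x = BalTensor.tmul S a r} := by
  induction hx using AddSubgroup.closure_induction with
  | mem x hx =>
    obtain ⟨i, j, h, hi, d, hd, r, hr, rfl⟩ := hx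
    rw [BalTensor.baseChange_tmul]
    exact AddSubgroup.subset_closure ⟨i, hi, _, toBase_mem hR α hd, r, rfl⟩
  | zero => rw [map_zero]; exact zero_mem _
  | add x y _ _ hx hy => rw [map_add]; exact add_mem hx hy
  | neg x _ hx => rw [map_neg]; exact neg_mem hx

/-- The difference between `ϑ₁ δ₂` and `d₂'` on `R`. -/
def defect : R →ₗ[S] BalTensor S (CentralExt α) (deg α 1) :=
  (((theta₁ hconn M).toLinearMap.comp M.delta₂ - relDiff hconn hR α).restrictScalars S).comp
    (((LinearMap.inl (CentralExt α) _ _).restrictScalars S).comp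
      (BalTensor.oneTmul S (CentralExt α) R))

theorem defect_apply (r : R) : defect hconn M r =
    theta₁ hconn M (M.delta₂ (BalTensor.tmul S 1 r, 0)) -
      relDiff hconn hR α (BalTensor.tmul S 1 r, 0) := rfl

variable (R α) in
/-- The `S`-submodule `(D ⊗ R)_n⁺ ⊕ (D ⊗ V)_{n-1}` of `M₂`. -/
def correction (n : ℕ) :
    Submodule S (BalTensor S (CentralExt α) R × BalTensor S (CentralExt α) (𝒜 1)) where
  toAddSubmonoid := ((grDRPos R α n).prod (shift (grDV α) n)).toAddSubmonoid
  smul_mem' s x hx := by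
    refine ⟨grDRPos_smul s hx.1, ?_⟩
    have h2 : x.2 ∈ shift (grDV α) n := hx.2
    cases n with
    | zero =>
      change s • x.2 = 0
      rw [show x.2 = 0 from h2, smul_zero]
    | succ n => exact BalTensor.smul_base_mem_deg s h2

theorem mem_correction {n : ℕ}
    {x : BalTensor S (CentralExt α) R × BalTensor S (CentralExt α) (𝒜 1)} :
    x ∈ correction R α n ↔ x.1 ∈ grDRPos R α n ∧ x.2 ∈ shift (grDV α) n := Iff.rfl

/-- The defect is a homogeneous cycle, so exactness over `D` gives a homogeneous preimage, whose
component in `D ⊗ R` is `1 ⊗ ρ` plus a part with left factors of positive degree. Reduction modulo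
`z` turns this into a relation among relations over `A`, and minimality of `R` gives `ρ = 0`. -/
theorem exists_correction (hstr : IsStronglyGraded 𝒜) (hA : Module.Projective S (𝒜 1))
    (hRproj : Module.Projective S R) {n : ℕ} {r : R}
    (hr : (r : TensorRing S (𝒜 1)) ∈ TensorRing.deg S (𝒜 1) n) :
    ∃ y ∈ correction R α n, relDiff hconn hR α y = defect hconn M r := by
  have hex := (isResolutionStart hconn hR α hstr hA hRproj).exact₂
  have hmem : ((BalTensor.tmul S 1 r, 0) :
      BalTensor S (CentralExt α) R × BalTensor S (CentralExt α) (𝒜 1)) ∈ grM₂ R α n :=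
    ⟨BalTensor.tmul_mem_deg (zero_add n) (one_mem_deg α) hr, zero_mem _⟩
  have h0 : d₁ (deg α 1) (defect hconn M r) = 0 := by
    rw [defect_apply, map_sub, d₁_theta₁, delta₁_delta₂, zero_sub, relDiff_apply,
      hex.apply_apply_eq_zero, neg_zero]
  have hdeg : defect hconn M r ∈ grDD α n := by
    rw [defect_apply]
    exact sub_mem (theta₁_mem hconn M (delta₂_mem M hmem)) (relDiff_mem hconn hR α hmem)
  obtain ⟨u, hu⟩ := (hex _).1 h0
  have hu' : relDiff hconn hR α ((relTensorEquiv hconn hR α).symm u) = defect hconn M r := by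
    rw [relDiff_apply, LinearEquiv.apply_symm_apply, hu]
  obtain ⟨⟨y₁, y₂⟩, hy, h⟩ := exists_homogeneous hconn hR α _ (hu' ▸ hdeg)
  rw [hu'] at h
  obtain ⟨ρ, y, hy', rfl⟩ := exists_grDRPos hy.1
  have hred := congrArg (reduce hconn hR α) h
  -- Both `δ₂` and `d₂'` reduce to `d₂` on `1 ⊗ r`, hence the defect reduces to zero.
  rw [reduce_relDiff, defect_apply, map_sub, delta₂_apply, reduce_theta₁, reduce_relDiff,
    smul_zero, sub_zero, M.lifts₂, sub_self, map_add, BalTensor.baseChange_tmul, map_one] at hred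
  have hρ := hR.eq_zero_of_d₂ hconn hstr ρ (baseChange_grDRPos hy') hred
  rw [hρ, BalTensor.tmul_zero, zero_add] at h
  exact ⟨(y, y₂), ⟨hy', hy.2⟩, h⟩

/-- Projectivity of `R` makes the choice of corrections `S`-linear; lifting each degree separately
keeps it graded. -/
theorem exists_correctionMap (hstr : IsStronglyGraded 𝒜) (hA : Module.Projective S (𝒜 1))
    (hRproj : Module.Projective S R) :
    ∃ η : R →ₗ[S] BalTensor S (CentralExt α) R × BalTensor S (CentralExt α) (𝒜 1),
      (∀ r, relDiff hconn hR α (η r) = defect hconn M r) ∧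
      ∀ n (r : R), (r : TensorRing S (𝒜 1)) ∈ TensorRing.deg S (𝒜 1) n →
        η r ∈ correction R α n := by
  -- The lift in degree `n` is defined on all of `R`, the module known to be projective, by
  -- composing the defect with the projection to degree `n`.
  have h : ∀ n, ∃ η : R →ₗ[S] correction R α n, ∀ r : R,
      relDiff hconn hR α (η r) = defect hconn M (FilteredMap.component hR.homogeneous n r) := by
    intro n
    let Δ : correction R α n →ₗ[S] BalTensor S (CentralExt α) (deg α 1) :=
      ((relDiff hconn hR α).restrictScalars S).comp (correction R α n).subtype
    let E : R →ₗ[S] LinearMap.range Δ := LinearMap.codRestrict _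
      ((defect hconn M).comp (FilteredMap.component hR.homogeneous n)) fun r => by
        obtain ⟨y, hy, h⟩ := exists_correction hconn M hstr hA hRproj
          (FilteredMap.component_mem hR.homogeneous n r)
        exact ⟨⟨y, hy⟩, h⟩
    obtain ⟨η, hη⟩ := Module.projective_lifting_property Δ.rangeRestrict E
      Δ.surjective_rangeRestrict
    exact ⟨η, fun r => congrArg Subtype.val (LinearMap.congr_fun hη r)⟩
  choose η hη using h
  have hη' : ∀ n (r : R), (r : TensorRing S (𝒜 1)) ∈ TensorRing.deg S (𝒜 1) n →
      FilteredMap.gradedSum hR.homogeneous (fun n => (correction R α n).subtype.comp (η n)) r =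
        η n r := fun n r hr => FilteredMap.gradedSum_of_mem hR.homogeneous _ hr
  refine ⟨FilteredMap.gradedSum hR.homogeneous fun n => (correction R α n).subtype.comp (η n),
    fun r => ?_, fun n r hr => ?_⟩
  · refine FilteredMap.homogeneous_induction hR.homogeneous (p := fun r => relDiff hconn hR α
      (FilteredMap.gradedSum hR.homogeneous (fun n => (correction R α n).subtype.comp (η n)) r) =
        defect hconn M r) (fun n r hr => ?_) (fun x y hx hy => ?_) r
    · rw [hη' n r hr, hη, FilteredMap.component_of_mem hR.homogeneous hr]
    · rw [map_add, map_add, hx, hy, map_add]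
  · rw [hη' n r hr]
    exact (η n r).2

/-! ### The filtration of `D ⊗ R` by the degree in `R`, and the construction of `ϑ₂`. -/

variable (R α) in
/-- The part of `D ⊗ R` generated by the `Dⁱ ⊗ Rʲ` with `j < m` and `i + j ∈ T`. -/
def filtDR (T : Set ℕ) (m : ℕ) : AddSubgroup (BalTensor S (CentralExt α) R) :=
  AddSubgroup.closure {x | ∃ i j, i + j ∈ T ∧ j < m ∧ ∃ d ∈ deg α i, ∃ r : R,
    (r : TensorRing S (𝒜 1)) ∈ TensorRing.deg S (𝒜 1) j ∧ x = BalTensor.tmul S d r}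

theorem filtDR_zero (T : Set ℕ) : filtDR R α T 0 = ⊥ := by
  rw [filtDR, AddSubgroup.closure_eq_bot_iff]
  rintro _ ⟨i, j, _, hj, _⟩
  exact absurd hj (Nat.not_lt_zero j)

theorem filtDR_mono (T : Set ℕ) : Monotone (filtDR R α T) := fun m m' h =>
  AddSubgroup.closure_mono (by
    rintro _ ⟨i, j, hT, hj, d, hd, r, hr, rfl⟩
    exact ⟨i, j, hT, hj.trans_le h, d, hd, r, hr, rfl⟩)

theorem grDR_le_filtDR (n : ℕ) : grDR α n ≤ filtDR R α {n} (n + 1) :=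
  AddSubgroup.closure_mono (by
    rintro _ ⟨i, j, h, d, hd, r, hr, rfl⟩
    exact ⟨i, j, h, by omega, d, hd, r, hr, rfl⟩)

theorem filtDR_le_grDR (n m : ℕ) : filtDR R α {n} m ≤ grDR α n :=
  AddSubgroup.closure_mono (by
    rintro _ ⟨i, j, h, _, d, hd, r, hr, rfl⟩
    exact ⟨i, j, h, d, hd, r, hr, rfl⟩)

/-- A left factor of positive degree leaves strictly less than `j` for the factor in `R`, and the
total degree is unchanged. -/
theorem smul_grDRPos_mem_filtDR {T : Set ℕ} {i j m : ℕ} (hT : i + j ∈ T) (hj : j < m + 1)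
    {d : CentralExt α} (hd : d ∈ deg α i) {x : BalTensor S (CentralExt α) R}
    (hx : x ∈ grDRPos R α j) : d • x ∈ filtDR R α T m := by
  induction hx using AddSubgroup.closure_induction with
  | mem x hx =>
    obtain ⟨k, l, h, hk, e, he, r, hr, rfl⟩ := hx
    rw [BalTensor.smul_tmul']
    refine AddSubgroup.subset_closure ⟨i + k, l, ?_, by omega, d * e,
      SetLike.mul_mem_graded hd he, r, hr, rfl⟩
    rwa [add_assoc, h]
  | zero => rw [smul_zero]; exact zero_mem _
  | add x y _ _ hx hy => rw [smul_add]; exact add_mem hx hy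
  | neg x _ hx => rw [smul_neg]; exact neg_mem hx

theorem exists_mem_grDR_filtDR (hR : IsRelationBimodule R) (x : BalTensor S (CentralExt α) R) :
    ∃ m, x ∈ filtDR R α Set.univ m := by
  have h := grM₂_induction hR α (p := fun x => ∃ m, x.1 ∈ filtDR R α Set.univ m)
    (fun n x hx => ⟨n + 1, ?_⟩) ?_ (x, 0)
  · exact h
  · refine AddSubgroup.closure_mono ?_ (grDR_le_filtDR n hx.1)
    rintro _ ⟨i, j, _, hj, d, hd, r, hr, rfl⟩
    exact ⟨i, j, Set.mem_univ _, hj, d, hd, r, hr, rfl⟩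
  · rintro x y ⟨m, hx⟩ ⟨m', hy⟩
    exact ⟨max m m', add_mem (filtDR_mono _ (le_max_left m m') hx)
      (filtDR_mono _ (le_max_right m m') hy)⟩

/-- The isomorphism is `relTensorEquiv ∘ Ψ`, where `Ψ` adds the correction on `R` and changes the
sign on `V`. Modulo the second summand `Ψ` is `1 + N`, with `N` strictly lowering the degree in `R`.
-/
theorem exists_theta₂ (hstr : IsStronglyGraded 𝒜) (hA : Module.Projective S (𝒜 1))
    (hRproj : Module.Projective S R) :
    ∃ θ₂ : (BalTensor S (CentralExt α) R × BalTensor S (CentralExt α) (𝒜 1)) ≃ₗ[CentralExt α]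
        BalTensor S (CentralExt α) (relD α),
      (∀ n x, x ∈ grM₂ R α n ↔ θ₂ x ∈ grDRD α n) ∧
      ∀ x, d₂ (deg α 1) (relD α) (θ₂ x) = theta₁ hconn M (M.delta₂ x) := by
  obtain ⟨η, hη, hηc⟩ := exists_correctionMap hconn M hstr hA hRproj
  let H : BalTensor S (CentralExt α) R →ₗ[CentralExt α]
      BalTensor S (CentralExt α) R × BalTensor S (CentralExt α) (𝒜 1) := BalTensor.lift η
  have hH : ∀ d r, H (BalTensor.tmul S d r) = d • η r := fun d r => BalTensor.lift_tmul _ _ _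
  let N : BalTensor S (CentralExt α) R →+ BalTensor S (CentralExt α) R :=
    ((LinearMap.fst (CentralExt α) _ _).comp H).toAddMonoidHom
  have hNapply : ∀ x, N x = (H x).1 := fun _ => rfl
  -- Two choices of `T` are used: `Set.univ` gives injectivity on inhomogeneous elements, and `{n}`
  -- gives surjectivity within a fixed degree.
  have hN : ∀ (T : Set ℕ) m, ∀ x ∈ filtDR R α T (m + 1), N x ∈ filtDR R α T m := by
    intro T m x hx
    induction hx using AddSubgroup.closure_induction with
    | mem x hx =>
      obtain ⟨i, j, hT, hj, d, hd, r, hr, rfl⟩ := hx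
      rw [hNapply, hH, Prod.smul_fst]
      exact smul_grDRPos_mem_filtDR hT hj hd (mem_correction.1 (hηc j r hr)).1
    | zero => rw [map_zero]; exact zero_mem _
    | add x y _ _ hx hy => rw [map_add]; exact add_mem hx hy
    | neg x _ hx => rw [map_neg]; exact neg_mem hx
  have hHgr : ∀ n, ∀ x ∈ grDR α n, H x ∈ grM₂ R α n := fun n x hx =>
    BalTensor.map_deg_mem (grM₂_smul α) H (fun j r hr => by
      rw [hH, one_smul]
      exact ⟨grDRPos_le j (hηc j r hr).1, (hηc j r hr).2⟩) hx
  -- The minus sign on the second summand absorbs the one in `theta₁_delta₂_right`.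
  let Ψ : (BalTensor S (CentralExt α) R × BalTensor S (CentralExt α) (𝒜 1)) →ₗ[CentralExt α]
      BalTensor S (CentralExt α) R × BalTensor S (CentralExt α) (𝒜 1) :=
    (LinearMap.inl (CentralExt α) _ _ + H).coprod (-LinearMap.inr (CentralExt α) _ _)
  have hΨ : ∀ x y, Ψ (x, y) = (x + N x, (H x).2 - y) := fun x y => by
    change ((x, 0) + H x) + -(0, y) = _
    refine Prod.ext ?_ ?_
    · change x + (H x).1 + -0 = x + N x
      rw [neg_zero, add_zero, hNapply]
    · change 0 + (H x).2 + -y = _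
      rw [zero_add, sub_eq_add_neg]
  have hΨmem : ∀ n, ∀ x ∈ grM₂ R α n, Ψ x ∈ grM₂ R α n := by
    rintro n ⟨x, y⟩ ⟨hx, hy⟩
    rw [hΨ]
    exact ⟨add_mem hx (hHgr n x hx).1, (shift (grDV α) n).sub_mem (hHgr n x hx).2 hy⟩
  have hΨinj : Function.Injective Ψ := by
    rw [← LinearMap.ker_eq_bot, LinearMap.ker_eq_bot']
    rintro ⟨x, y⟩ h
    rw [hΨ] at h
    obtain ⟨m, hm⟩ := exists_mem_grDR_filtDR hR x
    have hx : x = 0 := eq_zero_of_add_eq_zero_of_lowering N _ (filtDR_zero _) (hN _) hm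
      (congrArg Prod.fst h)
    have hy := congrArg Prod.snd h
    simp only [hx, map_zero, Prod.snd_zero, zero_sub, neg_eq_zero] at hy
    rw [hx, hy]
    rfl
  -- Surjectivity is needed degree by degree: with injectivity it also shows that `Ψ` reflects
  -- degrees.
  have hΨsurj : ∀ n, ∀ x ∈ grM₂ R α n, ∃ y ∈ grM₂ R α n, Ψ y = x := by
    rintro n ⟨a, b⟩ ⟨ha, hb⟩
    obtain ⟨x, hx, h⟩ := exists_add_eq_of_lowering N _ (filtDR_zero _) (filtDR_mono _) (hN _)
      (grDR_le_filtDR n ha)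
    have hx' := filtDR_le_grDR n _ hx
    refine ⟨(x, (H x).2 - b), ⟨hx', (shift (grDV α) n).sub_mem (hHgr n x hx').2 hb⟩, ?_⟩
    rw [hΨ, h, sub_sub_cancel]
  have hΨsurj' : Function.Surjective Ψ := fun x =>
    grM₂_induction hR α (p := fun x => ∃ y, Ψ y = x)
      (fun n x hx => (hΨsurj n x hx).imp fun _ h => h.2)
      (by rintro _ _ ⟨x, rfl⟩ ⟨y, rfl⟩; exact ⟨x + y, map_add _ _ _⟩) x
  have hcomm : (relDiff hconn hR α).comp Ψ = (theta₁ hconn M).toLinearMap.comp M.delta₂ := by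
    refine LinearMap.prod_ext (BalTensor.linearMap_ext fun r => ?_)
      (BalTensor.linearMap_ext fun v => ?_)
    · change relDiff hconn hR α (Ψ (BalTensor.tmul S 1 r, 0)) =
        theta₁ hconn M (M.delta₂ (BalTensor.tmul S 1 r, 0))
      have h : Ψ (BalTensor.tmul S 1 r, 0) = (BalTensor.tmul S 1 r, 0) + η r := by
        rw [hΨ, hNapply, hH, one_smul, sub_zero]
        exact Prod.ext rfl (zero_add _).symm
      rw [h, map_add, hη, defect_apply, add_sub_cancel]
    · change relDiff hconn hR α (Ψ (0, BalTensor.tmul S 1 v)) =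
        theta₁ hconn M (M.delta₂ (0, BalTensor.tmul S 1 v))
      have h : Ψ (0, BalTensor.tmul S 1 v) = -(0, BalTensor.tmul S 1 v) := by
        rw [hΨ, map_zero, map_zero]
        exact Prod.ext (by simp) (by simp)
      rw [h, map_neg, theta₁_delta₂_right]
  refine ⟨(LinearEquiv.ofBijective Ψ ⟨hΨinj, hΨsurj'⟩).trans (relTensorEquiv hconn hR α),
    fun n x => ⟨fun hx => relTensorEquiv_mem hconn hR α (hΨmem n x hx), fun hx => ?_⟩,
    fun x => LinearMap.congr_fun hcomm x⟩
  have h := relTensorEquiv_symm_mem hconn hR α hx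
  rw [LinearEquiv.trans_apply, LinearEquiv.symm_apply_apply] at h
  obtain ⟨y, hy, hxy⟩ := hΨsurj n _ h
  rwa [← hΨinj hxy]

include hconn in
theorem exists_isomorphism (hstr : IsStronglyGraded 𝒜) (hA : Module.Projective S (𝒜 1))
    (hRproj : Module.Projective S R) :
    (∃ (θ₁ : (BalTensor S (CentralExt α) (𝒜 1) × CentralExt α) ≃ₗ[CentralExt α]
            BalTensor S (CentralExt α) (deg α 1))
        (θ₂ : (BalTensor S (CentralExt α) R × BalTensor S (CentralExt α) (𝒜 1))
          ≃ₗ[CentralExt α] BalTensor S (CentralExt α) (relD α)),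
      (∀ n x, x ∈ grM₁ R α n ↔ θ₁ x ∈ grDD α n) ∧
      (∀ n x, x ∈ grM₂ R α n ↔ θ₂ x ∈ grDRD α n) ∧
      (∀ x, d₁ (deg α 1) (θ₁ x) = M.delta₁ x) ∧
      (∀ x, d₂ (deg α 1) (relD α) (θ₂ x) = θ₁ (M.delta₂ x))) ∧
    Function.Exact M.delta₂ M.delta₁ := by
  obtain ⟨θ₂, h₂, hd⟩ := exists_theta₂ hconn M hstr hA hRproj
  refine ⟨⟨theta₁ hconn M, θ₂, fun n x => ⟨theta₁_mem hconn M, fun hx => ?_⟩, h₂,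
    d₁_theta₁ hconn M, hd⟩, fun y => ⟨fun hy => ?_, ?_⟩⟩
  · have := theta₁_symm_mem hconn M hx
    rwa [LinearEquiv.symm_apply_apply] at this
  · rw [← d₁_theta₁ hconn M] at hy
    obtain ⟨u, hu⟩ := ((isResolutionStart hconn hR α hstr hA hRproj).exact₂ _).1 hy
    obtain ⟨x, rfl⟩ := θ₂.surjective u
    rw [hd] at hu
    exact ⟨x, (theta₁ hconn M).injective hu⟩
  · rintro ⟨x, rfl⟩
    exact delta₁_delta₂ M x

end CentralExt

end PBW

end
theorem mainTheorem7 {S A : Type*} [Ring S] [Ring A] [Module S A] [IsScalarTower S A A]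
    (𝒜 : ℕ → Submodule S A) [GradedRing 𝒜]
    (hconn : PBW.IsConnected 𝒜) (hstr : PBW.IsStronglyGraded 𝒜)
    (hA : Module.Projective S (𝒜 1))
    (R : Submodule S (PBW.TensorRing S (𝒜 1))) [PBW.IsSubbimodule R]
    (hR : PBW.IsRelationBimodule R) (hRproj : Module.Projective S R)
    (α : PBW.FilteredMap R) :
    -- the canonical sequence `A ⊗ R → A ⊗ A¹ → A → S → 0` starts a projective resolution
    PBW.IsResolutionStart (PBW.d₂ (𝒜 1) R) (PBW.d₁ (𝒜 1)) (PBW.augmentation 𝒜 hconn) ∧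
    -- the sum `R_D = λ(P_z) + [z, A¹]` is direct
    Disjoint (PBW.CentralExt.lamPz α) (PBW.CentralExt.commZ α) ∧
    -- the sequence `D ⊗ R_D → D ⊗ D¹ → D → S → 0` starts a projective resolution
    PBW.IsResolutionStart
      (PBW.d₂ (PBW.CentralExt.deg α 1) (PBW.CentralExt.relD α))
      (PBW.d₁ (PBW.CentralExt.deg α 1))
      ((PBW.augmentation 𝒜 hconn).comp (PBW.CentralExt.toBase α hR)) ∧
    -- the sequence `¹M` can be formed
    Nonempty (PBW.OneM α hR) ∧
    -- and, however it is formed, it is isomorphic to the previous one, and `H₁(¹M) = 0`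
    ∀ M : PBW.OneM α hR,
      (∃ (θ₁ : (PBW.BalTensor S (PBW.CentralExt α) (𝒜 1) × PBW.CentralExt α)
            ≃ₗ[PBW.CentralExt α]
              PBW.BalTensor S (PBW.CentralExt α) (PBW.CentralExt.deg α 1))
          (θ₂ : (PBW.BalTensor S (PBW.CentralExt α) R ×
              PBW.BalTensor S (PBW.CentralExt α) (𝒜 1))
            ≃ₗ[PBW.CentralExt α]
              PBW.BalTensor S (PBW.CentralExt α) (PBW.CentralExt.relD α)),
        (∀ n x, x ∈ PBW.grM₁ R α n ↔ θ₁ x ∈ PBW.grDD α n) ∧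
        (∀ n x, x ∈ PBW.grM₂ R α n ↔ θ₂ x ∈ PBW.grDRD α n) ∧
        (∀ x, PBW.d₁ (PBW.CentralExt.deg α 1) (θ₁ x) = M.delta₁ x) ∧
        (∀ x, PBW.d₂ (PBW.CentralExt.deg α 1) (PBW.CentralExt.relD α) (θ₂ x)
          = θ₁ (M.delta₂ x))) ∧
      Function.Exact M.delta₂ M.delta₁ :=
  ⟨PBW.isResolutionStart hconn hstr hA hR hRproj, PBW.CentralExt.disjoint_lamPz_commZ hconn hR α,
    PBW.CentralExt.isResolutionStart hconn hR α hstr hA hRproj,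
    ⟨PBW.CentralExt.stdOneM hconn hR α⟩,
    fun M => PBW.CentralExt.exists_isomorphism hconn M hstr hA hRproj⟩
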